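/- Let $N\cong\mathbb{Z}^d$ be a lattice with dual lattice $M=\mathrm{Hom}_{\mathbb{Z}}(N,\mathbb{Z})$ and pairing $\langle\cdot,\cdot\rangle$, let $\triangle$ be a complete fan in $N_{\mathbb{R}}=N\otimes_{\mathbb Z}\mathbb{R}$, and let $X=X(N,\triangle)$ be the associated $d$-dimensional complete toric variety over $\mathbb{C}$. For a ray $\tau\in\triangle(1)$ let $v_\tau$ be the generator of the semigroup $\tau\cap N$. The set of Demazure roots of $\triangle$ is \[\mathcal{R}=\{m\in M : \exists\,\tau\in\triangle(1)\text{ with }\langle v_\tau,m\rangle=-1\text{ and }\langle v_{\tau'},m\rangle\ge 0\ \ \forall\,\tau'\in\triangle(1)\setminus\{\tau\}\},\] and $\mathcal{S}=\mathcal{R}\cap(-\mathcal{R})$ is the set of semisimple roots. Let $\mathbb{C}[x_\tau:\tau\in\triangle(1)]$ be the homogeneous coordinate ring (Cox ring) of $X$, graded by the divisor class group $\mathrm{Cl}(X)=\mathbb{Z}^{\triangle(1)}/\{(\langle v_\tau,m\rangle)_\tau : m\in M\}$ so that the degree of $\prod_\tau x_\tau^{k_\tau}$ is the class of $(k_\tau)_\tau$.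 Partition the set of variables into classes of variables of equal degree, and let $Y_1,\dots,Y_q$ be those classes that have at least two elements. Then $X$ is isomorphic (as a variety over $\mathbb{C}$) to a product of projective spaces $\mathbb{P}^{n_1}\times\cdots\times\mathbb{P}^{n_k}$ over $\mathbb{C}$ if and only if $\mathcal{S}$ contains $d$ elements that are linearly independent in $M_{\mathbb{R}}$. In this case \[X\cong\mathbb{P}^{|Y_1|-1}\times\cdots\times\mathbb{P}^{|Y_q|-1}.\] (An empty product is a point.) -/

import Mathlib

open CategoryTheory CategoryTheory.Limits AlgebraicGeometry
open scoped TensorProduct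

noncomputable section

namespace ToricGeometry

/-! ### Cones and fans

`N` is a lattice, `Module.Dual ℤ N` is the dual lattice `M`, and `ℝ ⊗[ℤ] N` is `N_ℝ`. -/

section Fans

variable {N : Type} [AddCommGroup N]

/-- The real extension of the pairing: the linear functional on `N_ℝ` defined by `m ∈ M`. -/
def realFunctional (m : Module.Dual ℤ N) : (ℝ ⊗[ℤ] N) →ₗ[ℝ] ℝ :=
  Module.Dual.baseChange ℝ m

/-- The image in `N_ℝ` of a lattice point. -/
def latticePoint (n : N) : ℝ ⊗[ℤ] N := (1 : ℝ) ⊗ₜ[ℤ] n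

lemma realFunctional_latticePoint (m : Module.Dual ℤ N) (n : N) :
    realFunctional m (latticePoint n) = (m n : ℝ) := by
  simp [realFunctional, latticePoint]

lemma realFunctional_add (m m' : Module.Dual ℤ N) (x : ℝ ⊗[ℤ] N) :
    realFunctional (m + m') x = realFunctional m x + realFunctional m' x := by
  simp [realFunctional]

lemma realFunctional_zero (x : ℝ ⊗[ℤ] N) :
    realFunctional (0 : Module.Dual ℤ N) x = 0 := by
  simp [realFunctional]

/-- A rational polyhedral cone: generated by finitely many lattice points. -/
def IsRationalPolyhedral (σ : PointedCone ℝ (ℝ ⊗[ℤ] N)) : Prop :=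
  ∃ s : Finset N, σ = PointedCone.hull ℝ (latticePoint '' (s : Set N))

/-- `τ` is a face of the (rational polyhedral) cone `σ`: `τ = σ ∩ m^⊥` for some `m ∈ σ^∨ ∩ M`. -/
def IsFace (τ σ : PointedCone ℝ (ℝ ⊗[ℤ] N)) : Prop :=
  ∃ m : Module.Dual ℤ N, (∀ x ∈ σ, 0 ≤ realFunctional m x) ∧
    ∀ x, x ∈ τ ↔ x ∈ σ ∧ realFunctional m x = 0

variable (N) in
/-- A fan in `N_ℝ`: a finite set of strongly convex rational polyhedral cones, closed under taking
faces, in which any two cones meet in a common face. -/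
structure Fan where
  cones : Set (PointedCone ℝ (ℝ ⊗[ℤ] N))
  finite : cones.Finite
  rational : ∀ σ ∈ cones, IsRationalPolyhedral σ
  salient : ∀ σ ∈ cones, σ.toConvexCone.Salient
  face_mem : ∀ σ ∈ cones, ∀ τ, IsFace τ σ → τ ∈ cones
  inter_face : ∀ σ ∈ cones, ∀ τ ∈ cones, IsFace (σ ⊓ τ) σ

namespace Fan

variable (Δ : Fan N)

/-- A fan is complete if its cones cover `N_ℝ`. -/
def IsComplete : Prop := ∀ x : ℝ ⊗[ℤ] N, ∃ σ ∈ Δ.cones, x ∈ σ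

/-- The cones of the fan, ordered by inclusion (equivalently, by the face relation). -/
abbrev Cone : Type := {σ : PointedCone ℝ (ℝ ⊗[ℤ] N) // σ ∈ Δ.cones}

lemma isFace_of_le {τ σ : Δ.Cone} (h : τ ≤ σ) : IsFace τ.1 σ.1 := by
  have h1 := Δ.inter_face σ.1 σ.2 τ.1 τ.2
  rwa [inf_eq_right.mpr (show τ.1 ≤ σ.1 from h)] at h1

/-- The intersection of two cones of the fan. -/
def inter (τ σ : Δ.Cone) : Δ.Cone :=
  ⟨τ.1 ⊓ σ.1, Δ.face_mem τ.1 τ.2 _ (Δ.inter_face τ.1 τ.2 σ.1 σ.2)⟩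

end Fan

end Fans

/-! ### The toric variety of a fan -/

section ToricVariety

variable {N : Type} [AddCommGroup N]

/-- The semigroup `σ^∨ ∩ M`. -/
def dualSemigroup (σ : PointedCone ℝ (ℝ ⊗[ℤ] N)) : AddSubmonoid (Module.Dual ℤ N) where
  carrier := {m | ∀ x ∈ σ, 0 ≤ realFunctional m x}
  zero_mem' := fun x _ => (realFunctional_zero x).ge
  add_mem' := fun ha hb x hx => by
    rw [realFunctional_add]; exact add_nonneg (ha x hx) (hb x hx)

lemma dualSemigroup_anti {τ σ : PointedCone ℝ (ℝ ⊗[ℤ] N)} (h : τ ≤ σ) :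
    dualSemigroup σ ≤ dualSemigroup τ := fun _ hm x hx => hm x (h hx)

/-- The semigroup algebra `ℂ[σ^∨ ∩ M]`. -/
abbrev coneAlgebra (σ : PointedCone ℝ (ℝ ⊗[ℤ] N)) : Type :=
  AddMonoidAlgebra ℂ (dualSemigroup σ)

/-- For `τ ⊆ σ`, the inclusion `ℂ[σ^∨ ∩ M] → ℂ[τ^∨ ∩ M]`. -/
def coneAlgebraMap {τ σ : PointedCone ℝ (ℝ ⊗[ℤ] N)} (h : τ ≤ σ) :
    coneAlgebra σ →+* coneAlgebra τ :=
  AddMonoidAlgebra.mapDomainRingHom ℂ (AddSubmonoid.inclusion (dualSemigroup_anti h))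

lemma coneAlgebraMap_single {τ σ : PointedCone ℝ (ℝ ⊗[ℤ] N)} (h : τ ≤ σ)
    (u : dualSemigroup σ) (r : ℂ) :
    coneAlgebraMap h (AddMonoidAlgebra.single u r) =
      AddMonoidAlgebra.single (AddSubmonoid.inclusion (dualSemigroup_anti h) u) r := by
  simp [coneAlgebraMap]

lemma coneAlgebraMap_injective {τ σ : PointedCone ℝ (ℝ ⊗[ℤ] N)} (h : τ ≤ σ) :
    Function.Injective (coneAlgebraMap h) :=
  AddMonoidAlgebra.mapDomain_injective (AddSubmonoid.inclusion_injective _)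

/-- The separation property behind the gluing: if `τ = σ ∩ m^⊥`, then every `u ∈ τ^∨ ∩ M` becomes
an element of `σ^∨ ∩ M` after adding a multiple of `m`. -/
lemma exists_add_nsmul_mem {τ σ : PointedCone ℝ (ℝ ⊗[ℤ] N)} (hσ : IsRationalPolyhedral σ)
    {m : Module.Dual ℤ N} (hm : m ∈ dualSemigroup σ)
    (hτ : ∀ x, x ∈ τ ↔ x ∈ σ ∧ realFunctional m x = 0)
    {u : Module.Dual ℤ N} (hu : u ∈ dualSemigroup τ) :
    ∃ k : ℕ, u + k • m ∈ dualSemigroup σ := by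
  obtain ⟨s, rfl⟩ := hσ
  refine ⟨∑ n ∈ s, (u n).natAbs, fun x hx => ?_⟩
  set k := ∑ n ∈ s, (u n).natAbs with hk
  have key : ∀ n ∈ s, 0 ≤ (u + k • m) n := by
    intro n hn
    have hmem : latticePoint n ∈
        PointedCone.hull ℝ (latticePoint '' (s : Set N)) :=
      PointedCone.subset_hull ⟨n, hn, rfl⟩
    have h0 : 0 ≤ m n := by
      have := hm _ hmem
      rw [realFunctional_latticePoint] at this
      exact_mod_cast this
    have happ : (u + k • m) n = u n + k * m n := by simp
    rw [happ]
    rcases h0.eq_or_lt with h | h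
    · have h2 : latticePoint n ∈ τ := (hτ _).2 ⟨hmem, by
        rw [realFunctional_latticePoint, ← h]; simp⟩
      have h3 := hu _ h2
      rw [realFunctional_latticePoint] at h3
      have h4 : 0 ≤ u n := by exact_mod_cast h3
      rw [← h]; simpa using h4
    · have h5 : (u n).natAbs ≤ k :=
        Finset.single_le_sum (f := fun n => (u n).natAbs) (fun _ _ => Nat.zero_le _) hn
      have h6 : (k : ℤ) ≤ k * m n := by nlinarith [Int.natCast_nonneg k]
      omega
  induction hx using Submodule.span_induction with
  | mem x h =>
    obtain ⟨n, hn, rfl⟩ := h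
    rw [realFunctional_latticePoint]
    exact_mod_cast key n hn
  | zero => simp
  | add x y _ _ hx hy => rw [map_add]; exact add_nonneg hx hy
  | smul a x _ hx =>
    have : a • x = (a : ℝ) • x := rfl
    rw [this, map_smul]
    exact mul_nonneg a.2 hx

/-- If `τ = σ ∩ m^⊥`, then `ℂ[τ^∨ ∩ M]` is the localization of `ℂ[σ^∨ ∩ M]` at the character
of `m`. -/
lemma isLocalization_face {τ σ : PointedCone ℝ (ℝ ⊗[ℤ] N)} (hσ : IsRationalPolyhedral σ)
    {m : Module.Dual ℤ N} (hm : m ∈ dualSemigroup σ)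
    (hτ : ∀ x, x ∈ τ ↔ x ∈ σ ∧ realFunctional m x = 0) (h : τ ≤ σ) :
    letI := (coneAlgebraMap h).toAlgebra
    IsLocalization.Away (AddMonoidAlgebra.single (⟨m, hm⟩ : dualSemigroup σ) (1 : ℂ))
      (coneAlgebra τ) := by
  letI := (coneAlgebraMap h).toAlgebra
  have hneg : -m ∈ dualSemigroup τ := fun x hx => by
    have h1 := realFunctional_add m (-m) x
    rw [add_neg_cancel, realFunctional_zero, ((hτ x).1 hx).2, zero_add] at h1
    exact h1.le
  have halg : ∀ f, algebraMap (coneAlgebra σ) (coneAlgebra τ) f = coneAlgebraMap h f :=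
    fun _ => rfl
  refine IsLocalization.Away.mk _ ?_ ?_ ?_
  · rw [halg, coneAlgebraMap_single]
    refine IsUnit.of_mul_eq_one (AddMonoidAlgebra.single ⟨-m, hneg⟩ 1) ?_
    rw [AddMonoidAlgebra.single_mul_single, AddMonoidAlgebra.one_def]
    congr 1
    · exact Subtype.ext (add_neg_cancel m)
    · exact one_mul 1
  · intro f
    induction f using AddMonoidAlgebra.induction_linear with
    | zero => exact ⟨0, 0, by simp⟩
    | add f g hf hg =>
      obtain ⟨a, f', hf⟩ := hf
      obtain ⟨b, g', hg⟩ := hg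
      refine ⟨a + b, f' * AddMonoidAlgebra.single ⟨m, hm⟩ 1 ^ b +
        g' * AddMonoidAlgebra.single ⟨m, hm⟩ 1 ^ a, ?_⟩
      rw [map_add, map_mul, map_mul, ← hf, ← hg, map_pow, map_pow, pow_add]
      ring
    | single u r =>
      obtain ⟨k, hk⟩ := exists_add_nsmul_mem hσ hm hτ u.2
      refine ⟨k, AddMonoidAlgebra.single ⟨_, hk⟩ r, ?_⟩
      rw [halg, halg, coneAlgebraMap_single, coneAlgebraMap_single, AddMonoidAlgebra.single_pow,
        AddMonoidAlgebra.single_mul_single, one_pow, mul_one]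
      rfl
  · intro a b hab
    exact ⟨0, by rw [coneAlgebraMap_injective h hab]⟩

/-- The affine toric variety `U_σ = Spec ℂ[σ^∨ ∩ M]`. -/
abbrev affineToric (σ : PointedCone ℝ (ℝ ⊗[ℤ] N)) : Scheme.{0} :=
  Spec (CommRingCat.of (coneAlgebra σ))

/-- The morphism `U_τ → U_σ` for `τ ⊆ σ`. -/
def affineToricMap {τ σ : PointedCone ℝ (ℝ ⊗[ℤ] N)} (h : τ ≤ σ) :
    affineToric τ ⟶ affineToric σ :=
  Spec.map (CommRingCat.ofHom (coneAlgebraMap h))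

lemma isOpenImmersion_affineToricMap {τ σ : PointedCone ℝ (ℝ ⊗[ℤ] N)}
    (hσ : IsRationalPolyhedral σ) (hτ : IsFace τ σ) (h : τ ≤ σ) :
    IsOpenImmersion (affineToricMap h) := by
  obtain ⟨m, hm, hτ⟩ := hτ
  letI := (coneAlgebraMap h).toAlgebra
  haveI := isLocalization_face hσ (m := m) hm hτ h
  exact IsOpenImmersion.of_isLocalization
    (AddMonoidAlgebra.single (⟨m, hm⟩ : dualSemigroup σ) (1 : ℂ))

lemma range_affineToricMap {τ σ : PointedCone ℝ (ℝ ⊗[ℤ] N)} (hσ : IsRationalPolyhedral σ)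
    {m : Module.Dual ℤ N} (hm : m ∈ dualSemigroup σ)
    (hτ : ∀ x, x ∈ τ ↔ x ∈ σ ∧ realFunctional m x = 0) (h : τ ≤ σ) :
    Set.range (affineToricMap h) =
      (PrimeSpectrum.basicOpen (AddMonoidAlgebra.single (⟨m, hm⟩ : dualSemigroup σ) (1 : ℂ)) :
        Set (PrimeSpectrum (coneAlgebra σ))) := by
  letI := (coneAlgebraMap h).toAlgebra
  haveI := isLocalization_face hσ (m := m) hm hτ h
  exact PrimeSpectrum.localization_away_comap_range (coneAlgebra τ)
    (AddMonoidAlgebra.single (⟨m, hm⟩ : dualSemigroup σ) (1 : ℂ))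

/-- The structure morphism `U_σ → Spec ℂ`. -/
def affineToricStructure (σ : PointedCone ℝ (ℝ ⊗[ℤ] N)) :
    affineToric σ ⟶ Spec (CommRingCat.of ℂ) :=
  Spec.map (CommRingCat.ofHom (algebraMap ℂ (coneAlgebra σ)))

namespace Fan

variable (Δ : Fan N)

/-- The diagram of the affine toric varieties `U_σ`, `σ ∈ Δ`, and the open immersions
`U_τ → U_σ` for `τ ≤ σ`. -/
def diagram : Δ.Cone ⥤ Scheme.{0} where
  obj σ := affineToric σ.1
  map {τ σ} f := affineToricMap (show τ.1 ≤ σ.1 from leOfHom f)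
  map_id σ := by
    have : coneAlgebraMap (le_refl σ.1) = RingHom.id _ := by
      refine RingHom.ext fun f => ?_
      induction f using AddMonoidAlgebra.induction_linear with
      | zero => simp
      | add f g hf hg => rw [map_add, map_add, hf, hg]
      | single u r => rw [coneAlgebraMap_single]; rfl
    simp only [affineToricMap, this]
    exact Spec.map_id _
  map_comp {ρ τ σ} f g := by
    simp only [affineToricMap, ← Spec.map_comp, ← CommRingCat.ofHom_comp]
    congr 2
    refine RingHom.ext fun f => ?_
    induction f using AddMonoidAlgebra.induction_linear with
    | zero => simp
    | add f g hf hg => rw [map_add, map_add, hf, hg]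
    | single u r =>
      rw [RingHom.comp_apply, coneAlgebraMap_single, coneAlgebraMap_single,
        coneAlgebraMap_single]
      rfl

instance isOpenImmersion_diagram {τ σ : Δ.Cone} (f : τ ⟶ σ) :
    IsOpenImmersion (Δ.diagram.map f) :=
  isOpenImmersion_affineToricMap (Δ.rational σ.1 σ.2) (Δ.isFace_of_le (leOfHom f)) (leOfHom f)

instance isLocallyDirected_diagram : (Δ.diagram ⋙ Scheme.forget).IsLocallyDirected where
  cond := by
    intro i j k fi fj xi xj hx
    obtain ⟨mi, hmi, hi⟩ := Δ.isFace_of_le (leOfHom fi)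
    obtain ⟨mj, hmj, hj⟩ := Δ.isFace_of_le (leOfHom fj)
    have hik : i.1 ≤ k.1 := leOfHom fi
    have hjk : j.1 ≤ k.1 := leOfHom fj
    let l := Δ.inter i j
    have hli : l ≤ i := show i.1 ⊓ j.1 ≤ i.1 from inf_le_left
    have hlj : l ≤ j := show i.1 ⊓ j.1 ≤ j.1 from inf_le_right
    have hlk : l.1 ≤ k.1 := le_trans hli hik
    have hm : mi + mj ∈ dualSemigroup k.1 := (dualSemigroup k.1).add_mem hmi hmj
    have hl : ∀ x, x ∈ l.1 ↔ x ∈ k.1 ∧ realFunctional (mi + mj) x = 0 := by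
      intro x
      rw [show x ∈ l.1 ↔ x ∈ i.1 ∧ x ∈ j.1 from Iff.rfl, hi, hj, realFunctional_add]
      constructor
      · rintro ⟨⟨h1, h2⟩, -, h3⟩
        exact ⟨h1, by rw [h2, h3, add_zero]⟩
      · rintro ⟨h1, h2⟩
        have := hmi x h1
        have := hmj x h1
        exact ⟨⟨h1, by linarith⟩, h1, by linarith⟩
    have hrat := Δ.rational k.1 k.2
    have ri := range_affineToricMap hrat (m := mi) hmi hi hik
    have rj := range_affineToricMap hrat (m := mj) hmj hj hjk
    have rl := range_affineToricMap hrat hm hl hlk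
    have hx' : affineToricMap hik xi = affineToricMap hjk xj := hx
    have h1 : affineToricMap hik xi ∈ Set.range (affineToricMap hik) := ⟨xi, rfl⟩
    have h2 : affineToricMap hik xi ∈ Set.range (affineToricMap hjk) := hx' ▸ ⟨xj, rfl⟩
    have h3 : affineToricMap hik xi ∈ Set.range (affineToricMap hlk) := by
      rw [rl]
      rw [ri] at h1
      rw [rj] at h2
      have hmul : (AddMonoidAlgebra.single (⟨mi + mj, hm⟩ : dualSemigroup k.1) (1 : ℂ)) =
          AddMonoidAlgebra.single (⟨mi, hmi⟩ : dualSemigroup k.1) (1 : ℂ) *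
            AddMonoidAlgebra.single (⟨mj, hmj⟩ : dualSemigroup k.1) (1 : ℂ) := by
        rw [AddMonoidAlgebra.single_mul_single, one_mul]
        rfl
      rw [hmul, PrimeSpectrum.basicOpen_mul]
      exact ⟨h1, h2⟩
    obtain ⟨y, hy⟩ := h3
    have ci : Δ.diagram.map (homOfLE hli) ≫ Δ.diagram.map fi = affineToricMap hlk := by
      rw [← Δ.diagram.map_comp]; rfl
    have cj : Δ.diagram.map (homOfLE hlj) ≫ Δ.diagram.map fj = affineToricMap hlk := by
      rw [← Δ.diagram.map_comp]; rfl
    refine ⟨l, homOfLE hli, homOfLE hlj, y, ?_, ?_⟩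
    · apply (Δ.diagram.map fi).isOpenEmbedding.injective
      change (Δ.diagram.map fi) ((Δ.diagram.map (homOfLE hli)) y) = affineToricMap hik xi
      rw [← hy, ← ci]; rfl
    · apply (Δ.diagram.map fj).isOpenEmbedding.injective
      change (Δ.diagram.map fj) ((Δ.diagram.map (homOfLE hlj)) y) = affineToricMap hjk xj
      rw [← hx', ← hy, ← cj]; rfl

/-- The structure morphisms `U_σ → Spec ℂ`, as a cocone on the diagram. -/
def structureCocone : Cocone Δ.diagram where
  pt := Spec (CommRingCat.of ℂ)
  ι :=
    { app := fun σ => affineToricStructure σ.1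
      naturality := fun τ σ f => by
        simp only [diagram, affineToricStructure, affineToricMap, ← Spec.map_comp,
          ← CommRingCat.ofHom_comp, Functor.const_obj_obj, Functor.const_obj_map,
          Category.comp_id]
        congr 2
        refine RingHom.ext fun r => ?_
        simp [coneAlgebraMap] }

/-- The toric variety `X(N, Δ)`, as a scheme over `ℂ`: the affine toric varieties `U_σ`, `σ ∈ Δ`,
glued along the open subschemes `U_τ ⊆ U_σ` for the faces `τ` of `σ`. -/
def toricVariety : Over (Spec (CommRingCat.of ℂ)) :=
  Over.mk (colimit.desc Δ.diagram Δ.structureCocone)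

end Fan

end ToricVariety

/-! ### Projective spaces and their products -/

attribute [local instance] MvPolynomial.gradedAlgebra

/-- Projective space `ℙ^n = Proj ℂ[x_0, …, x_n]` over `ℂ`. -/
def projectiveSpace (n : ℕ) : Over (Spec (CommRingCat.of ℂ)) :=
  Over.mk
    (Proj.toSpecZero (MvPolynomial.homogeneousSubmodule (Fin (n + 1)) ℂ) ≫
      Spec.map (CommRingCat.ofHom
        (algebraMap ℂ (MvPolynomial.homogeneousSubmodule (Fin (n + 1)) ℂ 0))))

/-- The product of the projective spaces `ℙ^(n i)`, `i ∈ I`, over `ℂ`. -/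
def productOfProjectiveSpaces {I : Type} [Finite I] (n : I → ℕ) :
    Over (Spec (CommRingCat.of ℂ)) :=
  ∏ᶜ fun i => projectiveSpace (n i)

/-! ### Rays, Demazure roots and the homogeneous coordinate ring -/

section Roots

variable {N : Type} [AddCommGroup N] [Module.Free ℤ N] [Module.Finite ℤ N]

lemma latticePoint_injective : Function.Injective (latticePoint (N := N)) := by
  intro a b h
  by_contra hne
  obtain ⟨f, hf⟩ : ∃ f : Module.Dual ℤ N, f (a - b) ≠ 0 := by
    by_contra hall
    push Not at hall
    exact hne (sub_eq_zero.mp ((Module.forall_dual_apply_eq_zero_iff ℤ (a - b)).mp hall))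
  have h1 := realFunctional_latticePoint f a
  rw [h, realFunctional_latticePoint] at h1
  apply hf
  rw [map_sub, sub_eq_zero]
  exact_mod_cast h1.symm

lemma latticePoint_sub (a b : N) : latticePoint (a - b) = latticePoint a - latticePoint b := by
  simp [latticePoint, TensorProduct.tmul_sub]

lemma latticePoint_zsmul (k : ℤ) (a : N) : latticePoint (k • a) = (k : ℝ) • latticePoint a := by
  simp [latticePoint, TensorProduct.tmul_smul, TensorProduct.smul_tmul']

namespace Fan

variable (Δ : Fan N)

/-- The rays `Δ(1)`: the one-dimensional cones of the fan. -/
def Ray : Type :=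
  {ρ : Δ.Cone // Module.finrank ℝ (Submodule.span ℝ (ρ.1 : Set (ℝ ⊗[ℤ] N))) = 1}

/-- The cone underlying a ray. -/
def Ray.cone {Δ : Fan N} (ρ : Δ.Ray) : PointedCone ℝ (ℝ ⊗[ℤ] N) := ρ.1.1

instance finite_ray : Finite Δ.Ray :=
  haveI : Finite Δ.Cone := Δ.finite.to_subtype
  inferInstanceAs (Finite (Subtype _))

/-- The semigroup `ρ ∩ N` of a ray is generated by a unique element. -/
lemma existsUnique_generator (ρ : Δ.Ray) :
    ∃! v : N, ∀ n : N, latticePoint n ∈ ρ.cone ↔ ∃ k : ℕ, n = k • v := by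
  obtain ⟨s, hs⟩ := Δ.rational ρ.1.1 ρ.1.2
  have hsal := Δ.salient ρ.1.1 ρ.1.2
  have hdim : Module.finrank ℝ (Submodule.span ℝ (ρ.cone : Set (ℝ ⊗[ℤ] N))) = 1 := ρ.2
  change ρ.cone = _ at hs
  change ρ.cone.toConvexCone.Salient at hsal
  obtain ⟨n₀, hn₀, hne⟩ : ∃ n₀ : N, latticePoint n₀ ∈ ρ.cone ∧ latticePoint n₀ ≠ 0 := by
    by_contra hall
    push Not at hall
    have hbot : Submodule.span ℝ (ρ.cone : Set (ℝ ⊗[ℤ] N)) = ⊥ := by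
      rw [Submodule.span_eq_bot]
      intro x hx
      have hle : ρ.cone ≤ ⊥ := by
        rw [hs]
        refine Submodule.span_le.2 ?_
        rintro _ ⟨n, hn, rfl⟩
        have h1 : latticePoint n ∈ ρ.cone := hs ▸ PointedCone.subset_hull ⟨n, hn, rfl⟩
        exact hall n h1
      exact (Submodule.mem_bot _).1 (hle hx)
    rw [hbot, finrank_bot] at hdim
    exact zero_ne_one hdim
  have hmul : ∀ x ∈ ρ.cone, ∃ c : ℝ, 0 ≤ c ∧ x = c • latticePoint n₀ := by
    intro x hx
    obtain ⟨c, hc⟩ := exists_smul_eq_of_finrank_eq_one hdim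
      (x := ⟨latticePoint n₀, Submodule.subset_span hn₀⟩)
      (fun h => hne (congrArg Subtype.val h)) ⟨x, Submodule.subset_span hx⟩
    have hc' : c • latticePoint n₀ = x := congrArg Subtype.val hc
    refine ⟨c, ?_, hc'.symm⟩
    by_contra hneg
    push Not at hneg
    refine hsal _ hn₀ hne ?_
    have h1 : (-c⁻¹) • x ∈ ρ.cone :=
      PointedCone.smul_mem ρ.cone (neg_nonneg.2 (inv_nonpos.2 hneg.le)) hx
    rwa [← hc', smul_smul, neg_mul, inv_mul_cancel₀ hneg.ne, neg_one_smul] at h1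
  obtain ⟨f, hf⟩ : ∃ f : Module.Dual ℤ N, 0 < f n₀ := by
    have hn0 : n₀ ≠ 0 := fun h => hne (by rw [h]; simp [latticePoint])
    obtain ⟨f, hf⟩ : ∃ f : Module.Dual ℤ N, f n₀ ≠ 0 := by
      by_contra hall
      push Not at hall
      exact hn0 ((Module.forall_dual_apply_eq_zero_iff ℤ n₀).mp hall)
    rcases lt_or_gt_of_ne hf with h | h
    · exact ⟨-f, by simpa using h⟩
    · exact ⟨f, h⟩
  have hval : ∀ (n : N) (c : ℝ), latticePoint n = c • latticePoint n₀ →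
      (f n : ℝ) = c * f n₀ := by
    intro n c h
    rw [← realFunctional_latticePoint, h, map_smul, realFunctional_latticePoint, smul_eq_mul]
  have hf' : (0 : ℝ) < f n₀ := by exact_mod_cast hf
  have hex : ∃ k : ℕ, 0 < k ∧ ∃ n : N, latticePoint n ∈ ρ.cone ∧ f n = k :=
    ⟨(f n₀).toNat, by omega, n₀, hn₀, by omega⟩
  classical
  obtain ⟨hk0, v, hv, hfv⟩ := Nat.find_spec hex
  have hmin := fun j (hj : j < Nat.find hex) => Nat.find_min hex hj
  set k := Nat.find hex with hk
  have hgen : ∀ n : N, latticePoint n ∈ ρ.cone ↔ ∃ k : ℕ, n = k • v := by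
    intro n
    constructor
    · intro hn
      obtain ⟨c, hc0, hc⟩ := hmul _ hn
      obtain ⟨c', -, hc'⟩ := hmul _ hv
      have hkz : (0 : ℤ) < k := by exact_mod_cast hk0
      have hr0 := Int.emod_nonneg (f n) hkz.ne'
      have hrk := Int.emod_lt_of_pos (f n) hkz
      have hdiv := Int.emod_add_mul_ediv (f n) k
      set q := f n / k
      set r := f n % k
      have hlp : latticePoint (n - q • v) = (c - q * c') • latticePoint n₀ := by
        rw [latticePoint_sub, latticePoint_zsmul, hc, hc', smul_smul, ← sub_smul]
      have hfr : f (n - q • v) = r := by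
        rw [map_sub, map_smul, hfv, smul_eq_mul]; linarith
      have hr := hval _ _ hlp
      rw [hfr] at hr
      have hcc : 0 ≤ c - q * c' := by
        have : (0 : ℝ) ≤ r := by exact_mod_cast hr0
        rw [hr] at this
        exact nonneg_of_mul_nonneg_left this hf'
      have hr_eq : r = 0 := by
        by_contra hrne
        refine hmin r.toNat (by omega) ⟨by omega, n - q • v, ?_, by rw [hfr]; omega⟩
        rw [hlp]
        exact PointedCone.smul_mem ρ.cone hcc hn₀
      have hc_eq : c - q * c' = 0 := by
        rw [hr_eq] at hr
        simpa [hf'.ne'] using hr.symm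
      have hzero : n - q • v = 0 := by
        apply latticePoint_injective
        rw [hlp, hc_eq, zero_smul]
        simp [latticePoint]
      have hfn : 0 ≤ f n := by
        have := hval n c hc
        have h2 : (0 : ℝ) ≤ f n := by rw [this]; positivity
        exact_mod_cast h2
      have hq : 0 ≤ q := Int.ediv_nonneg hfn hkz.le
      refine ⟨q.toNat, ?_⟩
      rw [← natCast_zsmul, Int.toNat_of_nonneg hq]
      exact sub_eq_zero.1 hzero
    · rintro ⟨j, rfl⟩
      rw [← natCast_zsmul, latticePoint_zsmul]
      exact PointedCone.smul_mem ρ.cone (by positivity) hv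
  refine ⟨v, hgen, fun w hw => ?_⟩
  obtain ⟨a, ha⟩ := (hw v).1 hv
  obtain ⟨b, hb⟩ := (hgen w).1 ((hw w).2 ⟨1, by simp⟩)
  have hfa : f v = a * f w := by
    conv_lhs => rw [ha]
    simp
  have hfb : f w = b * f v := by
    conv_lhs => rw [hb]
    simp
  have hfv0 : 0 < f v := by rw [hfv]; exact_mod_cast hk0
  have hab : (b : ℤ) * a = 1 := by
    have : ((b : ℤ) * a - 1) * f w = 0 := by rw [hfa] at hfb; linarith
    rcases mul_eq_zero.1 this with h | h
    · linarith
    · rw [h] at hfa; omega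
  have hb1 : b = 1 := Nat.eq_one_of_mul_eq_one_right (by exact_mod_cast hab)
  rw [hb, hb1, one_smul]

/-- The generator `v_ρ` of the semigroup `ρ ∩ N`. -/
def rayGenerator (ρ : Δ.Ray) : N := (Δ.existsUnique_generator ρ).choose

/-- The set `R` of Demazure roots. -/
def roots : Set (Module.Dual ℤ N) :=
  {m | ∃ τ : Δ.Ray, m (Δ.rayGenerator τ) = -1 ∧
    ∀ τ' : Δ.Ray, τ' ≠ τ → 0 ≤ m (Δ.rayGenerator τ')}

/-- The set `S = R ∩ (-R)` of semisimple roots. -/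
def semisimpleRoots : Set (Module.Dual ℤ N) := {m | m ∈ Δ.roots ∧ -m ∈ Δ.roots}

/-- There are `d = rank N` semisimple roots that are linearly independent in `M_ℝ`
(the dual space of `N_ℝ`). -/
def HasIndependentSemisimpleRoots : Prop :=
  ∃ b : Fin (Module.finrank ℤ N) → Module.Dual ℤ N,
    (∀ i, b i ∈ Δ.semisimpleRoots) ∧ LinearIndependent ℝ fun i => realFunctional (b i)

/-- The torus-invariant Weil divisor `∑_ρ ⟨m, v_ρ⟩ V_ρ` of the character of `m`; the basis vector
of `Δ.Ray → ℤ` at `ρ` stands for the torus-invariant prime divisor `V_ρ`. -/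
def divisorOfCharacter : Module.Dual ℤ N →+ (Δ.Ray → ℤ) where
  toFun m ρ := m (Δ.rayGenerator ρ)
  map_zero' := rfl
  map_add' _ _ := rfl

/-- The divisor class group `Cl(X)`: torus-invariant Weil divisors modulo divisors of
characters. -/
abbrev ClassGroup : Type := (Δ.Ray → ℤ) ⧸ Δ.divisorOfCharacter.range

open scoped Classical in
/-- The class of the torus-invariant prime divisor `V_ρ`. -/
def divisorClass (ρ : Δ.Ray) : Δ.ClassGroup := QuotientAddGroup.mk (Pi.single ρ (1 : ℤ))

/-- The homogeneous coordinate ring (Cox ring) `ℂ[x_ρ : ρ ∈ Δ(1)]`. -/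
abbrev CoxRing : Type := MvPolynomial Δ.Ray ℂ

/-- The homogeneous component of degree `c` of the Cox ring: the span of the monomials
`∏ x_ρ ^ k_ρ` with `∑ k_ρ [V_ρ] = c`. -/
def coxComponent (c : Δ.ClassGroup) : Submodule ℂ Δ.CoxRing :=
  MvPolynomial.weightedHomogeneousSubmodule ℂ Δ.divisorClass c

/-- The set of variables of degree `c` of the Cox ring. -/
def variablesOfDegree (c : Δ.ClassGroup) : Set Δ.CoxRing :=
  {x | (∃ ρ, x = MvPolynomial.X ρ) ∧ x ∈ Δ.coxComponent c}

/-- The index set of the degree classes `Y_1, …, Y_q` of order at least two of variables: the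
degrees `c` in which there are at least two variables. -/
def BigDegree : Type := {c : Δ.ClassGroup // 2 ≤ (Δ.variablesOfDegree c).ncard}

instance finite_bigDegree : Finite Δ.BigDegree := by
  have h : ∀ i : Δ.BigDegree, ∃ ρ : Δ.Ray, Δ.divisorClass ρ = i.1 := by
    intro i
    have h2 := i.2
    obtain ⟨x, ⟨ρ, rfl⟩, hx⟩ : (Δ.variablesOfDegree i.1).Nonempty :=
      Set.nonempty_of_ncard_ne_zero (by omega)
    exact ⟨ρ, MvPolynomial.IsWeightedHomogeneous.inj_right (MvPolynomial.X_ne_zero ρ)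
      (MvPolynomial.isWeightedHomogeneous_X ℂ Δ.divisorClass ρ) hx⟩
  choose g hg using h
  refine Finite.of_injective g fun i j hij => Subtype.ext ?_
  rw [← hg i, ← hg j, hij]

/-- The degree class `Y_i` of variables. -/
def degreeClass (i : Δ.BigDegree) : Set Δ.CoxRing := Δ.variablesOfDegree i.1

end Fan

end Roots

end ToricGeometry

end

/-!
Let `Δ` be a complete fan in `N_ℝ`, with `M` the dual lattice of `N` and `v_τ` the generator of a
ray `τ`.

**From a product of projective spaces to semisimple roots.** For a matrix `E` the infinitesimal
automorphism `1 + ε E` of `ℙ^n` acts on the morphisms `Spec A → ℙ^n` once an `ε ∈ A` of square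
zero is given (`exists_isInfinitesimalMove`). As it does not move points, a family of such
automorphisms of the factors restricts to every affine open subscheme `Spec A` of a product of
projective spaces, where it is a homomorphism `A → A[ε]` (`exists_isFlow`), compatibly between
different subschemes (`IsFlow.naturality`); and every tangent vector at a `ℂ`-point is the
velocity of one of them (`exists_matrix_of_tangentVector`). Transport this to the charts
`Spec ℂ[σ^∨ ∩ M]` of the toric variety. Given a full-dimensional cone `σ` and an indecomposable
element `u` of `σ^∨ ∩ M`, choose the automorphism with velocity dual to `u` at the torus fixed
point of `σ`. Its component of degree `-u` is `χ^w ↦ ν(w) χ^(w - u)` with `ν` additive and `ν(u) ≠ 0`, and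
preserves the semigroup algebras of all rays; this forces `-u` to be a Demazure root
(`Fan.IsComplete.neg_mem_roots_of_iso`).

So the negatives of all indecomposable elements are roots, and a reflection argument shows that
they are semisimple (`Fan.IsComplete.mem_semisimpleRoots`): let `τ` be the ray on which `u` is
`1`, and let `σ'` be a full-dimensional cone without the ray `τ`. Then `-u ∈ σ'^∨`, so `-u` has an
indecomposable summand `w` in `σ'^∨ ∩ M` that is negative at `τ`; as `-w` is a root too,
`u + w ≤ 0` on all rays, and completeness gives `u = -w`. The indecomposable elements of `σ^∨ ∩ M`
generate `M`, so there are `d` linearly independent ones.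

**From semisimple roots to a product of projective spaces.** A semisimple root has the values `1`
and `-1` at the generators of two rays of the same degree and `0` at all others. It therefore
vanishes on the sum of the ray generators of a fixed degree, so if the semisimple roots span
`M_ℝ`, these sums are zero (`Fan.HasIndependentSemisimpleRoots.sum_eq_zero`). Hence `M` is the
lattice of integer vectors on the set of rays whose sum over each degree class is zero
(`SimplexCoordinates`). A strongly convex cone cannot contain all rays of a degree class, and
completeness shows that the maximal cones are those generated by all rays but one from each degree
class (`Fan.IsComplete.simplexCone_mem`). The corresponding affine charts are the standard charts
of the product of projective spaces with one factor for each degree class, and they are glued in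
the same way (`toricVariety_iso_product`).

Both parts use that a cone of the fan is generated by its rays (`Fan.hull_rayGenerators`), which
is deduced from Farkas' lemma over the integers (`farkas`).
-/

noncomputable section

namespace ToricGeometry

attribute [local instance] MvPolynomial.gradedAlgebra

section

open HomogeneousLocalization MvPolynomial

/-! ### Morphisms from affine schemes to projective space -/

section ProjMap

variable {n : ℕ}

/-- The standard grading of `ℂ[x_0, …, x_n]`. -/
abbrev stdGrading (n : ℕ) : ℕ → Submodule ℂ (MvPolynomial (Fin (n + 1)) ℂ) :=
  homogeneousSubmodule (Fin (n + 1)) ℂ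

variable {A B : Type} [CommRing A] [Algebra ℂ A] [CommRing B] [Algebra ℂ B]

/-- Evaluation of a degree zero fraction `a / f ^ k` at a point `x` with coordinates in `A`, where
`f x` is a unit. -/
def awayEval (x : Fin (n + 1) → A) (f : MvPolynomial (Fin (n + 1)) ℂ)
    (h : IsUnit (aeval x f)) : Away (stdGrading n) f →+* A :=
  (Localization.awayLift (aeval x).toRingHom f h).comp
    (algebraMap (Away (stdGrading n) f) (Localization.Away f))

lemma awayEval_mk (x : Fin (n + 1) → A) {f : MvPolynomial (Fin (n + 1)) ℂ}
    (h : IsUnit (aeval x f)) {d : ℕ} (hf : f ∈ stdGrading n d) (k : ℕ)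
    (a : MvPolynomial (Fin (n + 1)) ℂ) (ha : a ∈ stdGrading n (k • d)) :
    awayEval x f h (Away.mk _ hf k a ha) * aeval x f ^ k = aeval x a := by
  have hv := h.unit.mul_inv
  simp only [IsUnit.unit_spec] at hv
  simp only [awayEval, RingHom.comp_apply, HomogeneousLocalization.algebraMap_apply, Away.val_mk]
  rw [Localization.awayLift_mk (v := ((h.unit⁻¹ : Aˣ) : A)) (hv := by exact hv)]
  change aeval x a * _ ^ k * _ = _
  rw [mul_assoc, ← mul_pow, mul_comm _ (aeval x f), hv, one_pow, mul_one]

lemma awayEval_comp (x : Fin (n + 1) → A) {f : MvPolynomial (Fin (n + 1)) ℂ}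
    (h : IsUnit (aeval x f)) {d : ℕ} (hf : f ∈ stdGrading n d) (φ : A →ₐ[ℂ] B)
    (h' : IsUnit (aeval (fun k => φ (x k)) f)) :
    φ.toRingHom.comp (awayEval x f h) = awayEval (fun k => φ (x k)) f h' := by
  have key : ∀ a, aeval (fun k => φ (x k)) a = φ (aeval x a) := fun a => by
    rw [← AlgHom.comp_apply, comp_aeval]
  refine RingHom.ext fun z => ?_
  obtain ⟨k, a, ha, rfl⟩ := Away.mk_surjective _ hf z
  refine (h'.pow k).mul_right_cancel ?_
  rw [awayEval_mk, key, key, ← awayEval_mk x h hf k a ha]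
  simp

lemma awayEval_smul (x : Fin (n + 1) → A) {f : MvPolynomial (Fin (n + 1)) ℂ}
    (h : IsUnit (aeval x f)) {d : ℕ} (hf : f ∈ stdGrading n d) (u : A)
    (h' : IsUnit (aeval (fun k => u * x k) f)) :
    awayEval (fun k => u * x k) f h' = awayEval x f h := by
  have key : ∀ (e : ℕ) (a : MvPolynomial (Fin (n + 1)) ℂ), a ∈ stdGrading n e →
      aeval (fun k => u * x k) a = u ^ e * aeval x a := by
    intro e a ha
    rw [aeval_def, aeval_def, eval₂_eq, eval₂_eq, Finset.mul_sum]
    refine Finset.sum_congr rfl fun m hm => ?_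
    have hd : ∑ i ∈ m.support, m i = e := by
      have := ha (mem_support_iff.1 hm)
      rw [Finsupp.weight_apply, Finsupp.sum] at this
      simpa using this
    simp only [mul_pow, Finset.prod_mul_distrib, Finset.prod_pow_eq_pow_sum, hd]
    ring
  refine RingHom.ext fun z => ?_
  obtain ⟨k, a, ha, rfl⟩ := Away.mk_surjective _ hf z
  refine (h'.pow k).mul_right_cancel ?_
  rw [awayEval_mk, key _ _ ha, key _ _ hf, ← awayEval_mk x h hf k a ha, smul_eq_mul]
  ring

/-- Evaluation is compatible with the restriction from `f ≠ 0` to `f g ≠ 0`. -/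
lemma awayEval_awayMap (x : Fin (n + 1) → A) {f g : MvPolynomial (Fin (n + 1)) ℂ}
    (h : IsUnit (aeval x f)) (h' : IsUnit (aeval x (f * g))) {d e : ℕ}
    (hf : f ∈ stdGrading n d) (hg : g ∈ stdGrading n e) :
    (awayEval x (f * g) h').comp (awayMap (stdGrading n) hg rfl) = awayEval x f h := by
  refine RingHom.ext fun z => ?_
  obtain ⟨k, a, ha, rfl⟩ := Away.mk_surjective _ hf z
  refine (h'.pow k).mul_right_cancel ?_
  rw [RingHom.comp_apply, awayMap_mk, awayEval_mk, map_mul, map_mul, ← awayEval_mk x h hf k a ha,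
    map_pow]
  ring

lemma X_mem_stdGrading (l : Fin (n + 1)) :
    (X l : MvPolynomial (Fin (n + 1)) ℂ) ∈ stdGrading n 1 := isHomogeneous_X _ _

/-- The degree zero fraction `x_k / x_l`. -/
def coordFraction (k l : Fin (n + 1)) : Away (stdGrading n) (X l) :=
  Away.mk _ (X_mem_stdGrading l) 1 (X k) (X_mem_stdGrading k)

lemma coordFraction_self (l : Fin (n + 1)) : coordFraction l l = 1 := by
  refine HomogeneousLocalization.val_injective _ ?_
  rw [coordFraction, Away.val_mk, val_one]
  simp only [pow_one]
  exact Localization.mk_self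
    (⟨X l, 1, pow_one _⟩ : Submonoid.powers (X l : MvPolynomial (Fin (n + 1)) ℂ))

/-- The constants in the coordinate ring of the chart `x_l ≠ 0`. -/
def awayConst (l : Fin (n + 1)) : ℂ →+* Away (stdGrading n) (X l) :=
  (fromZeroRingHom (stdGrading n) _).comp (algebraMap ℂ (stdGrading n 0))

lemma awayConst_eq (l : Fin (n + 1)) (r : ℂ) : awayConst l r =
    Away.mk (stdGrading n) (X_mem_stdGrading l) 0 (C r) (by simp) := by
  ext
  simp [awayConst, fromZeroRingHom]
  rfl

lemma awayEval_awayConst (x : Fin (n + 1) → A) {l : Fin (n + 1)}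
    (h : IsUnit (aeval x (X l : MvPolynomial (Fin (n + 1)) ℂ))) (r : ℂ) :
    awayEval x (X l) h (awayConst l r) = algebraMap ℂ A r := by
  have := awayEval_mk x h (X_mem_stdGrading l) 0 (C r) (by simp)
  rw [← awayConst_eq] at this
  simpa using this

lemma awayEval_coordFraction (x : Fin (n + 1) → A) {l : Fin (n + 1)}
    (h : IsUnit (aeval x (X l : MvPolynomial (Fin (n + 1)) ℂ))) (k : Fin (n + 1)) :
    awayEval x (X l) h (coordFraction k l) * x l = x k := by
  have := awayEval_mk x h (X_mem_stdGrading l) 1 (X k) (X_mem_stdGrading k)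
  rwa [pow_one, aeval_X, aeval_X] at this

/-- The coordinate ring of the chart `x_l ≠ 0` is generated by the constants and the `x_k / x_l`. -/
lemma away_hom_ext {R : Type*} [CommRing R] {l : Fin (n + 1)}
    {φ ψ : Away (stdGrading n) (X l) →+* R}
    (hC : ∀ r, φ (awayConst l r) = ψ (awayConst l r))
    (hX : ∀ k, φ (coordFraction k l) = ψ (coordFraction k l)) : φ = ψ := by
  have key : ∀ (k : ℕ) (a : MvPolynomial (Fin (n + 1)) ℂ) (ha : a ∈ stdGrading n (k • 1)),
      Away.mk (stdGrading n) (X_mem_stdGrading l) k a ha =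
        ∑ m ∈ a.support, awayConst l (a.coeff m) * ∏ i, coordFraction i l ^ m i := by
    intro k a ha
    let ι := algebraMap (Away (stdGrading n) (X l)) (Localization.Away (X l : MvPolynomial _ ℂ))
    let τ := algebraMap (MvPolynomial (Fin (n + 1)) ℂ) (Localization.Away (X l : MvPolynomial _ ℂ))
    have hu : IsUnit (τ (X l)) := IsLocalization.Away.algebraMap_isUnit _
    have hmk : ∀ (k : ℕ) (b : MvPolynomial (Fin (n + 1)) ℂ) (hb : b ∈ stdGrading n (k • 1)),
        ι (Away.mk (stdGrading n) (X_mem_stdGrading l) k b hb) * τ (X l) ^ k = τ b := by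
      intro k b hb
      rw [← map_pow]
      change Localization.mk b ⟨X l ^ k, _⟩ * _ = _
      rw [Localization.mk_eq_mk'_apply]
      exact IsLocalization.mk'_spec _ b (⟨X l ^ k, k, rfl⟩ : Submonoid.powers _)
    have hX1 : ∀ i, ι (coordFraction i l) * τ (X l) = τ (X i) := fun i => by
      have := hmk 1 (X i) (X_mem_stdGrading i)
      rwa [pow_one] at this
    have hC1 : ∀ r, ι (awayConst l r) = τ (C r) := fun r => by
      rw [awayConst_eq, ← hmk 0 (C r), pow_zero, mul_one]
    refine HomogeneousLocalization.val_injective _ ((hu.pow k).mul_right_cancel ?_)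
    refine (hmk k a ha).trans ?_
    change _ = ι _ * _
    conv_lhs => rw [a.as_sum]
    rw [map_sum, map_sum, Finset.sum_mul]
    refine Finset.sum_congr rfl fun m hm => ?_
    have hd : ∑ i, m i = k := by
      have := ha (mem_support_iff.1 hm)
      rw [Finsupp.weight_apply, Finsupp.sum_fintype _ _ (by simp)] at this
      simpa using this
    rw [monomial_eq, map_mul, map_mul, hC1, mul_assoc, Finsupp.prod_fintype _ _ (by simp), map_prod,
      map_prod, ← hd, ← Finset.prod_pow_eq_pow_sum, ← Finset.prod_mul_distrib]
    simp only [map_pow, ← mul_pow, hX1]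
  refine RingHom.ext fun z => ?_
  obtain ⟨k, a, ha, rfl⟩ := Away.mk_surjective _ (X_mem_stdGrading l) z
  rw [key]
  simp [hC, hX]

lemma isUnit_aeval_X {x : Fin (n + 1) → A} {l : Fin (n + 1)} (h : IsUnit (x l)) :
    IsUnit (aeval x (X l : MvPolynomial (Fin (n + 1)) ℂ)) := by simpa using h

/-- The morphism `Spec A → ℙ^n` with homogeneous coordinates `x`, of which the `l`-th is a
unit. -/
def projMap (x : Fin (n + 1) → A) (l : Fin (n + 1)) (h : IsUnit (x l)) :
    Spec (CommRingCat.of A) ⟶ Proj (stdGrading n) :=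
  Spec.map (CommRingCat.ofHom (awayEval x (X l) (isUnit_aeval_X h))) ≫
    Proj.awayι (stdGrading n) (X l) (X_mem_stdGrading l) one_pos

lemma SpecMap_projMap (x : Fin (n + 1) → A) (l : Fin (n + 1)) (h : IsUnit (x l)) (φ : A →ₐ[ℂ] B) :
    Spec.map (CommRingCat.ofHom φ.toRingHom) ≫ projMap x l h =
      projMap (fun k => φ (x k)) l (h.map φ) := by
  rw [projMap, projMap, ← Category.assoc, ← Spec.map_comp, ← CommRingCat.ofHom_comp,
    awayEval_comp x _ (X_mem_stdGrading l)]

/-- The morphism does not depend on the choice of a coordinate that is a unit. -/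
lemma projMap_eq_of_isUnit (x : Fin (n + 1) → A) (l l' : Fin (n + 1)) (h : IsUnit (x l))
    (h' : IsUnit (x l')) : projMap x l h = projMap x l' h' := by
  have hu : IsUnit (aeval x (X l * X l' : MvPolynomial (Fin (n + 1)) ℂ)) := by
    simpa using ⟨h, h'⟩
  have key : ∀ (l l' : Fin (n + 1)) (h : IsUnit (x l)) (f : MvPolynomial (Fin (n + 1)) ℂ)
      (hf : f = X l * X l') (hd : f ∈ stdGrading n 2) (hu : IsUnit (aeval x f)),
      projMap x l h = Spec.map (CommRingCat.ofHom (awayEval x f hu)) ≫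
        Proj.awayι (stdGrading n) f hd two_pos := by
    rintro l l' h _ rfl hd hu
    rw [projMap, ← awayEval_awayMap x _ hu (X_mem_stdGrading l) (X_mem_stdGrading l'),
      CommRingCat.ofHom_comp, Spec.map_comp, Category.assoc, Proj.SpecMap_awayMap_awayι]
  have hd := SetLike.mul_mem_graded (X_mem_stdGrading l) (X_mem_stdGrading l')
  rw [key l l' h _ rfl hd hu, key l' l h' _ (mul_comm _ _) hd hu]

lemma projMap_smul (x : Fin (n + 1) → A) (l : Fin (n + 1)) (h : IsUnit (x l)) (u : A)
    (h' : IsUnit (u * x l)) : projMap (fun k => u * x k) l h' = projMap x l h := by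
  rw [projMap, projMap, awayEval_smul x _ (X_mem_stdGrading l)]

/-- The structure morphism `ℙ^n → Spec ℂ`. -/
def projStructure (n : ℕ) : Proj (stdGrading n) ⟶ Spec (CommRingCat.of ℂ) :=
  Proj.toSpecZero (stdGrading n) ≫
    Spec.map (CommRingCat.ofHom (algebraMap ℂ (stdGrading n 0)))

lemma awayι_projStructure (l : Fin (n + 1)) :
    Proj.awayι (stdGrading n) (X l) (X_mem_stdGrading l) one_pos ≫ projStructure n =
      Spec.map (CommRingCat.ofHom (awayConst l)) := by
  rw [projStructure, Proj.awayι_toSpecZero_assoc, ← Spec.map_comp, ← CommRingCat.ofHom_comp]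
  rfl

lemma projMap_projStructure (x : Fin (n + 1) → A) (l : Fin (n + 1)) (h : IsUnit (x l)) :
    projMap x l h ≫ projStructure n = Spec.map (CommRingCat.ofHom (algebraMap ℂ A)) := by
  rw [projMap, Category.assoc, awayι_projStructure, ← Spec.map_comp, ← CommRingCat.ofHom_comp]
  congr 2
  refine RingHom.ext fun r => ?_
  rw [RingHom.comp_apply, awayEval_awayConst]

lemma projMap_mem_basicOpen (x : Fin (n + 1) → A) (l : Fin (n + 1)) (h : IsUnit (x l))
    (l' : Fin (n + 1)) (p : Spec (CommRingCat.of A)) :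
    projMap x l h p ∈ Proj.basicOpen (stdGrading n) (X l') ↔ x l' ∉ PrimeSpectrum.asIdeal p := by
  have h1 := Proj.awayι_preimage_basicOpen (stdGrading n) (X_mem_stdGrading l) one_pos
    (X_mem_stdGrading l') one_pos
  have h2 : (Spec.map (CommRingCat.ofHom (awayEval x (X l) (isUnit_aeval_X h)))) p ∈
      Proj.awayι (stdGrading n) (X l) (X_mem_stdGrading l) one_pos ⁻¹ᵁ
        Proj.basicOpen (stdGrading n) (X l') ↔ awayEval x (X l) (isUnit_aeval_X h)
        (Away.isLocalizationElem (X_mem_stdGrading l) (X_mem_stdGrading l')) ∉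
          PrimeSpectrum.asIdeal p := by
    rw [h1]; rfl
  have h3 : awayEval x (X l) (isUnit_aeval_X h)
        (Away.isLocalizationElem (X_mem_stdGrading l) (X_mem_stdGrading l')) * x l = x l' := by
    have := awayEval_mk x (isUnit_aeval_X h) (X_mem_stdGrading l) 1 (X l' ^ 1)
      (by simpa using X_mem_stdGrading l')
    rw [map_pow, aeval_X, aeval_X, pow_one (x l), pow_one (x l')] at this
    exact this
  refine Iff.trans ?_ (h2.trans ?_)
  · rw [projMap, Scheme.Hom.comp_apply]; rfl
  · rw [← h3, Ideal.mul_unit_mem_iff_mem _ h]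

/-- Some homogeneous coordinate does not vanish at a given point of projective space. -/
lemma exists_mem_basicOpen (y : Proj (stdGrading n)) :
    ∃ l, y ∈ Proj.basicOpen (stdGrading n) (X l) := by
  have h := Proj.iSup_basicOpen_eq_top' (stdGrading n) (fun k : Fin (n + 1) => X k)
    (fun k => ⟨1, X_mem_stdGrading k⟩) (by
      rw [eq_top_iff]
      intro p _
      induction p using MvPolynomial.induction_on with
      | C a => exact Subalgebra.algebraMap_mem _ (⟨C a, isHomogeneous_C _ _⟩ : stdGrading n 0)
      | add p q hp hq => exact add_mem (hp trivial) (hq trivial)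
      | mul_X p k hp => exact mul_mem (hp trivial) (Algebra.subset_adjoin ⟨k, rfl⟩))
  have h2 : y ∈ (⊤ : (Proj (stdGrading n)).Opens) := trivial
  rw [← h] at h2
  exact TopologicalSpace.Opens.mem_iSup.1 h2

end ProjMap

end

section

open HomogeneousLocalization MvPolynomial

/-! ### Products of projective spaces -/

section Product

variable {I : Type} [Finite I] {n : I → ℕ}

/-- The scheme underlying `∏ i, ℙ^(n i)`. -/
abbrev productScheme (n : I → ℕ) : Scheme.{0} :=
  (productOfProjectiveSpaces n).left

/-- The structure morphism of `∏ i, ℙ^(n i)`. -/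
def productStructure (n : I → ℕ) :
    productScheme n ⟶ Spec (CommRingCat.of ℂ) :=
  (productOfProjectiveSpaces n).hom

/-- The projections of `∏ i, ℙ^(n i)`. -/
def factorMap (n : I → ℕ) (i : I) :
    productScheme n ⟶ Proj (stdGrading (n i)) :=
  (Pi.π (fun i => projectiveSpace (n i)) i).left

lemma factorMap_projStructure (n : I → ℕ) (i : I) :
    factorMap n i ≫ projStructure (n i) = productStructure n :=
  Over.w (Pi.π (fun i => projectiveSpace (n i)) i)

lemma productScheme_hom_ext {Z : Scheme.{0}}
    {f g : Z ⟶ productScheme n} (h : f ≫ productStructure n = g ≫ productStructure n)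
    (hi : ∀ i, f ≫ factorMap n i = g ≫ factorMap n i) : f = g := by
  let f' : Over.mk (f ≫ productStructure n) ⟶ productOfProjectiveSpaces n := Over.homMk f rfl
  let g' : Over.mk (f ≫ productStructure n) ⟶ productOfProjectiveSpaces n := Over.homMk g h.symm
  suffices f' = g' from congrArg (fun q => Over.Hom.left q) this
  refine Limits.Pi.hom_ext _ _ fun i => ?_
  ext1
  exact hi i

lemma exists_productScheme_lift {Z : Scheme.{0}}
    (s : Z ⟶ Spec (CommRingCat.of ℂ)) (f : ∀ i, Z ⟶ Proj (stdGrading (n i)))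
    (h : ∀ i, f i ≫ projStructure (n i) = s) :
    ∃ g : Z ⟶ productScheme n, g ≫ productStructure n = s ∧ ∀ i, g ≫ factorMap n i = f i := by
  let f' : ∀ i, Over.mk s ⟶ projectiveSpace (n i) := fun i => Over.homMk (f i) (h i)
  let g' : Over.mk s ⟶ productOfProjectiveSpaces n := Pi.lift f'
  refine ⟨g'.left, Over.w g', fun i => ?_⟩
  have : g' ≫ Pi.π (fun i => projectiveSpace (n i)) i = f' i := Limits.Pi.lift_π _ _
  exact congrArg (fun q => Over.Hom.left q) this

/-- The open subset of `∏ i, ℙ^(n i)` on which the coordinates `x_{i, j i}` do not vanish. -/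
def productChart (j : (i : I) → Fin (n i + 1)) : (productScheme n).Opens where
  carrier := ⋂ i, (factorMap n i) ⁻¹' (Proj.basicOpen (stdGrading (n i)) (X (j i)))
  is_open' := isOpen_iInter_of_finite fun i =>
    (Proj.basicOpen (stdGrading (n i)) (X (j i))).isOpen.preimage (factorMap n i).continuous

lemma mem_productChart {j : (i : I) → Fin (n i + 1)} {y : productScheme n} :
    y ∈ productChart j ↔
      ∀ i, factorMap n i y ∈ Proj.basicOpen (stdGrading (n i)) (X (j i)) :=
  Set.mem_iInter

/-- The charts cover the product. -/
lemma exists_mem_productChart (y : productScheme n) :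
    ∃ j : (i : I) → Fin (n i + 1), y ∈ productChart j := by
  choose j hj using fun i => exists_mem_basicOpen (factorMap n i y)
  exact ⟨j, mem_productChart.2 hj⟩

end Product

/-! ### The monomial charts of a product of projective spaces -/

section MonoidAlgebra

variable {M : Type} [AddCommGroup M]

/-- The affine scheme `Spec ℂ[Q]`. -/
abbrev monoidSpec (Q : AddSubmonoid M) : Scheme.{0} :=
  Spec (CommRingCat.of (AddMonoidAlgebra ℂ Q))

/-- The inclusion `ℂ[Q] → ℂ[Q']` for `Q ⊆ Q'`. -/
def monoidAlgebraMap {Q Q' : AddSubmonoid M} (h : Q ≤ Q') :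
    AddMonoidAlgebra ℂ Q →ₐ[ℂ] AddMonoidAlgebra ℂ Q' :=
  AddMonoidAlgebra.mapDomainAlgHom ℂ ℂ (AddSubmonoid.inclusion h)

/-- The morphism `Spec ℂ[Q'] → Spec ℂ[Q]` for `Q ⊆ Q'`. -/
def monoidSpecMap {Q Q' : AddSubmonoid M} (h : Q ≤ Q') :
    monoidSpec Q' ⟶ monoidSpec Q :=
  Spec.map (CommRingCat.ofHom (monoidAlgebraMap h).toRingHom)

end MonoidAlgebra

/-- Coordinates identifying `M` with the lattice of integer vectors `(a_{ik})`, `i ∈ I`,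
`0 ≤ k ≤ n i`, all of whose rows have sum zero: the character lattice of the big torus of
`∏ i, ℙ^(n i)`, the row `i` being the exponents of the homogeneous coordinates on `ℙ^(n i)`. -/
structure SimplexCoordinates (M : Type) [AddCommGroup M] {I : Type} (n : I → ℕ) where
  coord : M →+ ((i : I) → Fin (n i + 1) → ℤ)
  injective : Function.Injective coord
  mem_range : ∀ a, (∃ m, coord m = a) ↔ ∀ i, ∑ k, a i k = 0

namespace SimplexCoordinates

variable {M : Type} [AddCommGroup M] {I : Type} {n : I → ℕ}
variable (S : SimplexCoordinates M n)

open scoped Classical in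
/-- The exponent vector of `x_{ik} / x_{il}` has row sums zero. -/
lemma exists_root (i : I) (k l : Fin (n i + 1)) :
    ∃ m, S.coord m = Pi.single i (Pi.single k 1 - Pi.single l 1) := by
  rw [S.mem_range]
  intro i'
  rcases eq_or_ne i' i with rfl | h
  · simp
  · simp [Pi.single_eq_of_ne h]

/-- The character `x_{ik} / x_{il}`. -/
def root (i : I) (k l : Fin (n i + 1)) : M := (S.exists_root i k l).choose

open scoped Classical in
lemma coord_root (i : I) (k l : Fin (n i + 1)) :
    S.coord (S.root i k l) = Pi.single i (Pi.single k 1 - Pi.single l 1) :=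
  (S.exists_root i k l).choose_spec

lemma coord_root_same (i : I) (k l k' : Fin (n i + 1)) : S.coord (S.root i k l) i k' =
    (if k' = k then 1 else 0) - (if k' = l then 1 else 0) := by
  classical
  rw [coord_root, Pi.single_eq_same, Pi.sub_apply, Pi.single_apply, Pi.single_apply]

lemma coord_root_of_ne {i i' : I} (h : i' ≠ i) (k l : Fin (n i + 1)) (k' : Fin (n i' + 1)) :
    S.coord (S.root i k l) i' k' = 0 := by
  classical
  rw [coord_root, Pi.single_eq_of_ne h]; rfl

lemma root_self (i : I) (k : Fin (n i + 1)) : S.root i k k = 0 := by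
  classical
  refine S.injective ?_
  rw [coord_root, map_zero, sub_self, Pi.single_zero]

lemma root_add_root (i : I) (k l m : Fin (n i + 1)) :
    S.root i k l + S.root i l m = S.root i k m := by
  classical
  refine S.injective ?_
  rw [map_add, coord_root, coord_root, coord_root, ← Pi.single_add, sub_add_sub_cancel]

lemma sum_coord (m : M) (i : I) : ∑ k, S.coord m i k = 0 := (S.mem_range _).1 ⟨m, rfl⟩ i

/-- The monomials that are regular on the chart `∏ i, {x_{i, j i} ≠ 0}`. -/
def chartMonoid (j : (i : I) → Fin (n i + 1)) : AddSubmonoid M where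
  carrier := {m | ∀ i k, k ≠ j i → 0 ≤ S.coord m i k}
  zero_mem' := by simp
  add_mem' := fun ha hb i k hk => by
    rw [map_add]; exact add_nonneg (ha i k hk) (hb i k hk)

lemma mem_chartMonoid {j : (i : I) → Fin (n i + 1)} {m : M} :
    m ∈ S.chartMonoid j ↔ ∀ i k, k ≠ j i → 0 ≤ S.coord m i k := Iff.rfl

lemma root_mem_chartMonoid (j : (i : I) → Fin (n i + 1)) (i : I) (k : Fin (n i + 1)) :
    S.root i k (j i) ∈ S.chartMonoid j := by
  intro i' k' hk'
  rcases eq_or_ne i' i with rfl | h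
  · rw [coord_root_same, if_neg hk']; split_ifs <;> simp
  · rw [coord_root_of_ne S h]

variable [Fintype I]

/-- A monomial regular on a chart is the product of the powers of the normalized coordinates
`x_{ik} / x_{i, j i}` with its own exponents; `toNat` only affects the exponent of
`x_{i, j i} / x_{i, j i} = 1`. -/
lemma eq_sum_root {j : (i : I) → Fin (n i + 1)} {m : M} (hm : m ∈ S.chartMonoid j) :
    m = ∑ i, ∑ k, (S.coord m i k).toNat • S.root i k (j i) := by
  refine S.injective ?_
  funext i k
  have hsum : ∀ k, k ≠ j i → (∑ k', ((S.coord m i k').toNat • S.coord (S.root i k' (j i))) i k) =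
      S.coord m i k := by
    intro k hk
    rw [Finset.sum_eq_single k]
    · rw [Pi.smul_apply, Pi.smul_apply, coord_root_same, if_pos rfl, if_neg hk, sub_zero,
        nsmul_eq_mul, mul_one, Int.toNat_of_nonneg (hm i k hk)]
    · intro k' _ hk'
      rw [Pi.smul_apply, Pi.smul_apply, coord_root_same, if_neg hk'.symm, if_neg hk, sub_zero,
        smul_zero]
    · simp
  have hrow : ∀ k, S.coord (∑ i, ∑ k, (S.coord m i k).toNat • S.root i k (j i)) i k =
      (∑ k', ((S.coord m i k').toNat • S.coord (S.root i k' (j i))) i k) := by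
    intro k
    simp only [map_sum, map_nsmul, Finset.sum_apply]
    refine Finset.sum_eq_single i (fun i' _ hi' => ?_) (by simp)
    refine Finset.sum_eq_zero fun k' _ => ?_
    rw [Pi.smul_apply, Pi.smul_apply, coord_root_of_ne S hi'.symm, smul_zero]
  rcases eq_or_ne k (j i) with rfl | hk
  · have h1 := S.sum_coord m i
    have h2 := S.sum_coord (∑ i, ∑ k, (S.coord m i k).toNat • S.root i k (j i)) i
    rw [← Finset.add_sum_erase _ _ (Finset.mem_univ (j i))] at h1 h2
    have h3 : ∑ x ∈ Finset.univ.erase (j i), S.coord m i x =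
        ∑ x ∈ Finset.univ.erase (j i),
          S.coord (∑ i, ∑ k, (S.coord m i k).toNat • S.root i k (j i)) i x :=
      Finset.sum_congr rfl fun x hx => by
        rw [hrow, hsum x (Finset.ne_of_mem_erase hx)]
    linarith
  · rw [hrow, hsum k hk]

/-- The coordinates on `ℙ^(n i)`, normalized by `x_{i, j i} = 1`, as elements of `ℂ[Q]`. -/
def chartCoord {Q : AddSubmonoid M} {j : (i : I) → Fin (n i + 1)} (hQ : S.chartMonoid j ≤ Q)
    (i : I) (k : Fin (n i + 1)) : AddMonoidAlgebra ℂ Q :=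
  AddMonoidAlgebra.single ⟨S.root i k (j i), hQ (S.root_mem_chartMonoid j i k)⟩ 1

variable {Q : AddSubmonoid M} {j : (i : I) → Fin (n i + 1)} (hQ : S.chartMonoid j ≤ Q)

omit [Fintype I] in
lemma chartCoord_self (i : I) : S.chartCoord hQ i (j i) = 1 := by
  rw [chartCoord, AddMonoidAlgebra.one_def]
  congr 1
  exact Subtype.ext (S.root_self _ _)

omit [Fintype I] in
lemma isUnit_chartCoord_self (i : I) : IsUnit (S.chartCoord hQ i (j i)) := by
  rw [chartCoord_self]; exact isUnit_one

lemma exists_toProduct : ∃ g : monoidSpec Q ⟶ productScheme n,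
    g ≫ productStructure n =
      Spec.map (CommRingCat.ofHom (algebraMap ℂ (AddMonoidAlgebra ℂ Q))) ∧
    ∀ i, g ≫ factorMap n i = projMap (S.chartCoord hQ i) (j i) (S.isUnit_chartCoord_self hQ i) :=
  exists_productScheme_lift _ _ fun _ => projMap_projStructure _ _ _

/-- The morphism from `Spec ℂ[Q]` to `∏ i, ℙ^(n i)` given by the monomials
`x_{ik} / x_{i, j i}`. -/
def toProduct : monoidSpec Q ⟶ productScheme n := (S.exists_toProduct hQ).choose

lemma toProduct_productStructure : S.toProduct hQ ≫ productStructure n =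
    Spec.map (CommRingCat.ofHom (algebraMap ℂ (AddMonoidAlgebra ℂ Q))) :=
  (S.exists_toProduct hQ).choose_spec.1

lemma toProduct_factorMap (i : I) : S.toProduct hQ ≫ factorMap n i =
    projMap (S.chartCoord hQ i) (j i) (S.isUnit_chartCoord_self hQ i) :=
  (S.exists_toProduct hQ).choose_spec.2 i

omit [Fintype I] in
lemma monoidAlgebraMap_chartCoord {Q' : AddSubmonoid M} (h : Q ≤ Q') (i : I)
    (k : Fin (n i + 1)) :
    monoidAlgebraMap h (S.chartCoord hQ i k) = S.chartCoord (hQ.trans h) i k := by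
  simp [chartCoord, monoidAlgebraMap]
  rfl

lemma monoidSpecMap_toProduct {Q' : AddSubmonoid M} (h : Q ≤ Q') :
    monoidSpecMap h ≫ S.toProduct hQ = S.toProduct (hQ.trans h) := by
  refine productScheme_hom_ext ?_ fun i => ?_
  · rw [Category.assoc, toProduct_productStructure, toProduct_productStructure, monoidSpecMap,
      ← Spec.map_comp, ← CommRingCat.ofHom_comp]
    congr 2
    exact (monoidAlgebraMap h).comp_algebraMap
  · rw [Category.assoc, toProduct_factorMap, toProduct_factorMap, monoidSpecMap, SpecMap_projMap]
    congr 1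
    funext k
    exact S.monoidAlgebraMap_chartCoord hQ h i k

/-- The morphism to the product does not depend on the chart used to define it. -/
lemma toProduct_eq {j' : (i : I) → Fin (n i + 1)} (hQ' : S.chartMonoid j' ≤ Q) :
    S.toProduct hQ = S.toProduct hQ' := by
  refine productScheme_hom_ext ?_ fun i => ?_
  · rw [toProduct_productStructure, toProduct_productStructure]
  rw [toProduct_factorMap, toProduct_factorMap]
  have h : ∀ k, S.chartCoord hQ' i (j i) * S.chartCoord hQ i k = S.chartCoord hQ' i k := by
    intro k
    rw [chartCoord, chartCoord, chartCoord, AddMonoidAlgebra.single_mul_single, one_mul]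
    congr 1
    refine Subtype.ext ?_
    change S.root _ _ _ + S.root _ _ _ = S.root _ _ _
    rw [add_comm, root_add_root]
  have hu : IsUnit (S.chartCoord hQ' i (j i)) := by
    refine IsUnit.of_mul_eq_one (S.chartCoord hQ i (j' i)) ?_
    rw [h, chartCoord_self]
  have h1 := S.isUnit_chartCoord_self hQ i
  calc projMap (S.chartCoord hQ i) (j i) h1
      = projMap (fun k => S.chartCoord hQ' i (j i) * S.chartCoord hQ i k) (j i)
        (hu.mul h1) := (projMap_smul _ _ _ _ _).symm
    _ = projMap (S.chartCoord hQ' i) (j i) hu := by congr 1; funext k; exact h k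
    _ = _ := projMap_eq_of_isUnit _ _ _ _ _

end SimplexCoordinates

end

section

open HomogeneousLocalization MvPolynomial

/-! ### The charts as open subschemes of the product -/

/-- The ring homomorphism `R → Γ(Z, ⊤)` of a morphism `Z → Spec R`. -/
def globalHom {Z : Scheme.{0}} {R : CommRingCat.{0}} (q : Z ⟶ Spec R) : R →+* Γ(Z, ⊤) :=
  ((Scheme.ΓSpecIso R).inv ≫ q.appTop).hom

lemma toSpecΓ_globalHom {Z : Scheme.{0}} {R : CommRingCat.{0}} (q : Z ⟶ Spec R) :
    Z.toSpecΓ ≫ Spec.map (CommRingCat.ofHom (globalHom q)) = q := by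
  simp only [globalHom, CommRingCat.ofHom_hom, Spec.map_comp]
  rw [← Scheme.toSpecΓ_naturality_assoc, toSpecΓ_SpecMap_ΓSpecIso_inv, Category.comp_id]

lemma globalHom_toSpecΓ {Z : Scheme.{0}} {R : CommRingCat.{0}} (φ : R →+* Γ(Z, ⊤)) :
    globalHom (Z.toSpecΓ ≫ Spec.map (CommRingCat.ofHom φ)) = φ := by
  simp [globalHom]

lemma globalHom_comp_SpecMap {Z : Scheme.{0}} {R R' : CommRingCat.{0}} (q : Z ⟶ Spec R)
    (φ : R' ⟶ R) : globalHom (q ≫ Spec.map φ) = (globalHom q).comp φ.hom := by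
  conv_lhs => rw [← toSpecΓ_globalHom q]
  rw [Category.assoc, ← Spec.map_comp]
  exact globalHom_toSpecΓ _

namespace SimplexCoordinates

variable {M : Type} [AddCommGroup M] {I : Type} {n : I → ℕ}
variable (S : SimplexCoordinates M n)

lemma awayEval_chartCoord {Q : AddSubmonoid M} {j : (i : I) → Fin (n i + 1)}
    (hQ : S.chartMonoid j ≤ Q) (i : I) (k : Fin (n i + 1))
    (h : IsUnit (aeval (S.chartCoord hQ i) (X (j i) : MvPolynomial (Fin (n i + 1)) ℂ))) :
    awayEval (S.chartCoord hQ i) (X (j i)) h (coordFraction k (j i)) = S.chartCoord hQ i k := by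
  have := awayEval_coordFraction (S.chartCoord hQ i) h k
  rwa [chartCoord_self, mul_one] at this

variable [Fintype I]

/-- A ring homomorphism out of the coordinate ring of a chart is determined by the values on
constants and on the normalized coordinates. -/
lemma chart_hom_ext {R : Type*} [CommRing R] {j : (i : I) → Fin (n i + 1)}
    {φ ψ : AddMonoidAlgebra ℂ (S.chartMonoid j) →+* R}
    (hC : ∀ r, φ (algebraMap ℂ _ r) = ψ (algebraMap ℂ _ r))
    (hX : ∀ i k, φ (S.chartCoord le_rfl i k) = ψ (S.chartCoord le_rfl i k)) : φ = ψ := by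
  have key : ∀ w : S.chartMonoid j, (AddMonoidAlgebra.single w 1 :
      AddMonoidAlgebra ℂ (S.chartMonoid j)) =
      ∏ i, ∏ k, S.chartCoord le_rfl i k ^ (S.coord w i k).toNat := by
    intro w
    simp only [chartCoord, AddMonoidAlgebra.single_pow, one_pow]
    have hs : ∀ {ι : Type} (s : Finset ι) (f : ι → S.chartMonoid j),
        ∏ x ∈ s, (AddMonoidAlgebra.single (f x) 1 : AddMonoidAlgebra ℂ (S.chartMonoid j)) =
          AddMonoidAlgebra.single (∑ x ∈ s, f x) 1 := by
      intro ι s f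
      classical
      induction s using Finset.induction_on with
      | empty => simp [AddMonoidAlgebra.one_def]
      | insert a s ha ih =>
        rw [Finset.prod_insert ha, Finset.sum_insert ha, ih, AddMonoidAlgebra.single_mul_single,
          one_mul]
    simp only [hs]
    congr 1
    refine Subtype.ext ?_
    simp only [AddSubmonoid.coe_finsetSum, AddSubmonoidClass.coe_nsmul]
    exact S.eq_sum_root w.2
  refine RingHom.ext fun f => ?_
  induction f using AddMonoidAlgebra.induction_linear with
  | zero => simp
  | add f g hf hg => rw [map_add, map_add, hf, hg]
  | single w r =>
    have : (AddMonoidAlgebra.single w r : AddMonoidAlgebra ℂ (S.chartMonoid j)) =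
        algebraMap ℂ _ r * AddMonoidAlgebra.single w 1 := by
      rw [← Algebra.smul_def, AddMonoidAlgebra.smul_single, smul_eq_mul, mul_one]
    rw [this, map_mul, map_mul, hC, key]
    simp [hX]

/-- A point of one chart lies in another one if and only if the coordinates of the latter do not
vanish there. -/
lemma toProduct_mem_productChart {Q : AddSubmonoid M} {j j' : (i : I) → Fin (n i + 1)}
    (hQ : S.chartMonoid j ≤ Q) (p : monoidSpec Q) :
    S.toProduct hQ p ∈ productChart j' ↔
      ∀ i, S.chartCoord hQ i (j' i) ∉ PrimeSpectrum.asIdeal p := by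
  rw [mem_productChart]
  refine forall_congr' fun i => ?_
  rw [← Scheme.Hom.comp_apply, toProduct_factorMap]
  exact projMap_mem_basicOpen _ (j i) (S.isUnit_chartCoord_self hQ i) (j' i) p

/-- Functions `y i k` with `y i (j i) = 1` define a homomorphism out of the coordinate ring of the
chart: the monomial `w` goes to the product of the `y i k ^ w_{ik}`. -/
def chartLift {R : Type*} [CommRing R] (j : (i : I) → Fin (n i + 1)) (c : ℂ →+* R)
    (y : (i : I) → Fin (n i + 1) → R) (hy : ∀ i, y i (j i) = 1) :
    AddMonoidAlgebra ℂ (S.chartMonoid j) →+* R :=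
  AddMonoidAlgebra.liftNCRingHom c
    { toFun := fun w => ∏ i, ∏ k, y i k ^ (S.coord w.toAdd.1 i k).toNat
      map_one' := by simp
      map_mul' := fun w w' => by
        simp only [← Finset.prod_mul_distrib]
        refine Finset.prod_congr rfl fun i _ => Finset.prod_congr rfl fun k _ => ?_
        rcases eq_or_ne k (j i) with rfl | hk
        · simp [hy]
        · rw [← pow_add, ← Int.toNat_add (w.toAdd.2 i k hk) (w'.toAdd.2 i k hk)]
          simp }
    (fun _ _ => Commute.all _ _)

section chartLift

variable {R : Type*} [CommRing R] (j : (i : I) → Fin (n i + 1)) (c : ℂ →+* R)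
    (y : (i : I) → Fin (n i + 1) → R) (hy : ∀ i, y i (j i) = 1)

lemma chartLift_algebraMap (r : ℂ) : S.chartLift j c y hy (algebraMap ℂ _ r) = c r := by
  rw [chartLift, AddMonoidAlgebra.coe_algebraMap]
  simp

lemma chartLift_chartCoord (i : I) (k : Fin (n i + 1)) :
    S.chartLift j c y hy (S.chartCoord le_rfl i k) = y i k := by
  have h : S.chartLift j c y hy (S.chartCoord le_rfl i k) =
      ∏ i', ∏ k', y i' k' ^ (S.coord (S.root i k (j i)) i' k').toNat := by
    simp [chartLift, chartCoord]
  rw [h, Finset.prod_eq_single i, Finset.prod_eq_single k]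
  · rcases eq_or_ne k (j i) with rfl | hk
    · simp [hy]
    · simp [coord_root_same, hk]
  · intro k' _ hk'
    rcases eq_or_ne k' (j i) with rfl | hk
    · simp [hy]
    · simp [coord_root_same, hk, hk']
  · simp
  · intro i' _ hi'
    simp [coord_root_of_ne S hi']
  · simp

end chartLift

/-- A scheme over the `j`-th chart of the product maps to `Spec ℂ[chartMonoid j]`. -/
lemma exists_chart_lift (j : (i : I) → Fin (n i + 1)) {W : Scheme.{0}} (ι : W ⟶ productScheme n)
    (hι : ∀ w, ι w ∈ productChart j) :
    ∃ h : W ⟶ monoidSpec (S.chartMonoid j), h ≫ S.toProduct le_rfl = ι := by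
  have hr : ∀ i, Set.range (ι ≫ factorMap n i) ⊆ Set.range
      (Proj.awayι (stdGrading (n i)) (X (j i)) (X_mem_stdGrading (j i)) one_pos) := by
    rintro i _ ⟨w, rfl⟩
    rw [← Scheme.Hom.coe_opensRange, Proj.opensRange_awayι]
    exact mem_productChart.1 (hι w) i
  let q : ∀ i, W ⟶ Spec (CommRingCat.of (Away (stdGrading (n i)) (X (j i)))) := fun i =>
    IsOpenImmersion.lift _ _ (hr i)
  have hq : ∀ i, q i ≫ Proj.awayι (stdGrading (n i)) (X (j i)) (X_mem_stdGrading (j i)) one_pos =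
      ι ≫ factorMap n i := fun i => IsOpenImmersion.lift_fac _ _ _
  have hqC : ∀ i, q i ≫ Spec.map (CommRingCat.ofHom (awayConst (j i))) =
      ι ≫ productStructure n := by
    intro i
    rw [← awayι_projStructure, reassoc_of% (hq i), factorMap_projStructure]
  have hone : ∀ i, globalHom (q i) (coordFraction (j i) (j i)) = 1 := fun i => by
    rw [coordFraction_self]; exact map_one _
  let θ := S.chartLift j (globalHom (ι ≫ productStructure n))
    (fun i k => globalHom (q i) (coordFraction k (j i))) hone
  refine ⟨W.toSpecΓ ≫ Spec.map (CommRingCat.ofHom θ), productScheme_hom_ext ?_ fun i => ?_⟩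
  · rw [Category.assoc, Category.assoc, toProduct_productStructure, ← Spec.map_comp,
      ← CommRingCat.ofHom_comp, ← toSpecΓ_globalHom (ι ≫ productStructure n)]
    congr 3
    exact RingHom.ext fun r => S.chartLift_algebraMap _ _ _ hone r
  · rw [Category.assoc, Category.assoc, toProduct_factorMap, projMap, ← Spec.map_comp_assoc,
      ← CommRingCat.ofHom_comp, ← hq, ← Category.assoc, ← toSpecΓ_globalHom (q i)]
    congr 4
    refine away_hom_ext (fun r => ?_) (fun k => ?_)
    · rw [RingHom.comp_apply, awayEval_awayConst]
      refine (S.chartLift_algebraMap _ _ _ hone r).trans ?_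
      rw [← hqC i, globalHom_comp_SpecMap]
      rfl
    · rw [RingHom.comp_apply, awayEval_chartCoord]
      exact S.chartLift_chartCoord _ _ _ hone i k

/-- A morphism to `Spec ℂ[chartMonoid j]` is determined by the induced morphism to the product. -/
instance mono_toProduct (j : (i : I) → Fin (n i + 1)) :
    Mono (S.toProduct (le_refl (S.chartMonoid j))) := by
  refine ⟨fun {Z} g h hgh => ?_⟩
  rw [← toSpecΓ_globalHom g, ← toSpecΓ_globalHom h]
  congr 3
  have hi : ∀ i, (globalHom g).comp (awayEval (S.chartCoord le_rfl i) (X (j i))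
      (isUnit_aeval_X (S.isUnit_chartCoord_self le_rfl i))) =
      (globalHom h).comp (awayEval (S.chartCoord le_rfl i) (X (j i))
      (isUnit_aeval_X (S.isUnit_chartCoord_self le_rfl i))) := by
    intro i
    have h1 := congrArg (· ≫ factorMap n i) hgh
    simp only [Category.assoc, toProduct_factorMap, projMap] at h1
    rw [← Category.assoc, ← Category.assoc, cancel_mono] at h1
    have h2 := congrArg globalHom h1
    rwa [globalHom_comp_SpecMap, globalHom_comp_SpecMap] at h2
  refine S.chart_hom_ext (fun r => ?_) (fun i k => ?_)
  · have h1 := congrArg (· ≫ productStructure n) hgh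
    simp only [Category.assoc, toProduct_productStructure] at h1
    have h2 := congrArg globalHom h1
    rw [globalHom_comp_SpecMap, globalHom_comp_SpecMap] at h2
    exact congrArg (fun f => f r) h2
  · have := congrArg (fun f => f (coordFraction k (j i))) (hi i)
    simp only [RingHom.comp_apply, awayEval_chartCoord] at this
    exact this

lemma range_toProduct_subset (j : (i : I) → Fin (n i + 1)) (p) :
    S.toProduct (le_refl (S.chartMonoid j)) p ∈ productChart j := by
  rw [toProduct_mem_productChart]
  intro i
  rw [chartCoord_self]
  exact fun h => p.2.ne_top ((Ideal.eq_top_iff_one _).2 h)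

/-- `Spec ℂ[chartMonoid j]` is the `j`-th chart of the product. -/
lemma exists_iso_productChart (j : (i : I) → Fin (n i + 1)) :
    ∃ g : monoidSpec (S.chartMonoid j) ⟶ (productChart j).toScheme, IsIso g ∧
      g ≫ (productChart j).ι = S.toProduct (le_refl (S.chartMonoid j)) := by
  obtain ⟨h, hh⟩ := S.exists_chart_lift j (productChart j).ι fun w => w.2
  let g := IsOpenImmersion.lift (productChart j).ι (S.toProduct (le_refl (S.chartMonoid j))) (by
    rintro _ ⟨p, rfl⟩
    rw [← Scheme.Hom.coe_opensRange, Scheme.Opens.opensRange_ι]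
    exact S.range_toProduct_subset j p)
  have hg : g ≫ (productChart j).ι = S.toProduct (le_refl (S.chartMonoid j)) :=
    IsOpenImmersion.lift_fac _ _ _
  refine ⟨g, ⟨h, ?_, ?_⟩, hg⟩
  · rw [← cancel_mono (S.toProduct (le_refl (S.chartMonoid j))), Category.assoc, hh, hg,
      Category.id_comp]
  · rw [← cancel_mono (productChart j).ι, Category.assoc, hg, hh, Category.id_comp]

instance isOpenImmersion_toProduct (j : (i : I) → Fin (n i + 1)) :
    IsOpenImmersion (S.toProduct (le_refl (S.chartMonoid j))) := by
  obtain ⟨g, hg, h⟩ := S.exists_iso_productChart j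
  rw [← h]
  infer_instance

lemma range_toProduct (j : (i : I) → Fin (n i + 1)) :
    Set.range (S.toProduct (le_refl (S.chartMonoid j))) = productChart j := by
  obtain ⟨g, hg, h⟩ := S.exists_iso_productChart j
  rw [← h, ← Scheme.Hom.coe_opensRange, Scheme.Hom.opensRange_comp_of_isIso,
    Scheme.Opens.opensRange_ι]

end SimplexCoordinates

end

/-! ### Toric varieties whose fan is that of a product of projective spaces -/

/-- The chart `U_τ → X(Δ)` of a cone `τ` of the fan. -/
def Fan.chart {N : Type} [AddCommGroup N] (Δ : Fan N) (τ : Δ.Cone) :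
    affineToric τ.1 ⟶ colimit Δ.diagram :=
  colimit.ι Δ.diagram τ

instance Fan.isOpenImmersion_chart {N : Type} [AddCommGroup N] (Δ : Fan N) (τ : Δ.Cone) :
    IsOpenImmersion (Δ.chart τ) :=
  inferInstanceAs (IsOpenImmersion (colimit.ι Δ.diagram τ))

lemma Fan.map_chart {N : Type} [AddCommGroup N] (Δ : Fan N) {τ σ : Δ.Cone} (h : τ ≤ σ) :
    affineToricMap (show τ.1 ≤ σ.1 from h) ≫ Δ.chart σ = Δ.chart τ :=
  colimit.w Δ.diagram (homOfLE h)

lemma Fan.exists_chart {N : Type} [AddCommGroup N] (Δ : Fan N) (x : ↥(colimit Δ.diagram)) :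
    ∃ (τ : Δ.Cone) (p : affineToric τ.1), Δ.chart τ p = x :=
  Scheme.IsLocallyDirected.ι_jointly_surjective Δ.diagram x

lemma Fan.chart_structure {N : Type} [AddCommGroup N] (Δ : Fan N) (τ : Δ.Cone) :
    Δ.chart τ ≫ colimit.desc Δ.diagram Δ.structureCocone = affineToricStructure τ.1 :=
  colimit.ι_desc _ _

section SimplexFan

variable {N : Type} [AddCommGroup N] {I : Type} {n : I → ℕ}

lemma mem_dualSemigroup_hull {s : Set N} {m : Module.Dual ℤ N} :
    m ∈ dualSemigroup (PointedCone.hull ℝ (latticePoint '' s)) ↔ ∀ v ∈ s, 0 ≤ m v := by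
  constructor
  · intro h v hv
    have := h _ (PointedCone.subset_hull ⟨v, hv, rfl⟩)
    rw [realFunctional_latticePoint] at this
    exact_mod_cast this
  · intro h x hx
    induction hx using Submodule.span_induction with
    | mem x hx =>
      obtain ⟨v, hv, rfl⟩ := hx
      rw [realFunctional_latticePoint]
      exact_mod_cast h v hv
    | zero => simp
    | add x y _ _ hx hy => rw [map_add]; exact add_nonneg hx hy
    | smul a x _ hx =>
      have : a • x = (a : ℝ) • x := rfl
      rw [this, map_smul]
      exact mul_nonneg a.2 hx

/-- The cone generated by all vectors `v i k` with `k ≠ j i`. -/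
def simplexCone (v : (i : I) → Fin (n i + 1) → N) (j : (i : I) → Fin (n i + 1)) :
    PointedCone ℝ (ℝ ⊗[ℤ] N) :=
  PointedCone.hull ℝ (latticePoint '' {x | ∃ i k, k ≠ j i ∧ x = v i k})

lemma latticePoint_mem_simplexCone {v : (i : I) → Fin (n i + 1) → N}
    {j : (i : I) → Fin (n i + 1)} {i : I} {k : Fin (n i + 1)} (h : k ≠ j i) :
    latticePoint (v i k) ∈ simplexCone v j :=
  PointedCone.subset_hull ⟨_, ⟨i, k, h, rfl⟩, rfl⟩

lemma dualSemigroup_simplexCone (S : SimplexCoordinates (Module.Dual ℤ N) n)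
    {v : (i : I) → Fin (n i + 1) → N} (hv : ∀ m i k, S.coord m i k = m (v i k))
    (j : (i : I) → Fin (n i + 1)) : dualSemigroup (simplexCone v j) = S.chartMonoid j := by
  ext m
  rw [simplexCone, mem_dualSemigroup_hull, SimplexCoordinates.mem_chartMonoid]
  constructor
  · intro h i k hk
    rw [hv]
    exact h _ ⟨i, k, hk, rfl⟩
  · rintro h _ ⟨i, k, hk, rfl⟩
    rw [← hv]
    exact h i k hk

variable [Fintype I]

lemma isOpenImmersion_toProduct_of_eq {M : Type} [AddCommGroup M] (S : SimplexCoordinates M n)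
    {Q : AddSubmonoid M} {j : (i : I) → Fin (n i + 1)} (hQ : S.chartMonoid j = Q) :
    IsOpenImmersion (S.toProduct hQ.le) := by
  subst hQ
  infer_instance

lemma range_toProduct_of_eq {M : Type} [AddCommGroup M] (S : SimplexCoordinates M n)
    {Q : AddSubmonoid M} {j : (i : I) → Fin (n i + 1)} (hQ : S.chartMonoid j = Q) :
    Set.range (S.toProduct hQ.le) = productChart j := by
  subst hQ
  exact S.range_toProduct j

/-- If the maximal cones of `Δ` are the cones spanned by the vectors `v i k`, one of which is
omitted from each row `i`, and the `v i k` are dual to coordinates identifying the character lattice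
with the lattice of integer vectors whose rows have sum zero, then the toric variety of `Δ` is
`∏ i, ℙ^(n i)`. -/
theorem toricVariety_iso_product (Δ : Fan N) (S : SimplexCoordinates (Module.Dual ℤ N) n)
    (v : (i : I) → Fin (n i + 1) → N) (hv : ∀ m i k, S.coord m i k = m (v i k))
    (hmem : ∀ j, simplexCone v j ∈ Δ.cones)
    (hle : ∀ τ : Δ.Cone, ∃ j, τ.1 ≤ simplexCone v j) :
    Nonempty (Δ.toricVariety ≅ productOfProjectiveSpaces n) := by
  choose J hJ using hle
  have hd := dualSemigroup_simplexCone S hv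
  have hQ : ∀ {τ : Δ.Cone} {j}, τ.1 ≤ simplexCone v j → S.chartMonoid j ≤ dualSemigroup τ.1 :=
    fun h => (hd _).ge.trans (dualSemigroup_anti h)
  let c : Cocone Δ.diagram :=
    { pt := productScheme n
      ι :=
        { app := fun τ => S.toProduct (hQ (hJ τ))
          naturality := fun τ σ f => by
            refine (S.monoidSpecMap_toProduct (hQ (hJ σ))
              (dualSemigroup_anti (show τ.1 ≤ σ.1 from leOfHom f))).trans ?_
            exact (S.toProduct_eq _ _).trans (Category.comp_id _).symm } }
  let F : colimit Δ.diagram ⟶ productScheme n := colimit.desc Δ.diagram c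
  have hF : ∀ τ : Δ.Cone, Δ.chart τ ≫ F = S.toProduct (hQ (hJ τ)) :=
    fun τ => colimit.ι_desc _ _
  let σ : ((i : I) → Fin (n i + 1)) → Δ.Cone := fun j => ⟨simplexCone v j, hmem j⟩
  have hσ : ∀ j, Δ.chart (σ j) ≫ F = S.toProduct (hd j).ge := fun j =>
    (hF _).trans (S.toProduct_eq _ _)
  have hσo : ∀ j, IsOpenImmersion (S.toProduct (hd j).ge) := fun j =>
    isOpenImmersion_toProduct_of_eq S (hd j).symm
  have hopen : ∀ τ : Δ.Cone, IsOpenImmersion (S.toProduct (hQ (hJ τ))) := by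
    intro τ
    have h1 := Δ.isOpenImmersion_diagram (homOfLE (show τ ≤ σ (J τ) from hJ τ))
    have h2 := hσo (J τ)
    rw [← S.monoidSpecMap_toProduct (hd (J τ)).ge (dualSemigroup_anti (hJ τ))]
    exact @IsOpenImmersion.comp _ _ _ _ _ h1 h2
  -- Every point of the colimit lies in the chart of a maximal cone.
  have hsurj : ∀ x : ↥(colimit Δ.diagram), ∃ j, ∃ p : affineToric (simplexCone v j),
      Δ.chart (σ j) p = x := by
    intro x
    obtain ⟨τ, p, rfl⟩ := Δ.exists_chart x
    refine ⟨J τ, affineToricMap (hJ τ) p, ?_⟩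
    rw [← Δ.map_chart (show τ ≤ σ (J τ) from hJ τ)]
    rfl
  have hFp : ∀ j (p : affineToric (simplexCone v j)), F (Δ.chart (σ j) p) =
      S.toProduct (hd j).ge p := by
    intro j p
    rw [← hσ j]; rfl
  -- The chart of `σ j` meets the `j'`-th chart of the product in the image of the chart of
  -- `σ j ⊓ σ j'`.
  have hinter : ∀ j j' (p : affineToric (simplexCone v j)),
      S.toProduct (hd j).ge p ∈ productChart j' →
      ∃ z : affineToric (Δ.inter (σ j) (σ j')).1,
        affineToricMap (show (Δ.inter (σ j) (σ j')).1 ≤ (σ j).1 from inf_le_left) z = p := by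
    intro j j' p hp
    rw [S.toProduct_mem_productChart] at hp
    have hle : (Δ.inter (σ j) (σ j')).1 ≤ (σ j).1 := inf_le_left
    obtain ⟨m, hm, hface⟩ := Δ.isFace_of_le (show Δ.inter (σ j) (σ j') ≤ σ j from hle)
    have hr := range_affineToricMap (Δ.rational _ (hmem j)) (m := m) hm hface hle
    change p ∈ Set.range (affineToricMap hle)
    rw [hr]
    have hm' : m ∈ S.chartMonoid j := hd j ▸ hm
    have hzero : ∀ i k, k ≠ j i → k ≠ j' i → m (v i k) = 0 := by
      intro i k h1 h2
      have := ((hface (latticePoint (v i k))).1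
        ⟨latticePoint_mem_simplexCone h1, latticePoint_mem_simplexCone h2⟩).2
      rw [realFunctional_latticePoint] at this
      exact_mod_cast this
    set K := ∑ i, (m (v i (j' i))).toNat with hK
    set u := ∑ i, S.root i (j' i) (j i) with hu
    have hucoord : ∀ i k, S.coord u i k =
        (if k = j' i then 1 else 0) - (if k = j i then 1 else 0) := by
      intro i k
      rw [hu, map_sum, Finset.sum_apply, Finset.sum_apply, Finset.sum_eq_single i,
        S.coord_root_same]
      · intro i' _ h
        rw [S.coord_root_of_ne h.symm]
      · simp
    have hdiff : K • u - m ∈ S.chartMonoid j := by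
      intro i k hk
      rw [map_sub, map_nsmul, Pi.sub_apply, Pi.sub_apply, Pi.smul_apply, Pi.smul_apply, hucoord,
        hv, if_neg hk, sub_zero]
      by_cases h : k = j' i
      · rw [if_pos h, nsmul_eq_mul, mul_one, h]
        have h1 : (m (v i (j' i))).toNat ≤ K :=
          Finset.single_le_sum (f := fun i => (m (v i (j' i))).toNat) (fun _ _ => Nat.zero_le _)
            (Finset.mem_univ i)
        omega
      · rw [if_neg h, hzero i k hk h]; simp
    have hu' : u ∈ S.chartMonoid j := AddSubmonoid.sum_mem _ fun i _ =>
      S.root_mem_chartMonoid j i (j' i)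
    -- The character `K u = m + (K u - m)` does not vanish at `p`.
    have hmul : (AddMonoidAlgebra.single (⟨m, hm⟩ : dualSemigroup (simplexCone v j)) (1 : ℂ)) *
        AddMonoidAlgebra.single ⟨K • u - m, (hd j).ge hdiff⟩ 1 =
        (∏ i, S.chartCoord (hd j).ge i (j' i)) ^ K := by
      have hs : ∀ s : Finset I, ∏ i ∈ s, S.chartCoord (hd j).ge i (j' i) =
          AddMonoidAlgebra.single (∑ i ∈ s, (⟨S.root i (j' i) (j i), (hd j).ge
            (S.root_mem_chartMonoid j i (j' i))⟩ : dualSemigroup (simplexCone v j))) (1 : ℂ) := by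
        classical
        intro s
        induction s using Finset.induction_on with
        | empty => simp [AddMonoidAlgebra.one_def]
        | insert a s ha ih =>
          rw [Finset.prod_insert ha, Finset.sum_insert ha, ih, SimplexCoordinates.chartCoord,
            AddMonoidAlgebra.single_mul_single, one_mul]
      rw [hs, AddMonoidAlgebra.single_pow, AddMonoidAlgebra.single_mul_single, one_pow, one_mul]
      congr 1
      refine Subtype.ext ?_
      simp only [AddSubmonoid.coe_add, AddSubmonoidClass.coe_nsmul, AddSubmonoid.coe_finsetSum]
      rw [← hu]
      abel
    intro hmp
    have h1 := Ideal.mul_mem_right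
      (AddMonoidAlgebra.single ⟨K • u - m, (hd j).ge hdiff⟩ (1 : ℂ)) _ hmp
    rw [hmul] at h1
    have h2 := p.2.mem_of_pow_mem _ h1
    obtain ⟨i, -, hi⟩ := (p.2.prod_mem_iff).1 h2
    exact hp i hi
  have hinj : Function.Injective F := by
    intro x y hxy
    obtain ⟨j, p, rfl⟩ := hsurj x
    obtain ⟨j', p', rfl⟩ := hsurj y
    have hle1 : Δ.inter (σ j) (σ j') ≤ σ j :=
      show (σ j).1 ⊓ (σ j').1 ≤ (σ j).1 from inf_le_left
    have hle2 : Δ.inter (σ j) (σ j') ≤ σ j' :=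
      show (σ j).1 ⊓ (σ j').1 ≤ (σ j').1 from inf_le_right
    have hxy' := hxy
    rw [hFp, hFp] at hxy'
    obtain ⟨z, hz⟩ := hinter j j' p (by
      rw [hxy']
      exact (range_toProduct_of_eq S (hd j').symm).subset ⟨p', rfl⟩)
    have hz1 : Δ.chart (σ j) p = Δ.chart (Δ.inter (σ j) (σ j')) z := by
      rw [← Δ.map_chart hle1, ← hz]
      rfl
    have hz2 : Δ.chart (σ j') (affineToricMap hle2 z) = Δ.chart (Δ.inter (σ j) (σ j')) z := by
      rw [← Δ.map_chart hle2]
      rfl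
    rw [hz1, ← hz2] at hxy ⊢
    congr 1
    have h3 := hσo j'
    refine (S.toProduct (hd j').ge).isOpenEmbedding.injective ?_
    exact (hFp j' _).symm.trans (hxy.trans (hFp j' _))
  have hFo : ∀ τ : Δ.Cone, IsOpenImmersion (Δ.chart τ ≫ F) := fun τ => by
    rw [hF]
    exact hopen τ
  have hFopen : IsOpenImmersion F := IsOpenImmersion.of_openCover_source F
    (Scheme.IsLocallyDirected.openCover Δ.diagram) hinj fun τ => hFo τ
  have hFsurj : Function.Surjective F := by
    intro y
    obtain ⟨j, hj⟩ := exists_mem_productChart y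
    obtain ⟨p, hp⟩ := (range_toProduct_of_eq S (hd j).symm).superset hj
    exact ⟨_, (hFp j p).trans hp⟩
  have hepi : Epi F.base := (TopCat.epi_iff_surjective _).2 hFsurj
  have hiso : IsIso F := IsOpenImmersion.isIso F
  let e : colimit Δ.diagram ≅ productScheme n := asIso F
  refine ⟨Over.isoMk e ?_⟩
  change F ≫ productStructure n = colimit.desc Δ.diagram Δ.structureCocone
  refine colimit.hom_ext fun τ => ?_
  have h1 : Δ.chart τ ≫ F ≫ productStructure n = affineToricStructure τ.1 := by
    rw [← Category.assoc, hF, S.toProduct_productStructure]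
    rfl
  exact h1.trans (Δ.chart_structure τ).symm

end SimplexFan

section

open HomogeneousLocalization MvPolynomial

/-! ### Infinitesimal automorphisms of projective space -/

section SpecHom

variable {A B C : Type} [CommRing A] [Algebra ℂ A] [CommRing B] [Algebra ℂ B]
  [CommRing C] [Algebra ℂ C]

/-- The morphism of spectra induced by a homomorphism of `ℂ`-algebras. -/
def specHom (φ : A →ₐ[ℂ] B) : Spec (CommRingCat.of B) ⟶ Spec (CommRingCat.of A) :=
  Spec.map (CommRingCat.ofHom φ.toRingHom)

lemma specHom_comp (ψ : B →ₐ[ℂ] C) (φ : A →ₐ[ℂ] B) :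
    specHom (ψ.comp φ) = specHom ψ ≫ specHom φ := by
  rw [specHom, specHom, specHom, ← Spec.map_comp, ← CommRingCat.ofHom_comp]
  rfl

lemma specHom_comp_assoc (ψ : B →ₐ[ℂ] C) (φ : A →ₐ[ℂ] B) {Z : Scheme.{0}}
    (f : Spec (CommRingCat.of A) ⟶ Z) :
    specHom (ψ.comp φ) ≫ f = specHom ψ ≫ specHom φ ≫ f := by
  rw [specHom_comp, Category.assoc]

lemma specHom_id : specHom (AlgHom.id ℂ A) = 𝟙 _ := Spec.map_id _

lemma specHom_injective {φ ψ : A →ₐ[ℂ] B} (h : specHom φ = specHom ψ) : φ = ψ := by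
  have h1 := congrArg CommRingCat.Hom.hom (Spec.map_injective h)
  exact AlgHom.ext fun a => congrArg (fun f => f a) h1

/-- The structure morphism of the spectrum of a `ℂ`-algebra. -/
abbrev specStructure (A : Type) [CommRing A] [Algebra ℂ A] :
    Spec (CommRingCat.of A) ⟶ Spec (CommRingCat.of ℂ) :=
  Spec.map (CommRingCat.ofHom (algebraMap ℂ A))

lemma specHom_specStructure (φ : A →ₐ[ℂ] B) :
    specHom φ ≫ specStructure A = specStructure B := by
  rw [specHom, ← Spec.map_comp, ← CommRingCat.ofHom_comp]
  congr 2
  exact φ.comp_algebraMap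

lemma exists_specHom_eq (f : Spec (CommRingCat.of B) ⟶ Spec (CommRingCat.of A))
    (hf : f ≫ specStructure A = specStructure B) : ∃ φ : A →ₐ[ℂ] B, specHom φ = f := by
  have h1 : Spec.map (CommRingCat.ofHom (Spec.preimage f).hom) = f := Spec.map_preimage f
  refine ⟨{ (Spec.preimage f).hom with commutes' := fun r => ?_ }, h1⟩
  rw [← h1, ← Spec.map_comp, ← CommRingCat.ofHom_comp] at hf
  have h2 := congrArg CommRingCat.Hom.hom (Spec.map_injective hf)
  exact congrArg (fun f => f r) h2

/-- The localization of a `ℂ`-algebra at an element, as a homomorphism of `ℂ`-algebras. -/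
def awayAlgHom (a : A) : A →ₐ[ℂ] Localization.Away a :=
  IsScalarTower.toAlgHom ℂ A (Localization.Away a)

/-- Morphisms out of `Spec A` agree if they do so on the members of a principal open cover. -/
lemma hom_ext_of_span_eq_top {ι : Type} {s : ι → A} (hs : Ideal.span (Set.range s) = ⊤)
    {Z : Scheme.{0}} {f g : Spec (CommRingCat.of A) ⟶ Z}
    (h : ∀ i, specHom (awayAlgHom (s i)) ≫ f = specHom (awayAlgHom (s i)) ≫ g) : f = g :=
  Scheme.Cover.hom_ext
    (Scheme.affineOpenCoverOfSpanRangeEqTop (R := CommRingCat.of A) s hs).openCover _ _ h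

/-- A morphism from `Spec R` to the spectrum of a `ℂ`-algebra makes `R` a `ℂ`-algebra. -/
lemma exists_algebra {R : Type} [CommRing R]
    (f : Spec (CommRingCat.of R) ⟶ Spec (CommRingCat.of A)) :
    ∃ _ : Algebra ℂ R, f ≫ specStructure A = specStructure R := by
  refine ⟨((Spec.preimage f).hom.comp (algebraMap ℂ A)).toAlgebra, ?_⟩
  conv_lhs => rw [specStructure, ← Spec.map_preimage f, ← Spec.map_comp]
  rfl

/-- Equality of two composites can be checked on `R`-valued points of their source. -/
lemma comp_eq_comp_of_points {W Z : Scheme.{0}} {a : W ⟶ Spec (CommRingCat.of A)}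
    {b : W ⟶ Spec (CommRingCat.of B)} (hab : a ≫ specStructure A = b ≫ specStructure B)
    {f : Spec (CommRingCat.of A) ⟶ Z} {g : Spec (CommRingCat.of B) ⟶ Z}
    (h : ∀ (R : Type) [CommRing R] [Algebra ℂ R] (r : Spec (CommRingCat.of R) ⟶ W) (φ : A →ₐ[ℂ] R)
      (ψ : B →ₐ[ℂ] R), r ≫ a = specHom φ → r ≫ b = specHom ψ → specHom φ ≫ f = specHom ψ ≫ g) :
    a ≫ f = b ≫ g := by
  refine Scheme.Cover.hom_ext W.affineOpenCover.openCover _ _ fun x => ?_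
  let R : Type := W.affineOpenCover.X x
  let r : Spec (CommRingCat.of R) ⟶ W := W.affineOpenCover.f x
  obtain ⟨_, ha⟩ := exists_algebra (r ≫ a)
  have hb : (r ≫ b) ≫ specStructure B = specStructure R := by
    rw [← ha, Category.assoc, Category.assoc, hab]
  obtain ⟨φ, hφ⟩ := exists_specHom_eq (r ≫ a) ha
  obtain ⟨ψ, hψ⟩ := exists_specHom_eq (r ≫ b) hb
  have h1 := h R r φ ψ hφ.symm hψ.symm
  rw [hφ, hψ, Category.assoc, Category.assoc] at h1
  exact h1

/-- Morphisms out of the principal open subsets of a cover of `Spec A` glue if they agree on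
`B`-valued points. -/
lemma exists_glue_of_span_eq_top {ι : Type} {s : ι → A} (hs : Ideal.span (Set.range s) = ⊤)
    {Z : Scheme.{0}} (f : ∀ i, Spec (CommRingCat.of (Localization.Away (s i))) ⟶ Z)
    (h : ∀ i j (B : Type) [CommRing B] [Algebra ℂ B] (φ : Localization.Away (s i) →ₐ[ℂ] B)
      (ψ : Localization.Away (s j) →ₐ[ℂ] B),
      φ.comp (awayAlgHom (s i)) = ψ.comp (awayAlgHom (s j)) →
        specHom φ ≫ f i = specHom ψ ≫ f j) :
    ∃ F : Spec (CommRingCat.of A) ⟶ Z, ∀ i, specHom (awayAlgHom (s i)) ≫ F = f i := by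
  let 𝒰 := (Scheme.affineOpenCoverOfSpanRangeEqTop (R := CommRingCat.of A) s hs).openCover
  have hf : ∀ i j : ι,
      pullback.fst (specHom (awayAlgHom (s i))) (specHom (awayAlgHom (s j))) ≫ f i =
      pullback.snd (specHom (awayAlgHom (s i))) (specHom (awayAlgHom (s j))) ≫ f j := by
    intro i j
    refine comp_eq_comp_of_points ?_ fun R _ _ r φ ψ hφ hψ => h i j R φ ψ (specHom_injective ?_)
    · rw [← specHom_specStructure (awayAlgHom (s i)), ← specHom_specStructure (awayAlgHom (s j)),
        ← Category.assoc, pullback.condition, Category.assoc]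
    · rw [specHom_comp, specHom_comp, ← hφ, ← hψ, Category.assoc, Category.assoc,
        pullback.condition]
  exact ⟨𝒰.glueMorphisms f hf, fun i => 𝒰.ι_glueMorphisms f hf i⟩

end SpecHom

section Translate

variable {n : ℕ} {A B : Type} [CommRing A] [Algebra ℂ A] [CommRing B] [Algebra ℂ B]

lemma specHom_projMap (x : Fin (n + 1) → A) (l : Fin (n + 1)) (h : IsUnit (x l)) (φ : A →ₐ[ℂ] B) :
    specHom φ ≫ projMap x l h = projMap (fun k => φ (x k)) l (h.map φ) :=
  SpecMap_projMap x l h φ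

/-- A morphism to projective space whose image lies in the chart `x_l ≠ 0` has homogeneous
coordinates. -/
lemma exists_eq_projMap {q : Spec (CommRingCat.of A) ⟶ Proj (stdGrading n)}
    (hq : q ≫ projStructure n = specStructure A) (l : Fin (n + 1))
    (hl : ∀ p, q p ∈ Proj.basicOpen (stdGrading n) (X l)) :
    ∃ (x : Fin (n + 1) → A) (h : IsUnit (x l)), q = projMap x l h := by
  have hr : Set.range q ⊆ Set.range
      (Proj.awayι (stdGrading n) (X l) (X_mem_stdGrading l) one_pos) := by
    rintro _ ⟨w, rfl⟩
    rw [← Scheme.Hom.coe_opensRange, Proj.opensRange_awayι]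
    exact hl w
  let r := IsOpenImmersion.lift _ _ hr
  have hr' : r ≫ Proj.awayι (stdGrading n) (X l) (X_mem_stdGrading l) one_pos = q :=
    IsOpenImmersion.lift_fac _ _ _
  let θ : Away (stdGrading n) (X l) →+* A := (Spec.preimage r).hom
  have hθ : Spec.map (CommRingCat.ofHom θ) = r := Spec.map_preimage r
  have h1 : IsUnit (θ (coordFraction l l)) := by
    rw [coordFraction_self, map_one]; exact isUnit_one
  refine ⟨fun k => θ (coordFraction k l), h1, ?_⟩
  rw [projMap, ← hr', ← hθ]
  congr 3
  refine away_hom_ext (fun c => ?_) fun k => ?_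
  · rw [awayEval_awayConst]
    rw [← hr', Category.assoc, awayι_projStructure, ← hθ, ← Spec.map_comp,
      ← CommRingCat.ofHom_comp] at hq
    have h2 := congrArg CommRingCat.Hom.hom (Spec.map_injective hq)
    exact congrArg (fun f => f c) h2
  · have := awayEval_coordFraction (fun k => θ (coordFraction k l)) (isUnit_aeval_X h1) k
    rw [coordFraction_self, map_one, mul_one] at this
    exact this.symm

/-- Every morphism to projective space is locally given by homogeneous coordinates. -/
lemma exists_span_eq_projMap {q : Spec (CommRingCat.of A) ⟶ Proj (stdGrading n)}
    (hq : q ≫ projStructure n = specStructure A) :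
    ∃ s : Spec (CommRingCat.of A) → A, Ideal.span (Set.range s) = ⊤ ∧
      ∀ p, ∃ (x : Fin (n + 1) → Localization.Away (s p)) (l : Fin (n + 1)) (h : IsUnit (x l)),
        specHom (awayAlgHom (s p)) ≫ q = projMap x l h := by
  have hs : ∀ p : Spec (CommRingCat.of A), ∃ (a : A) (l : Fin (n + 1)),
      a ∉ PrimeSpectrum.asIdeal p ∧
      ∀ p' : Spec (CommRingCat.of A), a ∉ PrimeSpectrum.asIdeal p' →
        q p' ∈ Proj.basicOpen (stdGrading n) (X l) := by
    intro p
    obtain ⟨l, hl⟩ := exists_mem_basicOpen (q p)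
    obtain ⟨_, ⟨_, ⟨a, rfl⟩, rfl⟩, ha, ha'⟩ :=
      PrimeSpectrum.isBasis_basic_opens.exists_subset_of_mem_open
        (show p ∈ ((q ⁻¹ᵁ Proj.basicOpen (stdGrading n) (X l) :
          (Spec (CommRingCat.of A)).Opens) : Set (Spec (CommRingCat.of A))) from hl)
        (q ⁻¹ᵁ Proj.basicOpen (stdGrading n) (X l)).isOpen
    exact ⟨a, l, ha, fun p' hp' => ha' hp'⟩
  choose s l hs hsl using hs
  refine ⟨s, ?_, fun p => ?_⟩
  · by_contra hne
    obtain ⟨m, hm, hle⟩ := Ideal.exists_le_maximal _ hne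
    exact hs ⟨m, hm.isPrime⟩ (hle (Ideal.subset_span ⟨_, rfl⟩))
  · obtain ⟨x, h, hx⟩ := exists_eq_projMap (q := specHom (awayAlgHom (s p)) ≫ q)
      (by rw [Category.assoc, hq, specHom_specStructure]) (l p) (fun p' => hsl p _ fun hmem => by
        have hu : IsUnit (awayAlgHom (s p) (s p)) :=
          IsLocalization.Away.algebraMap_isUnit (S := Localization.Away (s p)) (s p)
        exact p'.2.ne_top (Ideal.eq_top_of_isUnit_mem _ hmem hu))
    exact ⟨x, l p, h, hx⟩

/-- Morphisms out of `Spec A` agree if they do so wherever `q` has homogeneous coordinates. -/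
lemma hom_ext_of_projMap {q : Spec (CommRingCat.of A) ⟶ Proj (stdGrading n)}
    (hq : q ≫ projStructure n = specStructure A) {Z : Scheme.{0}}
    {f g : Spec (CommRingCat.of A) ⟶ Z}
    (h : ∀ (B : Type) [CommRing B] [Algebra ℂ B] (φ : A →ₐ[ℂ] B) (x : Fin (n + 1) → B) (l)
      (hl : IsUnit (x l)), specHom φ ≫ q = projMap x l hl → specHom φ ≫ f = specHom φ ≫ g) :
    f = g := by
  obtain ⟨s, hs, hx⟩ := exists_span_eq_projMap hq
  refine hom_ext_of_span_eq_top hs fun p => ?_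
  obtain ⟨x, l, hl, hxl⟩ := hx p
  exact h _ _ x l hl hxl

/-- Homogeneous coordinates of the same morphism are proportional. -/
lemma eq_mul_of_projMap_eq {x x' : Fin (n + 1) → A} {l l' : Fin (n + 1)} {h : IsUnit (x l)}
    {h' : IsUnit (x' l')} (hx : projMap x l h = projMap x' l' h') :
    ∃ u : A, IsUnit u ∧ ∀ k, x' k = u * x k := by
  have hu : IsUnit (x' l) := by
    by_contra hnu
    obtain ⟨m, hm, hmem⟩ := exists_max_ideal_of_mem_nonunits hnu
    have h1 := (projMap_mem_basicOpen x' l' h' l ⟨m, hm.isPrime⟩).1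
    rw [← hx] at h1
    exact h1 ((projMap_mem_basicOpen x l h l ⟨m, hm.isPrime⟩).2 fun hmem' =>
      hm.ne_top (Ideal.eq_top_of_isUnit_mem _ hmem' h)) hmem
  rw [projMap_eq_of_isUnit x' l' l h' hu, projMap, projMap, cancel_mono] at hx
  have h1 := congrArg CommRingCat.Hom.hom (Spec.map_injective hx)
  obtain ⟨w, hw⟩ := h.exists_left_inv
  refine ⟨x' l * w, hu.mul (IsUnit.of_mul_eq_one _ hw), fun k => ?_⟩
  have h2 := awayEval_coordFraction x (isUnit_aeval_X h) k
  have h3 := awayEval_coordFraction x' (isUnit_aeval_X hu) k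
  have h4 : awayEval x (X l) (isUnit_aeval_X h) (coordFraction k l) =
      awayEval x' (X l) (isUnit_aeval_X hu) (coordFraction k l) :=
    congrArg (fun f : Away (stdGrading n) (X l) →+* A => f (coordFraction k l)) h1
  rw [← h4] at h3
  linear_combination (-1) * h3 + x' l * w * h2 -
    (awayEval x (X l) (isUnit_aeval_X h) (coordFraction k l)) * x' l * hw

/-- The vector `x + e E x`. -/
def moveCoord (e : A) (E : Matrix (Fin (n + 1)) (Fin (n + 1)) ℂ) (x : Fin (n + 1) → A)
    (k : Fin (n + 1)) : A := x k + e * ∑ m, E k m • x m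

lemma map_moveCoord (φ : A →ₐ[ℂ] B) (e : A) (E : Matrix (Fin (n + 1)) (Fin (n + 1)) ℂ)
    (x : Fin (n + 1) → A) (k : Fin (n + 1)) :
    φ (moveCoord e E x k) = moveCoord (φ e) E (fun k => φ (x k)) k := by
  simp [moveCoord]

lemma moveCoord_mul (e u : A) (E : Matrix (Fin (n + 1)) (Fin (n + 1)) ℂ)
    (x : Fin (n + 1) → A) (k : Fin (n + 1)) :
    moveCoord e E (fun k => u * x k) k = u * moveCoord e E x k := by
  simp only [moveCoord, mul_add, Finset.mul_sum, mul_smul_comm]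
  congr 1
  exact Finset.sum_congr rfl fun m _ => by ring_nf

lemma isUnit_moveCoord {e : A} (he : e * e = 0) (E : Matrix (Fin (n + 1)) (Fin (n + 1)) ℂ)
    {x : Fin (n + 1) → A} {l : Fin (n + 1)} (h : IsUnit (x l)) : IsUnit (moveCoord e E x l) := by
  have : IsNilpotent (e * ∑ m, E l m • x m) := ⟨2, by rw [mul_pow, pow_two, he, zero_mul]⟩
  exact this.isUnit_add_left_of_commute h (Commute.all _ _)

/-- `q'` is the image of `q` under the infinitesimal automorphism `1 + e E` of projective space,
where `e ^ 2 = 0`: wherever `q` has homogeneous coordinates `x`, `q'` has homogeneous coordinates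
`x + e E x`. -/
def IsInfinitesimalMove (e : A) (E : Matrix (Fin (n + 1)) (Fin (n + 1)) ℂ)
    (q q' : Spec (CommRingCat.of A) ⟶ Proj (stdGrading n)) : Prop :=
  ∀ (B : Type) [CommRing B] [Algebra ℂ B] (φ : A →ₐ[ℂ] B) (x : Fin (n + 1) → B) (l)
    (hl : IsUnit (x l)), specHom φ ≫ q = projMap x l hl →
      ∃ hl', specHom φ ≫ q' = projMap (moveCoord (φ e) E x) l hl'

variable {e : A} {E : Matrix (Fin (n + 1)) (Fin (n + 1)) ℂ}
  {q q' q'' : Spec (CommRingCat.of A) ⟶ Proj (stdGrading n)}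

/-- `1 + e E` acts on morphisms to projective space, not only on their homogeneous coordinates. -/
lemma projMap_moveCoord_eq (he : e * e = 0) {x x' : Fin (n + 1) → A} {l l' : Fin (n + 1)}
    {h : IsUnit (x l)} {h' : IsUnit (x' l')} (hx : projMap x l h = projMap x' l' h') :
    projMap (moveCoord e E x) l (isUnit_moveCoord he E h) =
      projMap (moveCoord e E x') l' (isUnit_moveCoord he E h') := by
  obtain ⟨u, hu, hux⟩ := eq_mul_of_projMap_eq hx
  obtain rfl : x' = fun k => u * x k := funext hux
  have h1 : IsUnit (u * moveCoord e E x l) := hu.mul (isUnit_moveCoord he E h)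
  have h2 : IsUnit (u * moveCoord e E x l') := by
    rw [← moveCoord_mul]; exact isUnit_moveCoord he E h'
  rw [← projMap_smul (moveCoord e E x) l _ u h1, projMap_eq_of_isUnit _ l l' h1 h2]
  congr 1
  funext k
  rw [moveCoord_mul]

lemma IsInfinitesimalMove.specHom_comp (h : IsInfinitesimalMove e E q q') (φ : A →ₐ[ℂ] B) :
    IsInfinitesimalMove (φ e) E (specHom φ ≫ q) (specHom φ ≫ q') := by
  intro C _ _ ψ x l hl hx
  rw [← Category.assoc, ← ToricGeometry.specHom_comp] at hx ⊢
  exact h C _ x l hl hx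

lemma IsInfinitesimalMove.unique (hq : q ≫ projStructure n = specStructure A)
    (h : IsInfinitesimalMove e E q q') (h' : IsInfinitesimalMove e E q q'') : q' = q'' := by
  refine hom_ext_of_projMap hq fun B _ _ φ x l hl hx => ?_
  obtain ⟨_, h1⟩ := h B φ x l hl hx
  obtain ⟨_, h2⟩ := h' B φ x l hl hx
  rw [h1, h2]

lemma isInfinitesimalMove_zero : IsInfinitesimalMove 0 E q q := by
  intro B _ _ φ x l hl hx
  have : moveCoord (φ 0) E x = x := by funext k; simp [moveCoord]
  rw [this]
  exact ⟨hl, hx⟩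

lemma IsInfinitesimalMove.comp_projStructure (hq : q ≫ projStructure n = specStructure A)
    (h : IsInfinitesimalMove e E q q') : q' ≫ projStructure n = specStructure A := by
  refine hom_ext_of_projMap hq fun B _ _ φ x l hl hx => ?_
  obtain ⟨_, h1⟩ := h B φ x l hl hx
  rw [← Category.assoc, h1, projMap_projStructure, specHom_specStructure]

lemma isInfinitesimalMove_projMap (he : e * e = 0) (x : Fin (n + 1) → A) (l : Fin (n + 1))
    (hl : IsUnit (x l)) : IsInfinitesimalMove e E (projMap x l hl)
      (projMap (moveCoord e E x) l (isUnit_moveCoord he E hl)) := by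
  intro B _ _ φ x' l' hl' hx
  have he' : φ e * φ e = 0 := by rw [← map_mul, he, map_zero]
  refine ⟨isUnit_moveCoord he' E hl', ?_⟩
  rw [specHom_projMap] at hx ⊢
  rw [← projMap_moveCoord_eq he' hx]
  congr 1
  funext k
  exact map_moveCoord φ e E x k

/-- Infinitesimal automorphisms of projective space act on all points with values in a
`ℂ`-algebra. -/
lemma exists_isInfinitesimalMove (he : e * e = 0) (E : Matrix (Fin (n + 1)) (Fin (n + 1)) ℂ)
    (hq : q ≫ projStructure n = specStructure A) : ∃ q', IsInfinitesimalMove e E q q' := by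
  obtain ⟨s, hs, hx⟩ := exists_span_eq_projMap hq
  choose x l hl hx using hx
  have hep : ∀ p, awayAlgHom (s p) e * awayAlgHom (s p) e = 0 := fun p => by
    rw [← map_mul, he, map_zero]
  have hmove : ∀ p, IsInfinitesimalMove (awayAlgHom (s p) e) E (specHom (awayAlgHom (s p)) ≫ q)
      (projMap (moveCoord (awayAlgHom (s p) e) E (x p)) (l p)
        (isUnit_moveCoord (hep p) E (hl p))) := fun p => by
    rw [hx p]; exact isInfinitesimalMove_projMap (hep p) (x p) (l p) (hl p)
  obtain ⟨q', hq'⟩ := exists_glue_of_span_eq_top hs (fun p =>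
    projMap (moveCoord (awayAlgHom (s p) e) E (x p)) (l p)
      (isUnit_moveCoord (hep p) E (hl p))) (by
    intro i j B _ _ φ ψ hφψ
    have h1 := (hmove i).specHom_comp φ
    have h2 := (hmove j).specHom_comp ψ
    rw [← Category.assoc, ← specHom_comp] at h1 h2
    rw [← hφψ] at h2
    have h3 : ψ (awayAlgHom (s j) e) = φ (awayAlgHom (s i) e) :=
      (congrArg (fun f => f e) hφψ).symm
    rw [h3] at h2
    refine IsInfinitesimalMove.unique ?_ h1 h2
    rw [Category.assoc, hq, specHom_specStructure])
  refine ⟨q', fun B _ _ φ y k hk hy => ?_⟩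
  have he' : φ e * φ e = 0 := by rw [← map_mul, he, map_zero]
  refine ⟨isUnit_moveCoord he' E hk, ?_⟩
  have hspan : Ideal.span (Set.range fun p => φ (s p)) = ⊤ := by
    have h1 := congrArg (Ideal.map φ) hs
    rw [Ideal.map_span, Ideal.map_top, ← Set.range_comp] at h1
    exact h1
  refine hom_ext_of_span_eq_top hspan fun p => ?_
  -- The extension of `φ` to the localizations.
  have hunit : IsUnit ((awayAlgHom (φ (s p))).comp φ (s p)) :=
    IsLocalization.Away.algebraMap_isUnit (S := Localization.Away (φ (s p))) (φ (s p))
  let θ : Localization.Away (s p) →ₐ[ℂ] Localization.Away (φ (s p)) :=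
    IsLocalization.liftAlgHom (M := Submonoid.powers (s p))
      (f := (awayAlgHom (φ (s p))).comp φ) (by
        rintro ⟨_, k, rfl⟩
        simp only [map_pow]
        exact hunit.pow k)
  have hθ : θ.comp (awayAlgHom (s p)) = (awayAlgHom (φ (s p))).comp φ := by
    ext a
    exact IsLocalization.lift_eq _ _
  have h1 := (hmove p).specHom_comp θ
  rw [← Category.assoc, ← specHom_comp, hθ, ← hq' p, ← Category.assoc, ← specHom_comp, hθ,
    show θ (awayAlgHom (s p) e) = awayAlgHom (φ (s p)) (φ e) from congrArg (fun f => f e) hθ] at h1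
  have h2 := (isInfinitesimalMove_projMap (E := E) he' y k hk).specHom_comp (awayAlgHom (φ (s p)))
  rw [← hy, ← Category.assoc, ← specHom_comp] at h2
  rw [← Category.assoc, ← specHom_comp]
  refine IsInfinitesimalMove.unique ?_ h1 h2
  rw [Category.assoc, hq, specHom_specStructure]

end Translate

end

section

open HomogeneousLocalization MvPolynomial

/-! ### Infinitesimal automorphisms of open affine subschemes of a product of projective spaces -/

section DualNumber

variable {A B : Type} [CommRing A] [Algebra ℂ A] [CommRing B] [Algebra ℂ B]

/-- The inclusion `A → A[ε]`. -/
def dualIncl (A : Type) [CommRing A] [Algebra ℂ A] : A →ₐ[ℂ] DualNumber A :=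
  TrivSqZeroExt.inlAlgHom ℂ A A

/-- The reduction `A[ε] → A` modulo `ε`. -/
def dualFst (A : Type) [CommRing A] [Algebra ℂ A] : DualNumber A →ₐ[ℂ] A :=
  TrivSqZeroExt.fstHom ℂ A A

lemma dualFst_comp_dualIncl : (dualFst A).comp (dualIncl A) = AlgHom.id ℂ A := by
  ext; simp [dualFst, dualIncl]

/-- The homomorphism `A[ε] → B[ε]` induced by `A → B`. -/
def dualMap (φ : A →ₐ[ℂ] B) : DualNumber A →ₐ[ℂ] DualNumber B where
  toFun x := TrivSqZeroExt.inl (φ x.fst) + TrivSqZeroExt.inr (φ x.snd)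
  map_one' := by ext <;> simp
  map_mul' x y := by ext <;> simp
  map_zero' := by ext <;> simp
  map_add' x y := by ext <;> simp
  commutes' r := by ext <;> simp [TrivSqZeroExt.algebraMap_eq_inl']

@[simp] lemma fst_dualMap (φ : A →ₐ[ℂ] B) (x : DualNumber A) : (dualMap φ x).fst = φ x.fst := by
  simp [dualMap]

@[simp] lemma snd_dualMap (φ : A →ₐ[ℂ] B) (x : DualNumber A) : (dualMap φ x).snd = φ x.snd := by
  simp [dualMap]

lemma dualMap_eps (φ : A →ₐ[ℂ] B) : dualMap φ DualNumber.eps = DualNumber.eps := by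
  ext <;> simp

lemma dualMap_comp_dualIncl (φ : A →ₐ[ℂ] B) :
    (dualMap φ).comp (dualIncl A) = (dualIncl B).comp φ := by
  ext <;> simp [dualIncl]

/-- `Spec A[ε]` and `Spec A` have the same points. -/
lemma specHom_dualFst_surjective (p : Spec (CommRingCat.of (DualNumber A))) :
    ∃ p', specHom (dualFst A) p' = p := by
  refine ⟨specHom (dualIncl A) p, PrimeSpectrum.ext (Ideal.ext fun x => ?_)⟩
  change dualIncl A (dualFst A x) ∈ PrimeSpectrum.asIdeal p ↔ x ∈ PrimeSpectrum.asIdeal p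
  have hx : x = dualIncl A (dualFst A x) + TrivSqZeroExt.inr x.snd :=
    (TrivSqZeroExt.inl_fst_add_inr_snd_eq x).symm
  have hnil : (TrivSqZeroExt.inr x.snd : DualNumber A) ∈ PrimeSpectrum.asIdeal p := by
    refine p.2.mem_of_pow_mem 2 ?_
    rw [pow_two, TrivSqZeroExt.inr_mul_inr]
    exact Ideal.zero_mem _
  conv_rhs => rw [hx]
  exact (Ideal.add_mem_iff_left _ hnil).symm

variable {I : Type} [Finite I] {n : I → ℕ}

/-- `Φ : A → A[ε]` describes the restriction to an open affine subscheme `g : Spec A → ∏ i, ℙ^(n i)`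
of the infinitesimal automorphism `1 + ε E i` on each factor. -/
def IsFlow (E : (i : I) → Matrix (Fin (n i + 1)) (Fin (n i + 1)) ℂ)
    (g : Spec (CommRingCat.of A) ⟶ productScheme n) (Φ : A →ₐ[ℂ] DualNumber A) : Prop :=
  ∀ i, IsInfinitesimalMove DualNumber.eps (E i) (specHom (dualIncl A) ≫ g ≫ factorMap n i)
    (specHom Φ ≫ g ≫ factorMap n i)

variable {E : (i : I) → Matrix (Fin (n i + 1)) (Fin (n i + 1)) ℂ}

lemma comp_factorMap_projStructure {g : Spec (CommRingCat.of A) ⟶ productScheme n}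
    (hg : g ≫ productStructure n = specStructure A) (φ : A →ₐ[ℂ] B) (i : I) :
    (specHom φ ≫ g ≫ factorMap n i) ≫ projStructure (n i) = specStructure B := by
  rw [Category.assoc, Category.assoc, factorMap_projStructure, hg, specHom_specStructure]

variable (E) in
/-- An infinitesimal automorphism of the product does not move points, so it restricts to every open
subscheme; on an affine one it is a homomorphism `A → A[ε]` that is the identity modulo `ε`. -/
lemma exists_isFlow {g : Spec (CommRingCat.of A) ⟶ productScheme n} [IsOpenImmersion g]
    (hg : g ≫ productStructure n = specStructure A) :
    ∃ Φ : A →ₐ[ℂ] DualNumber A, (dualFst A).comp Φ = AlgHom.id ℂ A ∧ IsFlow E g Φ := by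
  have h := comp_factorMap_projStructure hg (dualIncl A)
  choose q' hq' using fun i => exists_isInfinitesimalMove DualNumber.eps_mul_eps (E i) (h i)
  obtain ⟨G, hG, hGi⟩ := exists_productScheme_lift (specStructure (DualNumber A)) q'
    fun i => (hq' i).comp_projStructure (h i)
  -- Modulo `ε` the infinitesimal automorphism is the identity.
  have hred : specHom (dualFst A) ≫ G = g := by
    refine productScheme_hom_ext ?_ fun i => ?_
    · rw [Category.assoc, hG, specHom_specStructure, hg]
    · rw [Category.assoc, hGi]
      have h1 := (hq' i).specHom_comp (dualFst A)
      rw [← Category.assoc, ← specHom_comp, dualFst_comp_dualIncl,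
        show dualFst A DualNumber.eps = 0 from DualNumber.fst_eps] at h1
      have hid : specHom (AlgHom.id ℂ A) ≫ g ≫ factorMap n i = g ≫ factorMap n i := by
        rw [specHom_id, Category.id_comp]
      have h2 := h1.unique (comp_factorMap_projStructure hg _ i) isInfinitesimalMove_zero
      rw [h2, hid]
  have hrange : Set.range G ⊆ Set.range g := by
    rintro _ ⟨p, rfl⟩
    obtain ⟨p', rfl⟩ := specHom_dualFst_surjective p
    exact ⟨p', by rw [← Scheme.Hom.comp_apply, hred]⟩
  let k := IsOpenImmersion.lift g G hrange
  have hk : k ≫ g = G := IsOpenImmersion.lift_fac _ _ _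
  obtain ⟨Φ, hΦ⟩ := exists_specHom_eq k (by rw [← hg, ← Category.assoc, hk, hG])
  refine ⟨Φ, specHom_injective ?_, fun i => ?_⟩
  · rw [← cancel_mono g, specHom_comp, hΦ, Category.assoc, hk, hred]
    rw [specHom_id, Category.id_comp]
  · rw [hΦ, ← Category.assoc k, hk, hGi]
    exact hq' i

/-- The restrictions of an infinitesimal automorphism to a chart and to a smaller one are
compatible. -/
lemma IsFlow.naturality {gA : Spec (CommRingCat.of A) ⟶ productScheme n} [Mono gA]
    (hgA : gA ≫ productStructure n = specStructure A)
    {gB : Spec (CommRingCat.of B) ⟶ productScheme n} {φ : A →ₐ[ℂ] B} (hφ : specHom φ ≫ gA = gB)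
    {Φ : A →ₐ[ℂ] DualNumber A} {Ψ : B →ₐ[ℂ] DualNumber B} (hΦ : IsFlow E gA Φ)
    (hΨ : IsFlow E gB Ψ) : (dualMap φ).comp Φ = Ψ.comp φ := by
  refine specHom_injective ?_
  rw [← cancel_mono gA]
  refine productScheme_hom_ext ?_ fun i => ?_
  · rw [Category.assoc, Category.assoc, hgA, specHom_specStructure, specHom_specStructure]
  · have h1 := (hΦ i).specHom_comp (dualMap φ)
    have h2 := hΨ i
    rw [← specHom_comp_assoc, ← specHom_comp_assoc, dualMap_comp_dualIncl, dualMap_eps] at h1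
    rw [← hφ, Category.assoc, ← specHom_comp_assoc, ← specHom_comp_assoc] at h2
    rw [Category.assoc, Category.assoc]
    exact h1.unique (comp_factorMap_projStructure hgA _ i) h2

/-- The infinitesimal automorphisms of a product of projective spaces act transitively on the
tangent vectors at each `ℂ`-point. -/
lemma exists_matrix_of_tangentVector {g : Spec (CommRingCat.of A) ⟶ productScheme n} [Mono g]
    (hg : g ≫ productStructure n = specStructure A) (t : A →ₐ[ℂ] DualNumber ℂ) :
    ∃ E : (i : I) → Matrix (Fin (n i + 1)) (Fin (n i + 1)) ℂ, ∀ Φ, IsFlow E g Φ →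
      (dualMap ((dualFst ℂ).comp t)).comp Φ = t := by
  have hz : ∀ i, ∃ (z : Fin (n i + 1) → DualNumber ℂ) (l : Fin (n i + 1)) (h : IsUnit (z l)),
      specHom t ≫ g ≫ factorMap n i = projMap z l h := by
    intro i
    -- `Spec ℂ[ε]` has only one point.
    have hone : ∀ p p' : Spec (CommRingCat.of (DualNumber ℂ)), p = p' := by
      intro p p'
      obtain ⟨r, rfl⟩ := specHom_dualFst_surjective p
      obtain ⟨r', rfl⟩ := specHom_dualFst_surjective p'
      rw [Subsingleton.elim (α := PrimeSpectrum ℂ) r r']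
    let p₀ : Spec (CommRingCat.of (DualNumber ℂ)) := specHom (dualFst ℂ) (⊥ : PrimeSpectrum ℂ)
    obtain ⟨l, hl⟩ := exists_mem_basicOpen ((specHom t ≫ g ≫ factorMap n i) p₀)
    obtain ⟨z, h, hz⟩ := exists_eq_projMap (comp_factorMap_projStructure hg t i) l
      fun p => hone p₀ p ▸ hl
    exact ⟨z, l, h, hz⟩
  choose z l hl hz using hz
  have hE : ∀ i, ∃ E : Matrix (Fin (n i + 1)) (Fin (n i + 1)) ℂ, ∀ k,
      ∑ m, E k m * (z i m).fst = (z i k).snd := by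
    intro i
    -- A matrix with one nonzero column maps the point `z` modulo `ε` to its velocity.
    have h0 : (z i (l i)).fst ≠ 0 := ((hl i).map (dualFst ℂ)).ne_zero
    refine ⟨fun k m => if m = l i then (z i k).snd / (z i (l i)).fst else 0, fun k => ?_⟩
    simp [h0]
  choose E hE using hE
  refine ⟨E, fun Φ hΦ => specHom_injective ?_⟩
  rw [← cancel_mono g]
  refine productScheme_hom_ext ?_ fun i => ?_
  · rw [Category.assoc, Category.assoc, hg, specHom_specStructure, specHom_specStructure]
  · have h1 := (hΦ i).specHom_comp (dualMap ((dualFst ℂ).comp t))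
    rw [← specHom_comp_assoc, ← specHom_comp_assoc, dualMap_comp_dualIncl, dualMap_eps,
      specHom_comp_assoc, specHom_comp_assoc, hz, specHom_projMap, specHom_projMap] at h1
    have h2 := isInfinitesimalMove_projMap (E := E i) DualNumber.eps_mul_eps
      (fun k => dualIncl ℂ (dualFst ℂ (z i k))) (l i)
      (((hl i).map (dualFst ℂ)).map (dualIncl ℂ))
    rw [Category.assoc, Category.assoc, hz]
    refine (h1.unique (projMap_projStructure _ _ _) h2).trans ?_
    congr 1
    funext k
    ext
    · simp [moveCoord, dualIncl, dualFst]
    · simp [moveCoord, dualIncl, dualFst, ← hE, TrivSqZeroExt.fst_sum]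

end DualNumber

end

/-! ### Rational cones, their faces and their rays -/

section Cones

variable {N : Type} [AddCommGroup N]

lemma latticePoint_eq (n : N) : latticePoint n = TensorProduct.mk ℤ ℝ N 1 n := rfl

lemma latticePoint_zero : latticePoint (0 : N) = 0 := by rw [latticePoint_eq, map_zero]

lemma latticePoint_neg (n : N) : latticePoint (-n) = -latticePoint n := by
  rw [latticePoint_eq, map_neg]; rfl

lemma latticePoint_sum {ι : Type} (s : Finset ι) (f : ι → N) :
    latticePoint (∑ i ∈ s, f i) = ∑ i ∈ s, latticePoint (f i) := by
  rw [latticePoint_eq, map_sum]; rfl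

lemma realFunctional_neg (m : Module.Dual ℤ N) (x : ℝ ⊗[ℤ] N) :
    realFunctional (-m) x = -realFunctional m x := by
  have h := realFunctional_add m (-m) x
  rw [add_neg_cancel, realFunctional_zero] at h
  linarith

lemma eq_zero_of_realFunctional {m : Module.Dual ℤ N} (h : ∀ x, realFunctional m x = 0) :
    m = 0 := by
  ext n
  have := h (latticePoint n)
  rw [realFunctional_latticePoint] at this
  exact_mod_cast this

lemma mem_hull_finset {s : Finset N} {x : ℝ ⊗[ℤ] N}
    (hx : x ∈ PointedCone.hull ℝ (latticePoint '' (s : Set N))) :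
    ∃ c : N → ℝ, (∀ n, 0 ≤ c n) ∧ x = ∑ n ∈ s, c n • latticePoint n := by
  classical
  induction hx using Submodule.span_induction with
  | mem x hx =>
    obtain ⟨n, hn, rfl⟩ := hx
    refine ⟨fun k => if k = n then 1 else 0, fun k => by
      beta_reduce; split_ifs <;> norm_num, ?_⟩
    rw [Finset.sum_eq_single n]
    · simp
    · intro k _ hk; simp [hk]
    · intro h; exact absurd hn h
  | zero => exact ⟨0, fun _ => le_rfl, by simp⟩
  | add x y _ _ hx hy =>
    obtain ⟨c, hc, rfl⟩ := hx
    obtain ⟨d, hd, rfl⟩ := hy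
    refine ⟨fun n => c n + d n, fun n => add_nonneg (hc n) (hd n), ?_⟩
    simp only [add_smul, Finset.sum_add_distrib]
  | smul a x _ hx =>
    obtain ⟨c, hc, rfl⟩ := hx
    refine ⟨fun n => a * c n, fun n => mul_nonneg a.2 (hc n), ?_⟩
    simp only [mul_smul, ← Finset.smul_sum]
    rfl

lemma sum_mem_cone {σ : PointedCone ℝ (ℝ ⊗[ℤ] N)} {ι : Type} {s : Finset ι} {c : ι → ℝ}
    {x : ι → ℝ ⊗[ℤ] N} (hc : ∀ i ∈ s, 0 ≤ c i) (hx : ∀ i ∈ s, x i ∈ σ) :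
    ∑ i ∈ s, c i • x i ∈ σ :=
  Submodule.sum_mem σ fun i hi => PointedCone.smul_mem σ (hc i hi) (hx i hi)

lemma zero_of_mem_of_neg_mem {σ : PointedCone ℝ (ℝ ⊗[ℤ] N)} (hσ : σ.toConvexCone.Salient)
    {x : ℝ ⊗[ℤ] N} (hx : x ∈ σ) (hx' : -x ∈ σ) : x = 0 := by
  by_contra h
  exact hσ x hx h hx'

lemma neg_mem_of_smul_add {σ : PointedCone ℝ (ℝ ⊗[ℤ] N)} {x y : ℝ ⊗[ℤ] N} {μ : ℝ} (hμ : 0 < μ)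
    (hy : y ∈ σ) (h : μ • x + y = 0) : -x ∈ σ := by
  have h1 : -x = μ⁻¹ • y := by
    rw [eq_neg_of_add_eq_zero_right h, smul_neg, smul_smul, inv_mul_cancel₀ hμ.ne', one_smul]
  rw [h1]
  exact PointedCone.smul_mem σ (inv_nonneg.2 hμ.le) hy

variable [Module.Free ℤ N] [Module.Finite ℤ N]

omit [Module.Finite ℤ N] in
/-- **Farkas' lemma** over the integers: if `b` is nonnegative on all `m ∈ M` on which the `a i` are
nonnegative, then a positive multiple of `b` is a nonnegative combination of the `a i`. -/
lemma farkas {ι : Type} (s : Finset ι) (a : ι → N) (b : N)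
    (h : ∀ m : Module.Dual ℤ N, (∀ i ∈ s, 0 ≤ m (a i)) → 0 ≤ m b) :
    ∃ (μ : ℤ) (c : ι → ℤ), 0 < μ ∧ (∀ i, 0 ≤ c i) ∧ μ • b = ∑ i ∈ s, c i • a i := by
  classical
  induction s using Finset.induction_on generalizing a b with
  | empty =>
    have hb : b = 0 := by
      refine (Module.forall_dual_apply_eq_zero_iff ℤ b).1 fun m => ?_
      have h1 := h m (by simp)
      have h2 := h (-m) (by simp)
      rw [LinearMap.neg_apply] at h2
      omega
    exact ⟨1, 0, one_pos, fun _ => le_rfl, by simp [hb]⟩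
  | insert k s hk ih =>
    by_cases hs : ∀ m : Module.Dual ℤ N, (∀ i ∈ s, 0 ≤ m (a i)) → 0 ≤ m b
    · obtain ⟨μ, c, hμ, hc, hb⟩ := ih a b hs
      refine ⟨μ, fun i => if i = k then 0 else c i, hμ, fun i => ?_, ?_⟩
      · dsimp only
        split_ifs
        exacts [le_rfl, hc i]
      · beta_reduce
        rw [Finset.sum_insert hk, if_pos rfl, zero_smul, zero_add, hb]
        refine Finset.sum_congr rfl fun i hi => ?_
        rw [if_neg (ne_of_mem_of_not_mem hi hk)]
    · push Not at hs
      obtain ⟨y, hy, hyb⟩ := hs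
      have hyk : y (a k) < 0 := by
        by_contra hge
        push Not at hge
        exact absurd (h y ((Finset.forall_mem_insert _ _ _).2 ⟨hge, hy⟩)) (not_le.2 hyb)
      -- Project along `y` to the functionals vanishing at `a k`.
      obtain ⟨μ, c, hμ, hc, hb⟩ := ih (fun i => (-y (a k)) • a i + y (a i) • a k)
        ((-y (a k)) • b + y b • a k) (fun m hm => by
          have h1 := h ((-y (a k)) • m + m (a k) • y) ((Finset.forall_mem_insert _ _ _).2
            ⟨?_, fun i hi => ?_⟩)
          · simp only [LinearMap.add_apply, LinearMap.smul_apply, smul_eq_mul, map_add,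
              map_smul] at h1 ⊢
            linarith
          · simp only [LinearMap.add_apply, LinearMap.smul_apply, smul_eq_mul]
            linarith
          · have h1 := hm i hi
            simp only [LinearMap.add_apply, LinearMap.smul_apply, smul_eq_mul, map_add,
              map_smul] at h1 ⊢
            linarith)
      refine ⟨μ * -y (a k), fun i => if i = k then ∑ i ∈ s, c i * y (a i) - μ * y b else
        c i * -y (a k), by nlinarith, fun i => ?_, ?_⟩
      · dsimp only
        split_ifs
        · have : 0 ≤ ∑ i ∈ s, c i * y (a i) :=
            Finset.sum_nonneg fun i hi => mul_nonneg (hc i) (hy i hi)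
          nlinarith
        · have := hc i
          nlinarith
      · have h2 : ∑ i ∈ s, (if i = k then ∑ i ∈ s, c i * y (a i) - μ * y b else
            c i * -y (a k)) • a i = ∑ i ∈ s, (c i * -y (a k)) • a i :=
          Finset.sum_congr rfl fun i hi => by rw [if_neg (ne_of_mem_of_not_mem hi hk)]
        beta_reduce
        rw [Finset.sum_insert hk, if_pos rfl, h2]
        simp only [smul_add, smul_smul, Finset.sum_add_distrib, ← Finset.sum_smul] at hb
        rw [sub_smul, ← add_left_inj ((μ * y b) • a k), hb]
        abel

lemma mem_hull_of_forall_dual {s : Finset N} {b : N}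
    (h : ∀ m : Module.Dual ℤ N, (∀ n ∈ s, 0 ≤ m n) → 0 ≤ m b) :
    latticePoint b ∈ PointedCone.hull ℝ (latticePoint '' (s : Set N)) := by
  obtain ⟨μ, c, hμ, hc, hb⟩ := farkas s id b h
  have hμ' : (0 : ℝ) < μ := by exact_mod_cast hμ
  have h1 : latticePoint b = (μ : ℝ)⁻¹ • ∑ n ∈ s, (c n : ℝ) • latticePoint n := by
    have := congrArg latticePoint hb
    rw [latticePoint_zsmul, latticePoint_sum] at this
    rw [eq_inv_smul_iff₀ hμ'.ne', this]
    exact Finset.sum_congr rfl fun n _ => latticePoint_zsmul _ _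
  rw [h1]
  refine PointedCone.smul_mem _ (inv_nonneg.2 hμ'.le) (sum_mem_cone (fun n _ => ?_) fun n hn => ?_)
  · exact_mod_cast hc n
  · exact PointedCone.subset_hull ⟨n, hn, rfl⟩

/-- A member of a minimal set of generators of a strongly convex rational cone spans a
one-dimensional face. -/
lemma isFace_hull_singleton {σ : PointedCone ℝ (ℝ ⊗[ℤ] N)} (hσ : σ.toConvexCone.Salient)
    {s : Finset N} (hs : σ = PointedCone.hull ℝ (latticePoint '' (s : Set N)))
    (hmin : ∀ t : Finset N, σ = PointedCone.hull ℝ (latticePoint '' (t : Set N)) →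
      s.card ≤ t.card) {v : N} (hv : v ∈ s) :
    v ≠ 0 ∧ IsFace (PointedCone.hull ℝ {latticePoint v}) σ := by
  classical
  have hmem : ∀ n ∈ s, latticePoint n ∈ σ := fun n hn => hs ▸ PointedCone.subset_hull ⟨n, hn, rfl⟩
  have hred : ∀ w ∈ s,
      latticePoint w ∉ PointedCone.hull ℝ (latticePoint '' ((s.erase w : Finset N) : Set N)) := by
    intro w hw hwm
    have h1 := hmin (s.erase w) (by
      rw [hs]
      refine le_antisymm (Submodule.span_le.2 ?_) (Submodule.span_mono
        (Set.image_mono (by exact_mod_cast Finset.erase_subset w s)))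
      rintro _ ⟨n, hn, rfl⟩
      by_cases hnw : n = w
      · rw [hnw]; exact hwm
      · exact PointedCone.subset_hull ⟨n, by exact_mod_cast Finset.mem_erase.2 ⟨hnw, hn⟩, rfl⟩)
    rw [Finset.card_erase_of_mem hw] at h1
    have := Finset.card_pos.2 ⟨w, hw⟩
    omega
  have hne : ∀ w ∈ s, w ≠ 0 := by
    rintro w hw rfl
    exact hred 0 hw (by rw [latticePoint_zero]; exact Submodule.zero_mem _)
  refine ⟨hne v hv, ?_⟩
  -- If no supporting functional separates `w` from `v`, Farkas' lemma yields a relation between the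
  -- generators that contradicts salience or minimality.
  have hex : ∀ w ∈ s.erase v, ∃ m : Module.Dual ℤ N, (∀ n ∈ s, 0 ≤ m n) ∧ m v = 0 ∧ 0 < m w := by
    intro w hw
    obtain ⟨hwv, hws⟩ := Finset.mem_erase.1 hw
    by_contra hno
    push Not at hno
    obtain ⟨μ, c, hμ, hc, hb⟩ := farkas (Finset.insertNone s) (fun o => o.elim (-v) id) (-w) (by
      intro m hm
      rw [Finset.forall_mem_insertNone] at hm
      have h1 : 0 ≤ m (-v) := hm.1
      have h2 : ∀ n ∈ s, 0 ≤ m n := hm.2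
      rw [map_neg] at h1 ⊢
      have := hno m h2 (le_antisymm (by omega) (h2 v hv))
      omega)
    rw [Finset.sum_insertNone, ← Finset.add_sum_erase _ _ hv] at hb
    have hb' := congrArg latticePoint hb
    set Y := ∑ n ∈ s.erase v, (c (some n) : ℝ) • latticePoint n with hY
    have hb2 : (μ : ℝ) • latticePoint w + Y = ((c none : ℝ) - c (some v)) • latticePoint v := by
      have h1 : latticePoint (c none • -v + (c (some v) • v + ∑ n ∈ s.erase v, c (some n) • n)) =
          (c none : ℝ) • -latticePoint v + ((c (some v) : ℝ) • latticePoint v + Y) := by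
        rw [latticePoint_eq, map_add, map_add, map_sum]
        simp only [← latticePoint_eq, latticePoint_zsmul, latticePoint_neg, hY]
      have h2 := hb'.trans h1
      rw [latticePoint_zsmul, latticePoint_neg] at h2
      rw [sub_smul]
      have : (μ : ℝ) • latticePoint w = -((μ : ℝ) • -latticePoint w) := by simp
      rw [this, h2]
      simp only [smul_neg]
      abel
    have hμ' : (0 : ℝ) < μ := by exact_mod_cast hμ
    have hYσ : ∀ {τ : PointedCone ℝ (ℝ ⊗[ℤ] N)}, (∀ n ∈ s.erase v, latticePoint n ∈ τ) → Y ∈ τ :=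
      fun h => sum_mem_cone (fun n _ => by exact_mod_cast hc _) h
    rcases le_or_gt ((c none : ℝ) - c (some v)) 0 with hle | hgt
    -- `-w` lies in the cone, contrary to salience.
    · have h3 : -latticePoint w ∈ σ := by
        refine neg_mem_of_smul_add (y := Y + (-((c none : ℝ) - c (some v))) • latticePoint v) hμ'
          (Submodule.add_mem σ (hYσ fun n hn => hmem n (Finset.mem_of_mem_erase hn))
            (PointedCone.smul_mem σ (neg_nonneg.2 hle) (hmem v hv))) ?_
        rw [← add_assoc, hb2, neg_smul, add_neg_cancel]
      have h4 := zero_of_mem_of_neg_mem hσ (hmem w hws) h3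
      rw [← latticePoint_zero] at h4
      exact hne w hws (latticePoint_injective h4)
    -- `v` is redundant, contrary to minimality.
    · refine hred v hv ?_
      have h5 : latticePoint v =
          ((c none : ℝ) - c (some v))⁻¹ • ((μ : ℝ) • latticePoint w + Y) := by
        rw [hb2, smul_smul, inv_mul_cancel₀ hgt.ne', one_smul]
      rw [h5]
      have h6 : ∀ n ∈ s.erase v, latticePoint n ∈
          PointedCone.hull ℝ (latticePoint '' ((s.erase v : Finset N) : Set N)) := fun n hn =>
        PointedCone.subset_hull ⟨n, hn, rfl⟩
      exact PointedCone.smul_mem _ (inv_nonneg.2 hgt.le) (Submodule.add_mem _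
        (PointedCone.smul_mem _ hμ'.le (h6 w hw)) (hYσ h6))
  choose! m hm0 hmv hmw using hex
  set M := ∑ w ∈ s.erase v, m w with hM
  have hMapp : ∀ n, M n = ∑ w ∈ s.erase v, m w n := fun n => by
    rw [hM, LinearMap.sum_apply]
  have hMs : ∀ n ∈ s, 0 ≤ M n := fun n hn => by
    rw [hMapp]; exact Finset.sum_nonneg fun w hw => hm0 w hw n hn
  have hMv : M v = 0 := by rw [hMapp]; exact Finset.sum_eq_zero hmv
  have hMpos : ∀ n ∈ s.erase v, 0 < M n := fun n hn => by
    rw [hMapp]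
    exact Finset.sum_pos' (fun w hw => hm0 w hw n (Finset.mem_of_mem_erase hn)) ⟨n, hn, hmw n hn⟩
  have hMσ : M ∈ dualSemigroup σ := by
    rw [hs]; exact mem_dualSemigroup_hull.2 hMs
  refine ⟨M, hMσ, fun x => ⟨fun hx => ?_, fun ⟨hx, hx0⟩ => ?_⟩⟩
  · obtain ⟨a, rfl⟩ := Submodule.mem_span_singleton.1 hx
    refine ⟨Submodule.smul_mem _ _ (hmem v hv), ?_⟩
    have : a • latticePoint v = (a : ℝ) • latticePoint v := rfl
    rw [this, map_smul, realFunctional_latticePoint, hMv]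
    simp
  · rw [hs] at hx
    obtain ⟨c, hc, rfl⟩ := mem_hull_finset hx
    rw [map_sum] at hx0
    simp only [map_smul, realFunctional_latticePoint, smul_eq_mul] at hx0
    have h0 : ∀ n ∈ s, c n * (M n : ℝ) = 0 :=
      (Finset.sum_eq_zero_iff_of_nonneg fun n hn => mul_nonneg (hc n) (by
        exact_mod_cast hMs n hn)).1 hx0
    rw [Finset.sum_eq_single v]
    · exact PointedCone.smul_mem _ (hc v) (PointedCone.subset_hull rfl)
    · intro n hn hnv
      have h1 : (M n : ℝ) ≠ 0 := by
        exact_mod_cast (hMpos n (Finset.mem_erase.2 ⟨hnv, hn⟩)).ne'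
      rw [(mul_eq_zero.1 (h0 n hn)).resolve_right h1, zero_smul]
    · intro h; exact absurd hv h

namespace Fan

variable (Δ : Fan N)

lemma rayGenerator_spec (ρ : Δ.Ray) (n : N) :
    latticePoint n ∈ ρ.cone ↔ ∃ k : ℕ, n = k • Δ.rayGenerator ρ :=
  (Δ.existsUnique_generator ρ).choose_spec.1 n

lemma latticePoint_rayGenerator_mem (ρ : Δ.Ray) : latticePoint (Δ.rayGenerator ρ) ∈ ρ.cone :=
  (Δ.rayGenerator_spec ρ _).2 ⟨1, (one_smul _ _).symm⟩

/-- The ray generators lying in a cone of the fan generate that cone. -/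
lemma hull_rayGenerators (σ : Δ.Cone) :
    σ.1 = PointedCone.hull ℝ (latticePoint '' {v | ∃ ρ : Δ.Ray, ρ.cone ≤ σ.1 ∧
      v = Δ.rayGenerator ρ}) := by
  classical
  have hex : ∃ k : ℕ, ∃ s : Finset N,
      σ.1 = PointedCone.hull ℝ (latticePoint '' (s : Set N)) ∧ s.card = k := by
    obtain ⟨s, hs⟩ := Δ.rational σ.1 σ.2
    exact ⟨_, s, hs, rfl⟩
  obtain ⟨s, hs, hcard⟩ := Nat.find_spec hex
  have hmin : ∀ t : Finset N, σ.1 = PointedCone.hull ℝ (latticePoint '' (t : Set N)) →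
      s.card ≤ t.card := fun t ht => by
    rw [hcard]; exact Nat.find_min' hex ⟨t, ht, rfl⟩
  refine le_antisymm ?_ (Submodule.span_le.2 ?_)
  · conv_lhs => rw [hs]
    refine Submodule.span_le.2 ?_
    rintro _ ⟨v, hv, rfl⟩
    obtain ⟨hv0, hface⟩ := isFace_hull_singleton (Δ.salient σ.1 σ.2) hs hmin hv
    have hmem := Δ.face_mem σ.1 σ.2 _ hface
    have hle : PointedCone.hull ℝ {latticePoint v} ≤ σ.1 := by
      refine Submodule.span_le.2 ?_
      rintro _ rfl
      rw [hs]
      exact PointedCone.subset_hull ⟨v, hv, rfl⟩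
    let ρ : Δ.Ray := ⟨⟨_, hmem⟩, by
      have : Submodule.span ℝ ((PointedCone.hull ℝ {latticePoint v} :
          PointedCone ℝ (ℝ ⊗[ℤ] N)) : Set (ℝ ⊗[ℤ] N)) = Submodule.span ℝ {latticePoint v} :=
        Submodule.span_span_of_tower _ _ _
      rw [this]
      refine finrank_span_singleton fun h => hv0 (latticePoint_injective ?_)
      rw [h, latticePoint_zero]⟩
    obtain ⟨k, hk⟩ := (Δ.rayGenerator_spec ρ v).1 (PointedCone.subset_hull rfl)
    rw [hk, ← natCast_zsmul, latticePoint_zsmul]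
    exact PointedCone.smul_mem _ (by positivity) (PointedCone.subset_hull ⟨_, ⟨ρ, hle, rfl⟩, rfl⟩)
  · rintro _ ⟨_, ⟨ρ, hρ, rfl⟩, rfl⟩
    exact hρ (Δ.latticePoint_rayGenerator_mem ρ)

end Fan

end Cones

/-! ### Complete fans and the indecomposable elements of dual semigroups -/

section CompleteFans

variable {N : Type} [AddCommGroup N] [Module.Free ℤ N] [Module.Finite ℤ N]

namespace Fan

variable (Δ : Fan N)

/-- The dual semigroup of a cone is cut out by its rays. -/
lemma mem_dualSemigroup_iff (σ : Δ.Cone) {m : Module.Dual ℤ N} :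
    m ∈ dualSemigroup σ.1 ↔ ∀ ρ : Δ.Ray, ρ.cone ≤ σ.1 → 0 ≤ m (Δ.rayGenerator ρ) := by
  conv_lhs => rw [Δ.hull_rayGenerators σ]
  rw [mem_dualSemigroup_hull]
  exact ⟨fun h ρ hρ => h _ ⟨ρ, hρ, rfl⟩, by rintro h _ ⟨ρ, hρ, rfl⟩; exact h ρ hρ⟩

lemma ray_cone_eq (ρ : Δ.Ray) :
    ρ.cone = PointedCone.hull ℝ {latticePoint (Δ.rayGenerator ρ)} := by
  refine le_antisymm ?_ (Submodule.span_le.2 ?_)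
  · obtain ⟨s, hs⟩ := Δ.rational ρ.1.1 ρ.1.2
    change ρ.cone = _ at hs
    conv_lhs => rw [hs]
    refine Submodule.span_le.2 ?_
    rintro _ ⟨n, hn, rfl⟩
    obtain ⟨k, rfl⟩ := (Δ.rayGenerator_spec ρ n).1 (hs ▸ PointedCone.subset_hull ⟨n, hn, rfl⟩)
    rw [← natCast_zsmul, latticePoint_zsmul]
    exact PointedCone.smul_mem _ (by positivity) (PointedCone.subset_hull rfl)
  · rintro _ rfl
    exact Δ.latticePoint_rayGenerator_mem ρ

lemma ray_le_iff (ρ : Δ.Ray) {σ : PointedCone ℝ (ℝ ⊗[ℤ] N)} :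
    ρ.cone ≤ σ ↔ latticePoint (Δ.rayGenerator ρ) ∈ σ := by
  rw [ray_cone_eq]
  exact Submodule.span_le.trans Set.singleton_subset_iff

lemma rayGenerator_injective : Function.Injective Δ.rayGenerator := by
  intro ρ ρ' h
  refine Subtype.ext (Subtype.ext ?_)
  change ρ.cone = ρ'.cone
  rw [ray_cone_eq, ray_cone_eq, h]

lemma rayGenerator_ne_zero (ρ : Δ.Ray) : Δ.rayGenerator ρ ≠ 0 := by
  intro h
  have h1 : Submodule.span ℝ (ρ.cone : Set (ℝ ⊗[ℤ] N)) = ⊥ := by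
    rw [ray_cone_eq, h, latticePoint_zero]
    refine (Submodule.span_span_of_tower _ _ _).trans ?_
    simp
  have h2 := ρ.2
  change Module.finrank ℝ (Submodule.span ℝ (ρ.cone : Set (ℝ ⊗[ℤ] N))) = 1 at h2
  rw [h1, finrank_bot] at h2
  exact zero_ne_one h2

/-- Ray generators are primitive. -/
lemma exists_apply_rayGenerator_eq_one (ρ : Δ.Ray) :
    ∃ w : Module.Dual ℤ N, w (Δ.rayGenerator ρ) = 1 := by
  set v := Δ.rayGenerator ρ with hv
  -- The values of all characters at `v` are the multiples of some `g > 0`.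
  obtain ⟨g, hg⟩ := (IsPrincipalIdealRing.principal
    (LinearMap.range (Module.Dual.eval ℤ N v))).principal
  have hdvd : ∀ w : Module.Dual ℤ N, (|g| : ℤ) ∣ w v := fun w => by
    rw [abs_dvd]
    have : w v ∈ Submodule.span ℤ {g} := hg ▸ ⟨w, rfl⟩
    exact Ideal.mem_span_singleton.1 this
  obtain ⟨w, hw⟩ : ∃ w : Module.Dual ℤ N, w v = |g| := by
    have : |g| ∈ LinearMap.range (Module.Dual.eval ℤ N v) := by
      rw [hg]; exact Ideal.mem_span_singleton.2 ((dvd_abs g g).2 dvd_rfl)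
    exact this
  have hg0 : |g| ≠ 0 := by
    intro h
    refine Δ.rayGenerator_ne_zero ρ ((Module.forall_dual_apply_eq_zero_iff ℤ _).1 fun w => ?_)
    obtain ⟨c, hc⟩ := hdvd w
    rw [hc, h, zero_mul]
  have hgpos : 0 < |g| := lt_of_le_of_ne (abs_nonneg g) hg0.symm
  let b := Module.Free.chooseBasis ℤ N
  choose c hc using fun i => hdvd (b.coord i)
  have hvc : v = |g| • ∑ i, c i • b i := by
    conv_lhs => rw [← b.sum_repr v]
    rw [Finset.smul_sum]
    refine Finset.sum_congr rfl fun i _ => ?_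
    rw [smul_smul, ← hc]
    rfl
  have hmem : latticePoint (∑ i, c i • b i) ∈ ρ.cone := by
    have h1 := Δ.latticePoint_rayGenerator_mem ρ
    rw [← hv, hvc, latticePoint_zsmul] at h1
    have h2 : (0 : ℝ) < (|g| : ℤ) := by exact_mod_cast hgpos
    have h3 := PointedCone.smul_mem ρ.cone (inv_nonneg.2 h2.le) h1
    rwa [smul_smul, inv_mul_cancel₀ h2.ne', one_smul] at h3
  obtain ⟨k, hk⟩ := (Δ.rayGenerator_spec ρ _).1 hmem
  rw [← hv] at hk
  have h4 : |g| * (k * |g|) = |g| := by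
    conv_rhs => rw [← hw, hvc, hk]
    simp [hw]
  have h5 : |g| ∣ 1 := ⟨k, by
    have : |g| * (k * |g| - 1) = 0 := by linarith
    rcases mul_eq_zero.1 this with h | h
    · exact absurd h hg0
    · linarith⟩
  exact ⟨w, hw.trans (Int.eq_one_of_dvd_one (abs_nonneg g) h5)⟩

lemma exists_finset_rayGenerators (σ : Δ.Cone) :
    ∃ s : Finset N, (s : Set N) = {v | ∃ ρ : Δ.Ray, ρ.cone ≤ σ.1 ∧ v = Δ.rayGenerator ρ} := by
  refine (Set.Finite.subset (Set.finite_range Δ.rayGenerator) ?_).exists_finset_coe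
  rintro _ ⟨ρ, -, rfl⟩
  exact ⟨ρ, rfl⟩

/-- Some character is strictly positive on all rays of a given cone. -/
lemma exists_pos_on_rays (σ : Δ.Cone) : ∃ m ∈ dualSemigroup σ.1, ∀ ρ : Δ.Ray, ρ.cone ≤ σ.1 →
    0 < m (Δ.rayGenerator ρ) := by
  classical
  have : Fintype Δ.Ray := Fintype.ofFinite _
  have hex : ∀ ρ : Δ.Ray, ∃ m ∈ dualSemigroup σ.1, ρ.cone ≤ σ.1 → 0 < m (Δ.rayGenerator ρ) := by
    intro ρ
    by_cases hρ : ρ.cone ≤ σ.1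
    swap
    · exact ⟨0, zero_mem _, fun h => absurd h hρ⟩
    by_contra hno
    push Not at hno
    obtain ⟨s, hs⟩ := Δ.exists_finset_rayGenerators σ
    have h1 := mem_hull_of_forall_dual (s := s) (b := -Δ.rayGenerator ρ) fun m hm => by
      have h2 : m ∈ dualSemigroup σ.1 := by
        rw [Δ.hull_rayGenerators σ, ← hs]
        exact mem_dualSemigroup_hull.2 hm
      rw [map_neg]
      have := (hno m h2).2
      omega
    rw [hs, ← Δ.hull_rayGenerators σ, latticePoint_neg] at h1
    have h2 := zero_of_mem_of_neg_mem (Δ.salient σ.1 σ.2) ((Δ.ray_le_iff ρ).1 hρ) h1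
    rw [← latticePoint_zero] at h2
    exact Δ.rayGenerator_ne_zero ρ (latticePoint_injective h2)
  choose m hm hpos using hex
  refine ⟨∑ ρ, m ρ, sum_mem fun ρ _ => hm ρ, fun ρ hρ => ?_⟩
  rw [LinearMap.sum_apply]
  exact Finset.sum_pos' (fun ρ' _ => (Δ.mem_dualSemigroup_iff σ).1 (hm ρ') ρ hρ)
    ⟨ρ, Finset.mem_univ _, hpos ρ hρ⟩

variable {Δ}

/-- A character that is nonnegative on all rays of a complete fan vanishes. -/
lemma IsComplete.eq_zero (hΔ : Δ.IsComplete) {m : Module.Dual ℤ N}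
    (h : ∀ ρ, 0 ≤ m (Δ.rayGenerator ρ)) : m = 0 := by
  have h1 : ∀ x, 0 ≤ realFunctional m x := fun x => by
    obtain ⟨σ, hσ, hx⟩ := hΔ x
    exact (Δ.mem_dualSemigroup_iff ⟨σ, hσ⟩).2 (fun ρ _ => h ρ) x hx
  refine eq_zero_of_realFunctional fun x => le_antisymm ?_ (h1 x)
  have := h1 (-x)
  rw [map_neg] at this
  linarith

lemma IsComplete.eq_zero_of_nonpos (hΔ : Δ.IsComplete) {m : Module.Dual ℤ N}
    (h : ∀ ρ, m (Δ.rayGenerator ρ) ≤ 0) : m = 0 := by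
  rw [← neg_eq_zero]
  exact hΔ.eq_zero fun ρ => by rw [LinearMap.neg_apply]; have := h ρ; omega

/-- A cone is full-dimensional if it spans `N_ℝ`. -/
def Cone.IsFull (σ : Δ.Cone) : Prop := Submodule.span ℝ (σ.1 : Set (ℝ ⊗[ℤ] N)) = ⊤

omit [Module.Free ℤ N] [Module.Finite ℤ N] in
lemma IsComplete.iUnion_span_eq_univ (hΔ : Δ.IsComplete) :
    ⋃ σ : Δ.Cone, (Submodule.span ℝ (σ.1 : Set (ℝ ⊗[ℤ] N)) : Set (ℝ ⊗[ℤ] N)) = Set.univ := by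
  refine Set.eq_univ_of_forall fun x => ?_
  obtain ⟨σ, hσ, hx⟩ := hΔ x
  exact Set.mem_iUnion.2 ⟨⟨σ, hσ⟩, Submodule.subset_span hx⟩

omit [Module.Free ℤ N] [Module.Finite ℤ N] in
lemma IsComplete.exists_isFull (hΔ : Δ.IsComplete) : ∃ σ : Δ.Cone, σ.IsFull :=
  haveI : Finite Δ.Cone := Δ.finite.to_subtype
  Subspace.exists_eq_top_of_iUnion_eq_univ hΔ.iUnion_span_eq_univ

/-- For each ray there is a full-dimensional cone not containing it. -/
lemma IsComplete.exists_isFull_not_le (hΔ : Δ.IsComplete) (τ : Δ.Ray) :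
    ∃ σ : Δ.Cone, σ.IsFull ∧ ¬ τ.cone ≤ σ.1 := by
  classical
  have : Finite Δ.Cone := Δ.finite.to_subtype
  have : Fintype Δ.Cone := Fintype.ofFinite _
  -- `z` is generic, and `z - t v` is not contained in a cone containing `τ` for large `t`.
  obtain ⟨z, hz⟩ : ∃ z : ℝ ⊗[ℤ] N, ∀ σ : Δ.Cone, ¬ σ.IsFull →
      z ∉ Submodule.span ℝ (σ.1 : Set (ℝ ⊗[ℤ] N)) := by
    let s : Finset (Subspace ℝ (ℝ ⊗[ℤ] N)) :=
      (Finset.univ.filter fun σ : Δ.Cone => ¬ σ.IsFull).image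
        fun σ => Submodule.span ℝ (σ.1 : Set (ℝ ⊗[ℤ] N))
    have hs : ⊤ ∉ s := by
      intro h
      obtain ⟨σ, hσ, hσt⟩ := Finset.mem_image.1 h
      exact (Finset.mem_filter.1 hσ).2 hσt
    obtain ⟨z, hz⟩ :=
      (Set.ne_univ_iff_exists_notMem _).1 (Subspace.biUnion_ne_univ_of_top_notMem hs)
    refine ⟨z, fun σ hσ hmem => hz ?_⟩
    refine Set.mem_biUnion (x := Submodule.span ℝ (σ.1 : Set (ℝ ⊗[ℤ] N))) ?_ hmem
    exact Finset.mem_image.2 ⟨σ, Finset.mem_filter.2 ⟨Finset.mem_univ _, hσ⟩, rfl⟩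
  set v := latticePoint (Δ.rayGenerator τ) with hv
  -- Otherwise every full-dimensional cone contains `τ`.
  by_contra hno
  push Not at hno
  have hev : ∀ σ : Δ.Cone, ∀ᶠ t : ℝ in Filter.atTop, z - t • v ∉ σ.1 := by
    intro σ
    by_cases hσ : σ.IsFull
    · obtain ⟨m, hm, hpos⟩ := Δ.exists_pos_on_rays σ
      have hmv : (0 : ℝ) < realFunctional m v := by
        rw [hv, realFunctional_latticePoint]
        exact_mod_cast hpos τ (hno σ hσ)
      filter_upwards [Filter.eventually_gt_atTop (realFunctional m z / realFunctional m v)]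
        with t ht hmem
      have h1 := hm _ hmem
      rw [map_sub, map_smul, smul_eq_mul] at h1
      rw [div_lt_iff₀ hmv] at ht
      linarith
    · by_cases hvσ : v ∈ Submodule.span ℝ (σ.1 : Set (ℝ ⊗[ℤ] N))
      · refine Filter.Eventually.of_forall fun t hmem => hz σ hσ ?_
        have := Submodule.add_mem _ (Submodule.subset_span hmem) (Submodule.smul_mem _ t hvσ)
        rwa [sub_add_cancel] at this
      -- `v` is not in the span of `σ`, so at most one `t` is excluded.
      · by_cases hex : ∃ t₀ : ℝ, z - t₀ • v ∈ σ.1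
        · obtain ⟨t₀, ht₀⟩ := hex
          filter_upwards [Filter.eventually_gt_atTop t₀] with t ht hmem
          refine hvσ ?_
          have h1 := Submodule.sub_mem (Submodule.span ℝ (σ.1 : Set (ℝ ⊗[ℤ] N)))
            (Submodule.subset_span ht₀) (Submodule.subset_span hmem)
          have h2 : z - t₀ • v - (z - t • v) = (t - t₀) • v := by rw [sub_smul]; abel
          rw [h2] at h1
          exact (Submodule.smul_mem_iff _ (sub_pos.2 ht).ne').1 h1
        · push Not at hex
          exact Filter.Eventually.of_forall hex
  obtain ⟨t, ht⟩ := (Filter.eventually_all.2 hev).exists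
  obtain ⟨σ, hσ, hmem⟩ := hΔ (z - t • v)
  exact ht ⟨σ, hσ⟩ hmem

omit [Module.Free ℤ N] [Module.Finite ℤ N] in
lemma Cone.IsFull.eq_zero {σ : Δ.Cone} (hσ : σ.IsFull) {m : Module.Dual ℤ N}
    (h : m ∈ dualSemigroup σ.1) (h' : -m ∈ dualSemigroup σ.1) : m = 0 := by
  refine eq_zero_of_realFunctional fun x => ?_
  have hx : x ∈ Submodule.span ℝ (σ.1 : Set (ℝ ⊗[ℤ] N)) := by
    rw [show Submodule.span ℝ (σ.1 : Set (ℝ ⊗[ℤ] N)) = ⊤ from hσ]; trivial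
  induction hx using Submodule.span_induction with
  | mem x hx =>
    have h1 := h' x hx
    rw [realFunctional_neg] at h1
    exact le_antisymm (by linarith) (h x hx)
  | zero => simp
  | add x y _ _ hx hy => rw [map_add, hx, hy, add_zero]
  | smul a x _ hx => rw [map_smul, hx, smul_zero]

/-- An indecomposable element of the semigroup `σ^∨ ∩ M`: a nonzero element which is not the sum of
two nonzero elements. -/
def Cone.IsIndecomposable (σ : Δ.Cone) (u : Module.Dual ℤ N) : Prop :=
  u ∈ dualSemigroup σ.1 ∧ u ≠ 0 ∧
    ∀ a ∈ dualSemigroup σ.1, ∀ b ∈ dualSemigroup σ.1, a + b = u → a = 0 ∨ b = 0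

/-- If `σ` is full-dimensional, then `σ^∨ ∩ M` is generated by its indecomposable elements. -/
lemma Cone.IsFull.mem_closure {σ : Δ.Cone} (hσ : σ.IsFull) {m : Module.Dual ℤ N}
    (hm : m ∈ dualSemigroup σ.1) : m ∈ AddSubmonoid.closure {u | σ.IsIndecomposable u} := by
  classical
  have : Fintype Δ.Ray := Fintype.ofFinite _
  let s := Finset.univ.filter fun ρ : Δ.Ray => ρ.cone ≤ σ.1
  let ℓ : Module.Dual ℤ N → ℤ := fun m => ∑ ρ ∈ s, m (Δ.rayGenerator ρ)
  have hnn : ∀ m ∈ dualSemigroup σ.1, ∀ ρ ∈ s, 0 ≤ m (Δ.rayGenerator ρ) := fun m hm ρ hρ =>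
    (Δ.mem_dualSemigroup_iff σ).1 hm ρ (Finset.mem_filter.1 hρ).2
  have hℓ : ∀ m ∈ dualSemigroup σ.1, 0 ≤ ℓ m := fun m hm => Finset.sum_nonneg (hnn m hm)
  have hℓ0 : ∀ m ∈ dualSemigroup σ.1, m ≠ 0 → 0 < ℓ m := by
    intro m hm hm0
    refine lt_of_le_of_ne (hℓ m hm) fun h => hm0 (hσ.eq_zero hm ?_)
    have h1 := (Finset.sum_eq_zero_iff_of_nonneg (hnn m hm)).1 h.symm
    refine (Δ.mem_dualSemigroup_iff σ).2 fun ρ hρ => ?_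
    rw [LinearMap.neg_apply, h1 ρ (Finset.mem_filter.2 ⟨Finset.mem_univ _, hρ⟩), neg_zero]
  have hℓadd : ∀ a b, ℓ (a + b) = ℓ a + ℓ b := fun a b => by
    simp [ℓ, Finset.sum_add_distrib]
  obtain ⟨k, hk⟩ : ∃ k : ℕ, ℓ m ≤ k := ⟨(ℓ m).toNat, Int.self_le_toNat _⟩
  induction k generalizing m with
  | zero =>
    rcases eq_or_ne m 0 with rfl | h0
    · exact zero_mem _
    · have := hℓ0 m hm h0
      omega
  | succ k ih =>
    rcases eq_or_ne m 0 with rfl | h0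
    · exact zero_mem _
    by_cases hind : σ.IsIndecomposable m
    · exact AddSubmonoid.subset_closure hind
    · simp only [Cone.IsIndecomposable, not_and, not_forall, not_or] at hind
      obtain ⟨a, ha, b, hb, rfl, ha0, hb0⟩ := hind hm h0
      have h1 := hℓ0 a ha ha0
      have h2 := hℓ0 b hb hb0
      rw [hℓadd] at hk
      exact add_mem (ih ha (by push_cast at hk; omega)) (ih hb (by push_cast at hk; omega))

/-- If `σ` is full-dimensional, then the indecomposable elements of `σ^∨ ∩ M` generate `M`. -/
lemma Cone.closure_indecomposable_eq_top {σ : Δ.Cone} (hσ : σ.IsFull) :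
    AddSubgroup.closure {u | σ.IsIndecomposable u} = ⊤ := by
  classical
  have hle : ∀ m ∈ dualSemigroup σ.1, m ∈ AddSubgroup.closure {u | σ.IsIndecomposable u} := by
    intro m hm
    have h := hσ.mem_closure hm
    have h1 : AddSubmonoid.closure {u | σ.IsIndecomposable u} ≤
        (AddSubgroup.closure {u | σ.IsIndecomposable u}).toAddSubmonoid :=
      AddSubmonoid.closure_le.2 AddSubgroup.subset_closure
    exact h1 h
  refine eq_top_iff.2 fun m _ => ?_
  have : Fintype Δ.Ray := Fintype.ofFinite _
  obtain ⟨w, hw, hpos⟩ := Δ.exists_pos_on_rays σ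
  set k := ∑ ρ : Δ.Ray, (m (Δ.rayGenerator ρ)).natAbs with hk
  have h1 : m + k • w ∈ dualSemigroup σ.1 := by
    refine (Δ.mem_dualSemigroup_iff σ).2 fun ρ hρ => ?_
    have h2 : (m (Δ.rayGenerator ρ)).natAbs ≤ k :=
      Finset.single_le_sum (f := fun ρ : Δ.Ray => (m (Δ.rayGenerator ρ)).natAbs)
        (fun _ _ => Nat.zero_le _) (Finset.mem_univ ρ)
    have h3 := hpos ρ hρ
    have h4 : (k : ℤ) ≤ k * w (Δ.rayGenerator ρ) := by nlinarith [Int.natCast_nonneg k]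
    have h5 : (m + k • w) (Δ.rayGenerator ρ) =
      m (Δ.rayGenerator ρ) + k * w (Δ.rayGenerator ρ) := by simp
    omega
  have := AddSubgroup.sub_mem _ (hle _ h1) (AddSubgroup.nsmul_mem _ (hle _ hw) k)
  rwa [add_sub_cancel_right] at this

/-- The reflection argument: if the negatives of all indecomposable elements of the dual semigroups
of the full-dimensional cones are Demazure roots, then these elements are semisimple roots. -/
lemma IsComplete.mem_semisimpleRoots (hΔ : Δ.IsComplete)
    (H : ∀ σ : Δ.Cone, σ.IsFull → ∀ u, σ.IsIndecomposable u → -u ∈ Δ.roots) {σ : Δ.Cone}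
    (hσ : σ.IsFull) {u : Module.Dual ℤ N} (hu : σ.IsIndecomposable u) :
    u ∈ Δ.semisimpleRoots := by
  refine ⟨?_, H σ hσ u hu⟩
  obtain ⟨τ, hτ, hτ'⟩ := H σ hσ u hu
  simp only [LinearMap.neg_apply] at hτ hτ'
  obtain ⟨σ', hσ', hnle⟩ := hΔ.exists_isFull_not_le τ
  have hneg : -u ∈ dualSemigroup σ'.1 := (Δ.mem_dualSemigroup_iff σ').2 fun ρ hρ =>
    hτ' ρ (by rintro rfl; exact hnle hρ)
  -- An indecomposable summand `w` of `-u` which is negative at `τ`.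
  obtain ⟨w, hw, hwτ, hwu⟩ : ∃ w, σ'.IsIndecomposable w ∧ w (Δ.rayGenerator τ) < 0 ∧
      -u - w ∈ dualSemigroup σ'.1 := by
    have key : ∀ m ∈ AddSubmonoid.closure {u | σ'.IsIndecomposable u},
        m (Δ.rayGenerator τ) < 0 → ∃ w, σ'.IsIndecomposable w ∧ w (Δ.rayGenerator τ) < 0 ∧
          m - w ∈ dualSemigroup σ'.1 := by
      intro m hm
      have hle : AddSubmonoid.closure {u | σ'.IsIndecomposable u} ≤ dualSemigroup σ'.1 :=
        AddSubmonoid.closure_le.2 fun u hu => hu.1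
      induction hm using AddSubmonoid.closure_induction with
      | mem w hw => exact fun h => ⟨w, hw, h, by rw [sub_self]; exact zero_mem _⟩
      | zero => intro h; simp at h
      | add a b ha hb iha ihb =>
        intro h
        rw [LinearMap.add_apply] at h
        by_cases h1 : a (Δ.rayGenerator τ) < 0
        · obtain ⟨w, hw, hwτ, hm⟩ := iha h1
          exact ⟨w, hw, hwτ, by rw [add_sub_right_comm]; exact add_mem hm (hle hb)⟩
        · obtain ⟨w, hw, hwτ, hm⟩ := ihb (by omega)
          exact ⟨w, hw, hwτ, by rw [add_sub_assoc]; exact add_mem (hle ha) hm⟩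
    exact key _ (hσ'.mem_closure hneg) (by rw [LinearMap.neg_apply]; omega)
  obtain ⟨ρ, hρ, hρ'⟩ := H σ' hσ' w hw
  simp only [LinearMap.neg_apply] at hρ hρ'
  -- The ray at which `w` is positive lies in `σ'`.
  have hρσ : ρ.cone ≤ σ'.1 := by
    by_contra hno
    refine hw.2.1 (hσ'.eq_zero hw.1 ((Δ.mem_dualSemigroup_iff σ').2 fun ρ' h => ?_))
    exact hρ' ρ' (by rintro rfl; exact hno h)
  have h1 := (Δ.mem_dualSemigroup_iff σ').1 hwu ρ hρσ
  simp only [LinearMap.sub_apply, LinearMap.neg_apply] at h1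
  have h2 : u + w = 0 := by
    refine hΔ.eq_zero_of_nonpos fun ρ' => ?_
    rw [LinearMap.add_apply]
    by_cases hτρ : ρ' = τ
    · subst hτρ; omega
    · have h3 := hτ' ρ' hτρ
      by_cases hρρ : ρ' = ρ
      · subst hρρ; omega
      · have := hρ' ρ' hρρ
        omega
  rw [eq_neg_of_add_eq_zero_left h2]
  exact H σ' hσ' w hw

/-- The indecomposable elements for one full-dimensional cone are semisimple roots and generate `M`,
so they contain a basis of `M_ℝ`. -/
lemma IsComplete.hasIndependentSemisimpleRoots (hΔ : Δ.IsComplete)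
    (H : ∀ σ : Δ.Cone, σ.IsFull → ∀ u, σ.IsIndecomposable u → -u ∈ Δ.roots) :
    Δ.HasIndependentSemisimpleRoots := by
  classical
  obtain ⟨σ, hσ⟩ := hΔ.exists_isFull
  let W : Set (Module.Dual ℝ (ℝ ⊗[ℤ] N)) := realFunctional '' {u | σ.IsIndecomposable u}
  have hmem : ∀ m : Module.Dual ℤ N, realFunctional m ∈ Submodule.span ℝ W := by
    intro m
    have hm : m ∈ AddSubgroup.closure {u | σ.IsIndecomposable u} := by
      rw [Cone.closure_indecomposable_eq_top hσ]; trivial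
    induction hm using AddSubgroup.closure_induction with
    | mem u hu => exact Submodule.subset_span ⟨u, hu, rfl⟩
    | zero =>
      rw [show realFunctional (0 : Module.Dual ℤ N) = 0 from LinearMap.ext realFunctional_zero]
      exact zero_mem _
    | add a b _ _ ha hb =>
      rw [show realFunctional (a + b) = realFunctional a + realFunctional b from
        LinearMap.ext (realFunctional_add a b)]
      exact add_mem ha hb
    | neg a _ ha =>
      rw [show realFunctional (-a) = -realFunctional a from LinearMap.ext (realFunctional_neg a)]
      exact neg_mem ha
  have hspan : Submodule.span ℝ W = ⊤ := by
    refine eq_top_iff.2 fun f _ => ?_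
    let b := Module.Free.chooseBasis ℤ N
    have hf : f = ∑ i, f (latticePoint (b i)) • realFunctional (b.coord i) := by
      refine (b.baseChange ℝ).ext fun i => ?_
      rw [Module.Basis.baseChange_apply, LinearMap.sum_apply]
      change f (latticePoint (b i)) = ∑ x, f (latticePoint (b x)) • realFunctional (b.coord x)
        (latticePoint (b i))
      simp only [realFunctional_latticePoint]
      rw [Finset.sum_eq_single i]
      · simp
      · intro j _ hj
        simp [Finsupp.single_eq_of_ne hj]
      · simp
    rw [hf]
    exact Submodule.sum_mem _ fun i _ => Submodule.smul_mem _ _ (hmem _)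
  obtain ⟨B, hBW, hB, hli⟩ := exists_linearIndependent ℝ W
  let e := Module.Basis.mk hli (by rw [Subtype.range_coe, hB, hspan])
  have hfin : Module.finrank ℝ (Module.Dual ℝ (ℝ ⊗[ℤ] N)) = Module.finrank ℤ N := by
    rw [Subspace.dual_finrank_eq, Module.finrank_baseChange]
  let f : Fin (Module.finrank ℤ N) ≃ B := (Module.finBasisOfFinrankEq ℝ _ hfin).indexEquiv e
  choose u hu hu' using fun i => hBW (f i).2
  refine ⟨u, fun i => hΔ.mem_semisimpleRoots H hσ (hu i), ?_⟩
  rw [funext hu']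
  exact hli.comp f f.injective

end Fan

end CompleteFans

/-! ### Demazure roots from infinitesimal automorphisms -/

section RootsFromFlows

variable {N : Type} [AddCommGroup N] [Module.Free ℤ N] [Module.Finite ℤ N] {Δ : Fan N}

/-- The numerical shape of a homogeneous derivation of degree `-u`: if `χ^w ↦ ν(w) χ^(w - u)`
preserves the semigroup algebras of all rays and does not kill `χ^u`, then `-u` is a Demazure
root. -/
lemma Fan.IsComplete.neg_mem_roots (hΔ : Δ.IsComplete) {u : Module.Dual ℤ N}
    (ν : Module.Dual ℤ N →+ ℂ) (hu : ν u ≠ 0)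
    (h : ∀ (ρ : Δ.Ray) (w : Module.Dual ℤ N), 0 ≤ w (Δ.rayGenerator ρ) → ν w ≠ 0 →
      0 ≤ (w - u) (Δ.rayGenerator ρ)) : -u ∈ Δ.roots := by
  -- At a ray where `u` is positive, `ν` is a multiple of the evaluation, and `u` is `1`.
  have h1 : ∀ ρ : Δ.Ray, 0 < u (Δ.rayGenerator ρ) → ∀ w : Module.Dual ℤ N,
      w (Δ.rayGenerator ρ) = 0 → ν w = 0 := by
    intro ρ hρ w hw
    by_contra hne
    have := h ρ w hw.ge hne
    rw [LinearMap.sub_apply, hw] at this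
    omega
  have h2 : ∀ ρ : Δ.Ray, 0 < u (Δ.rayGenerator ρ) → u (Δ.rayGenerator ρ) = 1 := by
    intro ρ hρ
    obtain ⟨w, hw⟩ := Δ.exists_apply_rayGenerator_eq_one ρ
    have h3 : ν (u - u (Δ.rayGenerator ρ) • w) = 0 := h1 ρ hρ _ (by simp [hw])
    rw [map_sub, map_zsmul, sub_eq_zero] at h3
    have h4 : ν w ≠ 0 := by
      intro h0
      rw [h0, smul_zero] at h3
      exact hu h3
    have h5 := h ρ w (by rw [hw]; exact zero_le_one) h4
    rw [LinearMap.sub_apply, hw] at h5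
    omega
  have h3 : ∀ ρ : Δ.Ray, 0 < u (Δ.rayGenerator ρ) → ∀ w : Module.Dual ℤ N,
      ν w = (w (Δ.rayGenerator ρ)) • ν u := by
    intro ρ hρ w
    have := h1 ρ hρ (w - w (Δ.rayGenerator ρ) • u) (by simp [h2 ρ hρ])
    rwa [map_sub, map_zsmul, sub_eq_zero] at this
  obtain ⟨τ, hτ⟩ : ∃ τ, 0 < u (Δ.rayGenerator τ) := by
    by_contra hno
    push Not at hno
    exact hu (by rw [hΔ.eq_zero_of_nonpos hno, map_zero])
  refine ⟨τ, by rw [LinearMap.neg_apply, h2 τ hτ], fun τ' hne => ?_⟩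
  rw [LinearMap.neg_apply]
  -- `ν` is a multiple of the evaluation at both generators, so these are equal.
  by_contra hlt
  have hτ' : 0 < u (Δ.rayGenerator τ') := by omega
  refine hne (Δ.rayGenerator_injective (sub_eq_zero.1
    ((Module.forall_dual_apply_eq_zero_iff ℤ _).1 fun w => ?_)))
  have h4 := (h3 τ hτ w).symm.trans (h3 τ' hτ' w)
  rw [← sub_eq_zero, ← sub_smul] at h4
  have h5 := (smul_eq_zero.1 h4).resolve_right hu
  rw [map_sub]
  omega

/-- The zero cone belongs to a fan with at least one cone. -/
lemma Fan.bot_mem (σ : Δ.Cone) : (⊥ : PointedCone ℝ (ℝ ⊗[ℤ] N)) ∈ Δ.cones := by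
  obtain ⟨m, hm, hpos⟩ := Δ.exists_pos_on_rays σ
  refine Δ.face_mem σ.1 σ.2 _ ⟨m, hm, fun x => ⟨?_, fun ⟨hx, hx0⟩ => ?_⟩⟩
  · intro hx
    rw [(Submodule.mem_bot _).1 hx]
    exact ⟨zero_mem _, map_zero _⟩
  · obtain ⟨s, hs⟩ := Δ.exists_finset_rayGenerators σ
    rw [Δ.hull_rayGenerators σ, ← hs] at hx
    obtain ⟨c, hc, rfl⟩ := mem_hull_finset hx
    have hs' : ∀ n ∈ s, 0 < m n := by
      intro n hn
      obtain ⟨ρ, hρ, rfl⟩ := hs.subset hn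
      exact hpos ρ hρ
    rw [map_sum] at hx0
    simp only [map_smul, realFunctional_latticePoint, smul_eq_mul] at hx0
    have h0 := (Finset.sum_eq_zero_iff_of_nonneg fun n hn => mul_nonneg (hc n) (by
        exact_mod_cast (hs' n hn).le)).1 hx0
    rw [Submodule.mem_bot]
    refine Finset.sum_eq_zero fun n hn => ?_
    have h1 : (m n : ℝ) ≠ 0 := by exact_mod_cast (hs' n hn).ne'
    rw [(mul_eq_zero.1 (h0 n hn)).resolve_right h1, zero_smul]

section Laurent

variable {M : Type} [AddCommGroup M]

/-- The inclusion of a semigroup algebra into the group algebra. -/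
def toGroupAlgebra (Q : AddSubmonoid M) : AddMonoidAlgebra ℂ Q →ₐ[ℂ] AddMonoidAlgebra ℂ M :=
  AddMonoidAlgebra.mapDomainAlgHom ℂ ℂ Q.subtype

lemma toGroupAlgebra_single {Q : AddSubmonoid M} (w : Q) (r : ℂ) :
    toGroupAlgebra Q (AddMonoidAlgebra.single w r) = AddMonoidAlgebra.single (w : M) r := by
  simp [toGroupAlgebra]

lemma toGroupAlgebra_monoidAlgebraMap {Q Q' : AddSubmonoid M} (h : Q ≤ Q')
    (f : AddMonoidAlgebra ℂ Q) :
    toGroupAlgebra Q' (monoidAlgebraMap h f) = toGroupAlgebra Q f := by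
  induction f using AddMonoidAlgebra.induction_linear with
  | zero => simp
  | add f g hf hg => rw [map_add, map_add, map_add, hf, hg]
  | single w r =>
    have : monoidAlgebraMap h (AddMonoidAlgebra.single w r) =
        AddMonoidAlgebra.single (AddSubmonoid.inclusion h w) r := by simp [monoidAlgebraMap]
    rw [this, toGroupAlgebra_single, toGroupAlgebra_single]
    rfl

lemma mem_of_coeff_toGroupAlgebra_ne_zero {Q : AddSubmonoid M} {f : AddMonoidAlgebra ℂ Q} {w : M}
    (h : (toGroupAlgebra Q f).coeff w ≠ 0) : w ∈ Q := by
  classical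
  by_contra hw
  refine h ?_
  induction f using AddMonoidAlgebra.induction_linear with
  | zero => simp
  | add f g hf hg =>
    rw [map_add, AddMonoidAlgebra.coeff_add, Finsupp.add_apply]
    by_cases h1 : (toGroupAlgebra Q f).coeff w = 0
    · by_cases h2 : (toGroupAlgebra Q g).coeff w = 0
      · rw [h1, h2, add_zero]
      · exact absurd (hg h2) h2
    · exact absurd (hf h1) h1
  | single v r =>
    rw [toGroupAlgebra_single, AddMonoidAlgebra.coeff_single, Finsupp.single_apply, if_neg]
    rintro rfl
    exact hw v.2

/-- The tangent vector at the torus fixed point of `Spec ℂ[Q]`, `Q` without nonzero units, dual to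
an indecomposable element `u`: it sends `χ^u` to `ε` and all other nonconstant characters to `0`. -/
lemma exists_tangentVector {Q : AddSubmonoid M} (hQ : ∀ a ∈ Q, ∀ b ∈ Q, a + b = 0 → a = 0)
    {u : Q} (hu : u ≠ 0) (hind : ∀ a b : Q, a + b = u → a = 0 ∨ b = 0) :
    ∃ t : AddMonoidAlgebra ℂ Q →ₐ[ℂ] DualNumber ℂ,
      (∀ f, (t f).fst = (toGroupAlgebra Q f).coeff 0) ∧
      t (AddMonoidAlgebra.single u 1) = DualNumber.eps := by
  classical
  let t : AddMonoidAlgebra ℂ Q →ₐ[ℂ] DualNumber ℂ := AddMonoidAlgebra.lift ℂ (DualNumber ℂ) Q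
    { toFun := fun w => if w.toAdd = 0 then 1 else if w.toAdd = u then DualNumber.eps else 0
      map_one' := by simp
      map_mul' := fun a b => by
        rw [toAdd_mul]
        by_cases ha : a.toAdd = 0
        · rw [ha, zero_add, if_pos rfl, one_mul]
        by_cases hb : b.toAdd = 0
        · rw [hb, add_zero, if_pos rfl, mul_one]
        have hab : a.toAdd + b.toAdd ≠ 0 := fun h => ha (Subtype.ext
          (hQ _ a.toAdd.2 _ b.toAdd.2 (congrArg Subtype.val h)))
        have habu : a.toAdd + b.toAdd ≠ u := fun h => (hind _ _ h).elim ha hb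
        rw [if_neg hab, if_neg habu, if_neg ha, if_neg hb]
        split_ifs <;> simp }
  have ht : ∀ w r, t (AddMonoidAlgebra.single w r) =
      r • (if w = 0 then 1 else if w = u then DualNumber.eps else 0) := fun w r => by
    simp [t, AddMonoidAlgebra.lift_single]
  refine ⟨t, fun f => ?_, by rw [ht, if_neg hu, if_pos rfl, one_smul]⟩
  induction f using AddMonoidAlgebra.induction_linear with
  | zero => simp
  | add f g hf hg =>
    rw [map_add, map_add, TrivSqZeroExt.fst_add, hf, hg, AddMonoidAlgebra.coeff_add,
      Finsupp.add_apply]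
  | single w r =>
    rw [ht, toGroupAlgebra_single, AddMonoidAlgebra.coeff_single, Finsupp.single_apply]
    by_cases hw : w = 0
    · simp [hw]
    · have : (w : M) ≠ 0 := fun h => hw (Subtype.ext h)
      rw [if_neg hw, if_neg this]
      split_ifs <;> simp

end Laurent

/-- If the toric variety of a complete fan is a product of projective spaces, then the negatives of
the indecomposable elements of the dual semigroup of a full-dimensional cone are Demazure roots:
some infinitesimal automorphism moves the torus fixed point of the cone in the direction dual to
`u`, and its component of degree `-u` is still an infinitesimal automorphism. -/
theorem Fan.IsComplete.neg_mem_roots_of_iso (hΔ : Δ.IsComplete) {I : Type} [Finite I] {n : I → ℕ}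
    (e : Δ.toricVariety ≅ productOfProjectiveSpaces n) {σ : Δ.Cone} (hσ : σ.IsFull)
    {u : Module.Dual ℤ N} (hu : σ.IsIndecomposable u) : -u ∈ Δ.roots := by
  have heiso : IsIso e.hom.left := inferInstanceAs (IsIso ((Over.forget _).map e.hom))
  let e' : colimit Δ.diagram ⟶ productScheme n := e.hom.left
  have he' : IsIso e' := heiso
  let g : ∀ τ : Δ.Cone, affineToric τ.1 ⟶ productScheme n := fun τ => Δ.chart τ ≫ e'
  have hgo : ∀ τ, IsOpenImmersion (g τ) := fun τ => inferInstance
  have hg : ∀ τ, g τ ≫ productStructure n = specStructure (coneAlgebra τ.1) := fun τ => by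
    have h1 : e' ≫ productStructure n = colimit.desc Δ.diagram Δ.structureCocone := Over.w e.hom
    rw [Category.assoc, h1]
    exact Δ.chart_structure τ
  have hgle : ∀ {τ τ' : Δ.Cone} (h : τ ≤ τ'),
      specHom (monoidAlgebraMap (dualSemigroup_anti (show τ.1 ≤ τ'.1 from h))) ≫ g τ' = g τ :=
    fun {τ τ'} h => by
      have h1 := congrArg (· ≫ e') (Δ.map_chart h)
      exact (Category.assoc _ _ _).symm.trans h1
  obtain ⟨t, ht0, htu⟩ := exists_tangentVector (Q := dualSemigroup σ.1) (fun a ha b hb hab =>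
      hσ.eq_zero ha (by rwa [neg_eq_of_add_eq_zero_right hab])) (u := ⟨u, hu.1⟩)
    (fun h => hu.2.1 (congrArg Subtype.val h)) (fun a b hab =>
      (hu.2.2 a a.2 b b.2 (congrArg Subtype.val hab)).imp Subtype.ext Subtype.ext)
  obtain ⟨E, hE⟩ := exists_matrix_of_tangentVector (hg σ) t
  choose Φ hΦ1 hΦ using fun τ => exists_isFlow E (hg τ)
  have hnat : ∀ {τ τ' : Δ.Cone} (h : τ ≤ τ') (f : coneAlgebra τ'.1),
      (toGroupAlgebra _ (Φ τ (monoidAlgebraMap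
        (dualSemigroup_anti (show τ.1 ≤ τ'.1 from h)) f)).snd) =
        toGroupAlgebra _ (Φ τ' f).snd := by
    intro τ τ' h f
    have h1 := congrArg (fun θ => (θ f).snd) ((hΦ τ').naturality (hg τ') (hgle h) (hΦ τ))
    simp only [AlgHom.comp_apply, snd_dualMap] at h1
    rw [← h1, toGroupAlgebra_monoidAlgebraMap]
  -- The zero cone gives the torus, on which the vector field acts on all characters.
  let o : Δ.Cone := ⟨⊥, Fan.bot_mem σ⟩
  have ho : ∀ w : Module.Dual ℤ N, w ∈ dualSemigroup o.1 := fun w x hx => by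
    rw [(Submodule.mem_bot _).1 hx, map_zero]
  have hoτ : ∀ τ : Δ.Cone, o ≤ τ := fun τ => (bot_le : (⊥ : PointedCone ℝ (ℝ ⊗[ℤ] N)) ≤ τ.1)
  let χ : Module.Dual ℤ N → coneAlgebra o.1 := fun w => AddMonoidAlgebra.single ⟨w, ho w⟩ 1
  have hχmul : ∀ w w', χ (w + w') = χ w * χ w' := fun w w' => by
    rw [AddMonoidAlgebra.single_mul_single, one_mul]
    rfl
  have hfst : ∀ w, (Φ o (χ w)).fst = χ w := fun w => congrArg (fun θ => θ (χ w)) (hΦ1 o)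
  have hχτ : ∀ (τ : Δ.Cone) (w : dualSemigroup τ.1),
      monoidAlgebraMap (dualSemigroup_anti (show o.1 ≤ τ.1 from hoτ τ))
        (AddMonoidAlgebra.single w 1) = χ w := fun τ w => by
    simp [monoidAlgebraMap, χ]
    rfl
  -- `ν w` is the coefficient of `χ^(w - u)` in the derivative of `χ^w`; the Leibniz rule makes it
  -- additive.
  let ν : Module.Dual ℤ N →+ ℂ := AddMonoidHom.mk'
    (fun w => (toGroupAlgebra _ (Φ o (χ w)).snd).coeff (w - u)) (fun w w' => by
      rw [hχmul, map_mul, DualNumber.snd_mul, hfst, hfst, map_add, map_mul, map_mul,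
        toGroupAlgebra_single, toGroupAlgebra_single, AddMonoidAlgebra.coeff_add, Finsupp.add_apply,
        mul_comm _ (AddMonoidAlgebra.single w' 1), AddMonoidAlgebra.coeff_single_mul_apply,
        AddMonoidAlgebra.coeff_single_mul_apply, one_mul, one_mul, add_comm]
      congr 2 <;> abel)
  have hν : ∀ (τ : Δ.Cone) (w : dualSemigroup τ.1), ν w =
      (toGroupAlgebra _ (Φ τ (AddMonoidAlgebra.single w 1)).snd).coeff (w - u) := fun τ w => by
    rw [← hnat (hoτ τ), hχτ]
    rfl
  refine hΔ.neg_mem_roots ν ?_ fun ρ w hw hνw => ?_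
  · have h1 := hν σ ⟨u, hu.1⟩
    change ν u = (toGroupAlgebra _ (Φ σ _).snd).coeff (u - u) at h1
    rw [h1, sub_self, ← ht0]
    have h2 := congrArg (fun θ => (θ (AddMonoidAlgebra.single ⟨u, hu.1⟩ 1)).snd) (hE _ (hΦ σ))
    rw [htu] at h2
    simp only [AlgHom.comp_apply, snd_dualMap] at h2
    change (t (Φ σ _).snd).fst = _ at h2
    rw [h2, DualNumber.snd_eps]
    exact one_ne_zero
  · have hmem : ∀ w : Module.Dual ℤ N, w ∈ dualSemigroup ρ.1.1 ↔ 0 ≤ w (Δ.rayGenerator ρ) := by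
      intro w
      have : ρ.1.1 = PointedCone.hull ℝ (latticePoint '' {Δ.rayGenerator ρ}) := by
        rw [Set.image_singleton]; exact Δ.ray_cone_eq ρ
      rw [this, mem_dualSemigroup_hull]
      simp
    rw [← hmem]
    rw [hν ρ.1 ⟨w, (hmem w).2 hw⟩] at hνw
    exact mem_of_coeff_toGroupAlgebra_ne_zero hνw

end RootsFromFlows

/-! ### Complete fans with independent semisimple roots -/

section SemisimpleFans

variable {N : Type} [AddCommGroup N] [Module.Free ℤ N] [Module.Finite ℤ N]

/-- If the generators `v i k` of the rays of a complete fan are dual to simplex coordinates on the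
character lattice, then the cones `simplexCone v j` belong to the fan, and each of its cones lies
in one of them. -/
lemma Fan.IsComplete.simplexCone_mem {Δ : Fan N} (hΔ : Δ.IsComplete) {I : Type} [Fintype I]
    {n : I → ℕ} (S : SimplexCoordinates (Module.Dual ℤ N) n)
    (φ : (Σ i, Fin (n i + 1)) ≃ Δ.Ray)
    (hS : ∀ m i k, S.coord m i k = m (Δ.rayGenerator (φ ⟨i, k⟩))) :
    (∀ j, simplexCone (fun i k => Δ.rayGenerator (φ ⟨i, k⟩)) j ∈ Δ.cones) ∧
      ∀ τ : Δ.Cone, ∃ j, τ.1 ≤ simplexCone (fun i k => Δ.rayGenerator (φ ⟨i, k⟩)) j := by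
  classical
  set v : (i : I) → Fin (n i + 1) → N := fun i k => Δ.rayGenerator (φ ⟨i, k⟩) with hv
  have hray : ∀ ρ : Δ.Ray, ∃ i k, ρ = φ ⟨i, k⟩ := fun ρ =>
    ⟨(φ.symm ρ).1, (φ.symm ρ).2, (φ.apply_symm_apply ρ).symm⟩
  have hsum : ∀ i, ∑ k, v i k = 0 := fun i =>
    (Module.forall_dual_apply_eq_zero_iff ℤ _).1 fun m => by
      rw [map_sum, ← S.sum_coord m i]
      exact Finset.sum_congr rfl fun k _ => (hS m i k).symm
  have hle : ∀ τ : Δ.Cone, ∃ j, τ.1 ≤ simplexCone v j := by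
    intro τ
    -- A cone containing a whole row would contain a line.
    have hrow : ∀ i, ∃ k, latticePoint (v i k) ∉ τ.1 := by
      intro i
      by_contra hall
      push Not at hall
      have h1 : latticePoint (v i 0) + ∑ k ∈ Finset.univ.erase 0, latticePoint (v i k) = 0 := by
        rw [Finset.add_sum_erase _ (fun k => latticePoint (v i k))
          (Finset.mem_univ (0 : Fin (n i + 1))), ← latticePoint_sum, hsum, latticePoint_zero]
      have h2 : -latticePoint (v i 0) ∈ τ.1 := by
        rw [← eq_neg_of_add_eq_zero_right h1]
        exact Submodule.sum_mem _ fun k _ => hall k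
      have h3 := zero_of_mem_of_neg_mem (Δ.salient τ.1 τ.2) (hall 0) h2
      rw [← latticePoint_zero] at h3
      exact Δ.rayGenerator_ne_zero _ (latticePoint_injective h3)
    choose j hj using hrow
    refine ⟨j, ?_⟩
    conv_lhs => rw [Δ.hull_rayGenerators τ]
    refine Submodule.span_le.2 ?_
    rintro _ ⟨_, ⟨ρ, hρ, rfl⟩, rfl⟩
    obtain ⟨i, k, rfl⟩ := hray ρ
    refine latticePoint_mem_simplexCone (v := v) (i := i) (k := k) ?_
    rintro rfl
    exact hj i ((Δ.ray_le_iff _).1 hρ)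
  refine ⟨fun j => ?_, hle⟩
  -- The cone containing an interior point of `simplexCone v j`.
  set x : N := ∑ i, ∑ k ∈ Finset.univ.erase (j i), v i k with hx
  have hroot : ∀ i k l, (S.root i k l) x =
      (if k = j i then 0 else 1) - (if l = j i then 0 else 1) := by
    intro i k l
    have h1 : ∀ i' k', (S.root i k l) (v i' k') = S.coord (S.root i k l) i' k' := fun i' k' =>
      (hS _ _ _).symm
    simp only [hx, map_sum, h1]
    rw [Finset.sum_eq_single i]
    · simp only [S.coord_root_same, Finset.sum_sub_distrib, Finset.sum_ite_eq', Finset.mem_erase,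
        Finset.mem_univ, and_true, ne_eq, ite_not]
    · intro i' _ h
      exact Finset.sum_eq_zero fun k' _ => by rw [S.coord_root_of_ne h]
    · simp
  obtain ⟨τ, hτ, hxτ⟩ := hΔ (latticePoint x)
  have hpos : ∀ m ∈ dualSemigroup τ, 0 ≤ m x := fun m hm => by
    have := hm _ hxτ
    rw [realFunctional_latticePoint] at this
    exact_mod_cast this
  obtain ⟨j', hj'⟩ := hle ⟨τ, hτ⟩
  have hjj : j' = j := by
    funext i
    by_contra hne
    have h1 : S.root i (j i) (j' i) ∈ dualSemigroup τ := by
      refine dualSemigroup_anti hj' ?_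
      rw [dualSemigroup_simplexCone S hS]
      exact S.root_mem_chartMonoid j' i (j i)
    have h2 := hpos _ h1
    rw [hroot, if_pos rfl, if_neg hne] at h2
    omega
  subst hjj
  have hall : ∀ i k, k ≠ j' i → latticePoint (v i k) ∈ τ := by
    intro i k hk
    by_contra hno
    have h1 : -S.root i k (j' i) ∈ dualSemigroup τ := by
      refine (Δ.mem_dualSemigroup_iff ⟨τ, hτ⟩).2 fun ρ hρ => ?_
      obtain ⟨i', k', rfl⟩ := hray ρ
      rw [LinearMap.neg_apply, ← hS]
      by_cases hi : i' = i
      · subst hi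
        have hkk : k' ≠ k := by
          rintro rfl
          exact hno ((Δ.ray_le_iff _).1 hρ)
        rw [S.coord_root_same, if_neg hkk]
        split_ifs <;> norm_num
      · rw [S.coord_root_of_ne hi]
        simp
    have h2 := hpos _ h1
    rw [LinearMap.neg_apply, hroot, if_neg hk, if_pos rfl] at h2
    omega
  have heq : simplexCone v j' = τ := by
    refine le_antisymm (Submodule.span_le.2 ?_) hj'
    rintro _ ⟨_, ⟨i, k, hk, rfl⟩, rfl⟩
    exact hall i k hk
  rw [heq]
  exact hτ

namespace Fan

variable {Δ : Fan N}

open scoped Classical in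
/-- Two variables have the same degree if and only if `x_ρ / x_ρ'` is the divisor of a character. -/
lemma divisorClass_eq_iff {ρ ρ' : Δ.Ray} : Δ.divisorClass ρ = Δ.divisorClass ρ' ↔
    ∃ m : Module.Dual ℤ N, ∀ ρ'', m (Δ.rayGenerator ρ'') =
      (if ρ'' = ρ then 1 else 0) - (if ρ'' = ρ' then 1 else 0) := by
  rw [eq_comm, divisorClass, divisorClass, QuotientAddGroup.eq]
  refine exists_congr fun m => ?_
  rw [funext_iff]
  refine forall_congr' fun ρ'' => ?_
  simp only [Pi.add_apply, Pi.neg_apply, Pi.single_apply, neg_add_eq_sub]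
  rfl

open scoped Classical in
/-- A semisimple root takes the value `1` at one ray generator, `-1` at another one and `0` at all
others. -/
lemma exists_of_mem_semisimpleRoots {m : Module.Dual ℤ N} (hm : m ∈ Δ.semisimpleRoots) :
    ∃ ρ ρ' : Δ.Ray, ∀ ρ'', m (Δ.rayGenerator ρ'') =
      (if ρ'' = ρ then 1 else 0) - (if ρ'' = ρ' then 1 else 0) := by
  obtain ⟨⟨τ, hτ, hτ'⟩, τ₁, hτ₁, hτ₁'⟩ := hm
  simp only [LinearMap.neg_apply] at hτ₁ hτ₁'
  refine ⟨τ₁, τ, fun ρ => ?_⟩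
  by_cases h : ρ = τ
  · subst h
    have hne : ρ ≠ τ₁ := by rintro rfl; omega
    rw [hτ, if_neg hne, if_pos rfl]; norm_num
  · by_cases h1 : ρ = τ₁
    · subst h1
      rw [if_pos rfl, if_neg h]; omega
    · have h2 := hτ' ρ h
      have h3 := hτ₁' ρ h1
      rw [if_neg h, if_neg h1]; omega

/-- The semisimple roots separate the points of `N`. -/
lemma HasIndependentSemisimpleRoots.eq_zero (H : Δ.HasIndependentSemisimpleRoots) {w : N}
    (h : ∀ m ∈ Δ.semisimpleRoots, m w = 0) : w = 0 := by
  obtain ⟨b, hb, hli⟩ := H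
  have hfin : Fintype.card (Fin (Module.finrank ℤ N)) =
      Module.finrank ℝ (Module.Dual ℝ (ℝ ⊗[ℤ] N)) := by
    rw [Subspace.dual_finrank_eq, Module.finrank_baseChange, Fintype.card_fin]
  have hspan := hli.span_eq_top_of_card_eq_finrank' hfin
  refine latticePoint_injective ?_
  rw [latticePoint_zero]
  refine (Module.forall_dual_apply_eq_zero_iff ℝ _).1 fun f => ?_
  have hf : f ∈ Submodule.span ℝ (Set.range fun i => realFunctional (b i)) := by
    rw [hspan]; trivial
  induction hf using Submodule.span_induction with
  | mem f hf =>
    obtain ⟨i, rfl⟩ := hf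
    change realFunctional (b i) (latticePoint w) = 0
    rw [realFunctional_latticePoint, h _ (hb i), Int.cast_zero]
  | zero => rfl
  | add f g _ _ hf hg => rw [LinearMap.add_apply, hf, hg, add_zero]
  | smul a f _ hf => rw [LinearMap.smul_apply, hf, smul_zero]

open scoped Classical in
/-- The ray generators of each degree class sum to zero. -/
lemma HasIndependentSemisimpleRoots.sum_eq_zero [Fintype Δ.Ray]
    (H : Δ.HasIndependentSemisimpleRoots) (c : Δ.ClassGroup) :
    ∑ ρ with Δ.divisorClass ρ = c, Δ.rayGenerator ρ = 0 := by
  refine H.eq_zero fun m hm => ?_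
  obtain ⟨ρ, ρ', h⟩ := exists_of_mem_semisimpleRoots hm
  have hcl : Δ.divisorClass ρ = Δ.divisorClass ρ' := divisorClass_eq_iff.2 ⟨m, h⟩
  simp only [map_sum, h, Finset.sum_sub_distrib, Finset.sum_ite_eq', Finset.mem_filter,
    Finset.mem_univ, true_and, hcl, sub_self]

/-- The characters of a complete fan with independent semisimple roots are the integer vectors on
the rays whose sum over each degree class is zero. -/
def HasIndependentSemisimpleRoots.simplexCoordinates (H : Δ.HasIndependentSemisimpleRoots)
    (hΔ : Δ.IsComplete) {I : Type} [Finite I] {n : I → ℕ} (φ : (Σ i, Fin (n i + 1)) ≃ Δ.Ray)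
    (hφ : ∀ p q, Δ.divisorClass (φ p) = Δ.divisorClass (φ q) ↔ p.1 = q.1) :
    SimplexCoordinates (Module.Dual ℤ N) n where
  coord :=
    { toFun := fun m i k => m (Δ.rayGenerator (φ ⟨i, k⟩))
      map_zero' := rfl
      map_add' := fun _ _ => rfl }
  injective := by
    refine (injective_iff_map_eq_zero _).2 fun m hm => hΔ.eq_zero fun ρ => ?_
    obtain ⟨⟨i, k⟩, rfl⟩ := φ.surjective ρ
    exact (congrFun (congrFun hm i) k).ge
  mem_range := by
    classical
    have : Fintype Δ.Ray := Fintype.ofFinite _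
    have : Fintype I := Fintype.ofFinite _
    intro a
    constructor
    · rintro ⟨m, rfl⟩ i
      have h1 : ∑ k, Δ.rayGenerator (φ ⟨i, k⟩) =
          ∑ ρ with Δ.divisorClass ρ = Δ.divisorClass (φ ⟨i, 0⟩), Δ.rayGenerator ρ := by
        refine Finset.sum_bij (fun k _ => φ ⟨i, k⟩) (fun k _ => ?_) (fun k _ l _ h => ?_)
          (fun ρ hρ => ?_) fun _ _ => rfl
        · exact Finset.mem_filter.2 ⟨Finset.mem_univ _, (hφ _ _).2 rfl⟩
        · simpa using φ.injective h
        · obtain ⟨⟨i', k⟩, rfl⟩ := φ.surjective ρ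
          obtain rfl : i' = i := (hφ _ _).1 (Finset.mem_filter.1 hρ).2
          exact ⟨k, Finset.mem_univ _, rfl⟩
      change ∑ k, m (Δ.rayGenerator (φ ⟨i, k⟩)) = 0
      rw [← map_sum, h1, H.sum_eq_zero, map_zero]
    · intro ha
      have hM : ∀ (i : I) (k : Fin (n i + 1)), ∃ m : Module.Dual ℤ N, ∀ (i' : I)
          (k' : Fin (n i' + 1)), m (Δ.rayGenerator (φ ⟨i', k'⟩)) =
            (if (⟨i', k'⟩ : Σ i, Fin (n i + 1)) = ⟨i, k⟩ then 1 else 0) -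
              (if (⟨i', k'⟩ : Σ i, Fin (n i + 1)) = ⟨i, 0⟩ then 1 else 0) := by
        intro i k
        obtain ⟨m, hm⟩ := divisorClass_eq_iff.1 ((hφ ⟨i, k⟩ ⟨i, 0⟩).2 rfl)
        refine ⟨m, fun i' k' => ?_⟩
        rw [hm]
        simp only [φ.injective.eq_iff]
      choose M hM using hM
      refine ⟨∑ i, ∑ k, a i k • M i k, ?_⟩
      funext i' k'
      change (∑ i, ∑ k, a i k • M i k) (Δ.rayGenerator (φ ⟨i', k'⟩)) = a i' k'
      simp only [LinearMap.sum_apply, LinearMap.smul_apply, hM, smul_eq_mul]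
      rw [Finset.sum_eq_single i']
      · simp only [mul_sub, Finset.sum_sub_distrib, ← Finset.sum_mul, ha i', zero_mul, sub_zero]
        simp
      · intro i _ hi
        refine Finset.sum_eq_zero fun k _ => ?_
        rw [if_neg, if_neg, sub_self, mul_zero]
        · rintro h; exact hi (congrArg Sigma.fst h).symm
        · rintro h; exact hi (congrArg Sigma.fst h).symm
      · simp

/-- A complete fan with independent semisimple roots, whose rays are enumerated in rows which are
the degree classes, defines a product of projective spaces. -/
theorem HasIndependentSemisimpleRoots.nonempty_iso (H : Δ.HasIndependentSemisimpleRoots)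
    (hΔ : Δ.IsComplete) {I : Type} [Finite I] {n : I → ℕ} (φ : (Σ i, Fin (n i + 1)) ≃ Δ.Ray)
    (hφ : ∀ p q, Δ.divisorClass (φ p) = Δ.divisorClass (φ q) ↔ p.1 = q.1) :
    Nonempty (Δ.toricVariety ≅ productOfProjectiveSpaces n) := by
  have : Fintype I := Fintype.ofFinite _
  let S := H.simplexCoordinates hΔ φ hφ
  obtain ⟨h1, h2⟩ := hΔ.simplexCone_mem S φ fun _ _ _ => rfl
  exact toricVariety_iso_product Δ S _ (fun _ _ _ => rfl) h1 h2

lemma variablesOfDegree_eq (c : Δ.ClassGroup) :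
    Δ.variablesOfDegree c = MvPolynomial.X '' {ρ | Δ.divisorClass ρ = c} := by
  ext x
  constructor
  · rintro ⟨⟨ρ, rfl⟩, hx⟩
    exact ⟨ρ, MvPolynomial.IsWeightedHomogeneous.inj_right (MvPolynomial.X_ne_zero ρ)
      (MvPolynomial.isWeightedHomogeneous_X ℂ Δ.divisorClass ρ) hx, rfl⟩
  · rintro ⟨ρ, rfl, rfl⟩
    exact ⟨⟨ρ, rfl⟩, MvPolynomial.isWeightedHomogeneous_X ℂ Δ.divisorClass ρ⟩

lemma ncard_variablesOfDegree (c : Δ.ClassGroup) :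
    (Δ.variablesOfDegree c).ncard = Nat.card {ρ : Δ.Ray // Δ.divisorClass ρ = c} := by
  rw [variablesOfDegree_eq, Set.ncard_image_of_injective _ (MvPolynomial.X_injective)]
  rfl

/-- Every variable has the same degree as some other one. -/
lemma HasIndependentSemisimpleRoots.two_le_ncard (H : Δ.HasIndependentSemisimpleRoots)
    (ρ : Δ.Ray) : 2 ≤ (Δ.variablesOfDegree (Δ.divisorClass ρ)).ncard := by
  classical
  have : Fintype Δ.Ray := Fintype.ofFinite _
  have hne : ∃ ρ', Δ.divisorClass ρ' = Δ.divisorClass ρ ∧ ρ' ≠ ρ := by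
    by_contra hno
    push Not at hno
    have h1 := H.sum_eq_zero (Δ.divisorClass ρ)
    rw [Finset.sum_eq_single ρ] at h1
    · exact Δ.rayGenerator_ne_zero ρ h1
    · intro ρ' hρ' h
      exact absurd (hno ρ' (by simpa using hρ')) h
    · intro h
      exact absurd (by simp) h
  obtain ⟨ρ', h, hne⟩ := hne
  rw [ncard_variablesOfDegree]
  exact Nat.succ_le_of_lt (Finite.one_lt_card_iff_nontrivial.2
    ⟨⟨ρ', h⟩, ⟨ρ, rfl⟩, fun hh => hne (congrArg Subtype.val hh)⟩)

/-- The rays, enumerated by degree class. -/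
lemma HasIndependentSemisimpleRoots.exists_enumeration (H : Δ.HasIndependentSemisimpleRoots) :
    ∃ φ : (Σ i : Δ.BigDegree, Fin ((Δ.degreeClass i).ncard - 1 + 1)) ≃ Δ.Ray,
      ∀ i k, Δ.divisorClass (φ ⟨i, k⟩) = i.1 := by
  have hcard : ∀ i : Δ.BigDegree, Nat.card (Fin ((Δ.degreeClass i).ncard - 1 + 1)) =
      Nat.card {ρ : Δ.Ray // Δ.divisorClass ρ = i.1} := by
    intro i
    have h2 := i.2
    rw [Nat.card_fin, ← ncard_variablesOfDegree]
    change (Δ.variablesOfDegree i.1).ncard - 1 + 1 = _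
    omega
  have e := fun i : Δ.BigDegree => (Finite.card_eq.1 (hcard i)).some
  refine ⟨Equiv.ofBijective (fun p => (e p.1 p.2).1) ⟨?_, fun ρ => ?_⟩, fun i k => (e i k).2⟩
  · rintro ⟨i, k⟩ ⟨i', k'⟩ h
    obtain rfl : i = i' := Subtype.ext (by
      rw [← (e i k).2, ← (e i' k').2]
      exact congrArg _ h)
    obtain rfl : k = k' := (e i).injective (Subtype.ext h)
    rfl
  · let i : Δ.BigDegree := ⟨Δ.divisorClass ρ, H.two_le_ncard ρ⟩
    exact ⟨⟨i, (e i).symm ⟨ρ, rfl⟩⟩, by simp⟩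

/-- The factors are indexed by the degrees of at least two variables, since every variable has such
a degree. -/
theorem HasIndependentSemisimpleRoots.nonempty_iso_degreeClass
    (H : Δ.HasIndependentSemisimpleRoots) (hΔ : Δ.IsComplete) :
    Nonempty (Δ.toricVariety ≅ productOfProjectiveSpaces
      fun i : Δ.BigDegree => (Δ.degreeClass i).ncard - 1) := by
  obtain ⟨φ, hφ⟩ := H.exists_enumeration
  refine H.nonempty_iso hΔ φ ?_
  rintro ⟨i, k⟩ ⟨i', k'⟩
  rw [hφ, hφ]
  exact Subtype.ext_iff.symm

theorem HasIndependentSemisimpleRoots.exists_iso (H : Δ.HasIndependentSemisimpleRoots)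
    (hΔ : Δ.IsComplete) : ∃ (k : ℕ) (n : Fin k → ℕ),
      Nonempty (Δ.toricVariety ≅ productOfProjectiveSpaces n) := by
  obtain ⟨φ, hφ⟩ := H.exists_enumeration
  obtain ⟨k, ⟨e⟩⟩ := Finite.exists_equiv_fin Δ.BigDegree
  let n : Fin k → ℕ := fun j => (Δ.degreeClass (e.symm j)).ncard - 1
  let ψ : (Σ j, Fin (n j + 1)) ≃ Σ i : Δ.BigDegree, Fin ((Δ.degreeClass i).ncard - 1 + 1) :=
    e.symm.sigmaCongrLeft (β := fun i : Δ.BigDegree => Fin ((Δ.degreeClass i).ncard - 1 + 1))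
  refine ⟨k, n, H.nonempty_iso hΔ (ψ.trans φ) ?_⟩
  rintro ⟨j, l⟩ ⟨j', l'⟩
  have h : ∀ (j : Fin k) (l : Fin (n j + 1)), Δ.divisorClass ((ψ.trans φ) ⟨j, l⟩) = (e.symm j).1 :=
    fun j l => hφ _ _
  rw [h, h]
  exact Subtype.ext_iff.symm.trans e.symm.injective.eq_iff

end Fan

end SemisimpleFans

end ToricGeometry

end

theorem mainTheorem3 {N : Type} [AddCommGroup N] [Module.Free ℤ N] [Module.Finite ℤ N]
    (Δ : ToricGeometry.Fan N) (hΔ : Δ.IsComplete) :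
    ((∃ (k : ℕ) (n : Fin k → ℕ),
        Nonempty (Δ.toricVariety ≅ ToricGeometry.productOfProjectiveSpaces n)) ↔
      Δ.HasIndependentSemisimpleRoots) ∧
    (Δ.HasIndependentSemisimpleRoots →
      Nonempty (Δ.toricVariety ≅ ToricGeometry.productOfProjectiveSpaces
        fun i : Δ.BigDegree => (Δ.degreeClass i).ncard - 1)) := by
  refine ⟨⟨?_, fun H => H.exists_iso hΔ⟩, fun H => H.nonempty_iso_degreeClass hΔ⟩
  rintro ⟨k, n, ⟨e⟩⟩
  exact hΔ.hasIndependentSemisimpleRoots fun σ hσ u hu => hΔ.neg_mem_roots_of_iso e hσ hu
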